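/- **Setting.** Let $(X,d)$ be a metric space, $k\ge 1$ an integer, $h>0$ (half-life), and let $p_1,\dots,p_n\in X$, $n\ge1$, be a stream in which every nonzero distance between two points is at least $1$ and the ratio of any distance to any nonzero distance is at most $\Delta$ ($\Delta\ge1$). The $t$-th point has weight $w_t=2^{t/h}$ (up to a common factor this is exponential decay with half-life $h$). For a nonempty finite $S\subseteq X$ let $\mathrm{COST}(P,S)=\sum_{t\le n} w_t\min_{s\in S}d(p_t,s)$, and let $\mathrm{OPT}_k(P)$ be its infimum over all nonempty $S\subseteq X$ with $|S|\le k$. An offline $c$-approximate $k$-median algorithm KM-RAM takes a finite weighted set $C$ and returns a set of $\min(k,|C|)$ points of $C$ whose cost $\lambda$ on $C$ is at most $c$ times the least cost of at most $k$ centres chosen in $C$. Let $W_0=\sum_{0\le i<M}2^{i/h}$ with $M=\max(1,\lceil h\log_2\Delta\rceil)$, and let $W\ge W_0$ be a number with $W=O(h\Delta)$. **Algorithm** (parameters $\beta,\gamma$). Start with the guess $L=1$ and the facility set $C=\emptyset$. Work in phases. Each phase starts with service cost $0$ and uses the facility cost $f=L/(k(1+\log_2W))$. *First sub-phase:* read the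 next point $p$, of weight $w$; let $q$ be a closest point to $p$ in $C$. With probability $\min(w\,d(p,q)/f,1)$ (probability $1$ if $C=\emptyset$) add $p$ with weight $w$ to $C$; otherwise add $w\,d(p,q)$ to the service cost of the phase and $w$ to the weight of $q$. If now the service cost exceeds $\gamma L$ or $|C|>(\gamma-1)k(1+\log_2W)$, there is a phase change; otherwise, once at least $h\log_2\Delta$ points have been read in the phase, go to the second sub-phase. *Second sub-phase:* add all points read, with their weights, to $C$; as soon as at least $h+k$ distinct points have been read in this sub-phase, there is a phase change. *Phase change:* replace $C$ by the output of KM-RAM on the weighted set $C$, moving the weight of each old facility to a closest new one, replace $L$ by $\max(\beta L,\lambda/(c\gamma))$, and start a new phase. When the output is wanted, run KM-RAM on the weighted set $C$. To raise the success probability, run $r$ independent instances in parallel and use one with the smallest $L$. **Theorem.** Let $1<\beta\le2$, $\gamma\ge9$, $c\ge1$. There are constants $K,a>0$ that depend only on $\beta,\gamma,c$ such that for every $\delta\in(0,1)$ and every $r\ge a\log(1/\delta)$, after any $n$ points, with probability at least $1-\delta$ the output is a set of $k$ points (all the distinct points of the stream if there are fewer than $k$) with $\mathrm{COST}(P,\text{output})\le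 K\cdot\mathrm{OPT}_k(P)$. In every outcome, if KM-RAM takes $O(mk)$ steps on inputs of $m$ points, the $r$ instances take time $O(r\,nk\log(2+h\Delta))$ in total, and if KM-RAM uses $O(m)$ memory on inputs of $m$ points, they use space $O(r\,(k\log(2+h\Delta)+h))$. Here the implied constants depend only on $\beta,\gamma,c$ and on the constants in $W=O(h\Delta)$ and in the resource bounds of KM-RAM. (Time counts one step per distance evaluation or arithmetic operation, and $O(\log|C|)$ for a look-up among the stored points; space counts points and numbers.) -/

import Mathlib

universe u

noncomputable section

namespace ExpDecay

/-! ### Weighted `k`-median -/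

/-- `k`-median cost of the weighted finite set `(S, w)` for the (nonempty) set of centres `K`:
every point pays its weight times its distance to the nearest centre. -/
def medianCost {X : Type u} [MetricSpace X] (S : Finset X) (w : X → ℝ) (K : Finset X) : ℝ :=
  ∑ q ∈ S, w q * Metric.infDist q (K : Set X)

/-- Weight of the point that arrives at time `t + 1` (stream indices start at `0`). Only ratios of
weights matter, and arriving one time unit earlier means a weight smaller by the factor
`2 ^ (-1 / h)`, so this is exponential decay with half-life `h`. -/
def streamWeight (h : ℝ) (t : ℕ) : ℝ := (2 : ℝ) ^ (((t : ℝ) + 1) / h)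

/-- `k`-median cost of the first `n` points of the stream `p`, with exponentially decaying
weights, for the set of centres `K`. -/
def streamCost {X : Type u} [MetricSpace X] (h : ℝ) (p : ℕ → X) (n : ℕ) (K : Finset X) : ℝ :=
  ∑ t ∈ Finset.range n, streamWeight h t * Metric.infDist (p t) (K : Set X)

/-- Optimal value of a cost `φ` over the nonempty sets of at most `k` centres taken from `Y`. -/
def medianOpt {X : Type u} (k : ℕ) (Y : Set X) (φ : Finset X → ℝ) : ℝ :=
  sInf (φ '' {K : Finset X | K.Nonempty ∧ K.card ≤ k ∧ (K : Set X) ⊆ Y})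

/-- An offline `c`-approximate `k`-median algorithm, which the streaming algorithm receives as an
input: from a weighted finite set it extracts `k` of its points (all of them, if there are fewer),
of cost at most `c` times the optimum over centres in the set. `time` and `space` are the number of
steps and the number of words of working memory that it uses. -/
structure OfflineKMedian (X : Type u) [MetricSpace X] (k : ℕ) (c : ℝ) where
  solve : Finset X → (X → ℝ) → Finset X
  time : Finset X → (X → ℝ) → ℕ
  space : Finset X → (X → ℝ) → ℕ
  solve_subset : ∀ S w, solve S w ⊆ S
  solve_card : ∀ S w, (solve S w).card = min k S.card
  solve_cost : ∀ S w, S.Nonempty → (∀ q ∈ S, 0 ≤ w q) →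
    medianCost S w (solve S w) ≤ c * medianOpt k (S : Set X) (medianCost S w)

/-! ### The streaming algorithm -/

/-- Parameters: number of centres `k`, half-life `h`, (bound on the) aspect ratio `Δ`, weight
bound `W`, growth factor `β` of the guesses, threshold factor `γ`, and the approximation factor
`c` of the offline algorithm. -/
structure Params where
  k : ℕ
  h : ℝ
  Δ : ℝ
  W : ℝ
  β : ℝ
  γ : ℝ
  c : ℝ

/-- Total weight of the points which one first sub-phase can read, divided by the smallest of
these weights. A first sub-phase reads points until there are at least `h log₂ Δ` of them (and at
least one). -/
def phaseWeight (h Δ : ℝ) : ℝ :=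
  ∑ i ∈ Finset.range (max 1 ⌈h * Real.logb 2 Δ⌉₊), (2 : ℝ) ^ ((i : ℝ) / h)

/-- State of one instance. The last two fields only record the resources used so far. -/
structure State (X : Type u) where
  /-- current guess `L` -/
  guess : ℝ
  /-- current facilities -/
  fac : Finset X
  /-- weights of the facilities -/
  wt : X → ℝ
  /-- service cost of the current phase -/
  svc : ℝ
  /-- number of points read in the first sub-phase of the current phase -/
  count : ℕ
  /-- whether the current phase is in its second sub-phase -/
  verbatim : Bool
  /-- the distinct points read in the second sub-phase of the current phase -/
  seen : Finset X
  /-- number of points read since the start of the stream -/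
  clock : ℕ
  /-- number of elementary steps so far -/
  time : ℕ
  /-- largest number of memory words used so far -/
  peak : ℕ

/-- A closest point of `C` to `x` (`x` itself if `C` is empty). -/
def nearest {X : Type u} [MetricSpace X] (C : Finset X) (x : X) : X :=
  open Classical in
  if hC : C.Nonempty then (C.exists_min_image (fun q => dist x q) hC).choose else x

/-- Memory words in use: two for each facility with its weight, one for each point of `seen`, and
a constant number of scalars. -/
def State.words {X : Type u} (s : State X) : ℕ := 2 * s.fac.card + s.seen.card + 8

/-- Update the record of the largest memory use. -/
def State.record {X : Type u} (s : State X) : State X :=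
  { s with peak := max s.peak s.words }

/-- Initial state: `L = 1`, no facilities. -/
def State.init (X : Type u) : State X where
  guess := 1
  fac := ∅
  wt := fun _ => 0
  svc := 0
  count := 0
  verbatim := false
  seen := ∅
  clock := 0
  time := 0
  peak := 8

/-- `1 + log₂ W`. -/
def Params.logFactor (A : Params) : ℝ := 1 + Real.logb 2 A.W

/-- Facility cost `f` for the guess `L`. -/
def Params.facilityCost (A : Params) (L : ℝ) : ℝ := L / (A.k * A.logFactor)

/-- Phase change: the facilities are clustered by the offline algorithm, each facility hands its
weight over to a closest remaining one, and the guess becomes `max (β L) (lam / (c γ))`, where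
`lam` is the cost of that clustering. Besides the offline algorithm, one step is charged for each
pair of an old facility and a new centre. -/
def phaseChange {X : Type u} [MetricSpace X] [DecidableEq X] (A : Params)
    (KM : OfflineKMedian X A.k A.c) (s : State X) : State X :=
  let S := KM.solve s.fac s.wt
  let lam := medianCost s.fac s.wt S
  { guess := max (A.β * s.guess) (lam / (A.c * A.γ))
    fac := S
    wt := fun q => ∑ x ∈ s.fac.filter (fun x => nearest S x = q), s.wt x
    svc := 0
    count := 0
    verbatim := false
    seen := ∅
    clock := s.clock
    time := s.time + KM.time s.fac s.wt + A.k * s.fac.card + 1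
    peak := max s.peak (s.words + KM.space s.fac s.wt + 2 * A.k) }

/-- Probability of opening a facility at the new point `x`, of weight `w`. -/
def openProb {X : Type u} [MetricSpace X] [DecidableEq X] (A : Params) (s : State X)
    (x : X) (w : ℝ) : NNReal :=
  if s.fac = ∅ then 1
  else min (Real.toNNReal (w * dist x (nearest s.fac x) / A.facilityCost s.guess)) 1

theorem openProb_le_one {X : Type u} [MetricSpace X] [DecidableEq X] (A : Params) (s : State X)
    (x : X) (w : ℝ) : openProb A s x w ≤ 1 := by
  unfold openProb
  split_ifs
  · exact le_rfl
  · exact min_le_right _ _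

/-- A coin that shows `true` with probability `q`. -/
def coin (q : NNReal) (hq : q ≤ 1) : PMF Bool :=
  PMF.ofFintype (fun b => if b then (q : ENNReal) else ((1 - q : NNReal) : ENNReal)) (by
    rw [Fintype.sum_bool]
    simp only [if_true, Bool.false_eq_true, if_false]
    rw [← ENNReal.coe_add, add_tsub_cancel_of_le hq, ENNReal.coe_one])

/-- Online facility location on the point `x` of weight `w`, once the coin is flipped: on `true` a
facility is opened at `x`, otherwise the closest facility serves `x`. The search for the closest
facility takes one step per facility. -/
def oflUpdate {X : Type u} [MetricSpace X] [DecidableEq X] (s : State X) (x : X) (w : ℝ)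
    (heads : Bool) : State X :=
  let q := nearest s.fac x
  { guess := s.guess
    fac := if heads then insert x s.fac else s.fac
    wt := if heads then Function.update s.wt x (s.wt x + w)
      else Function.update s.wt q (s.wt q + w)
    svc := if heads then s.svc else s.svc + w * dist x q
    count := s.count + 1
    verbatim := false
    seen := s.seen
    clock := s.clock + 1
    time := s.time + s.fac.card + 1
    peak := s.peak }

/-- The test after a point of the first sub-phase: change the phase if the service cost or the
number of facilities is too large; otherwise go to the second sub-phase if at least `h log₂ Δ`
points have been read. -/
def oflCheck {X : Type u} [MetricSpace X] [DecidableEq X] (A : Params)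
    (KM : OfflineKMedian X A.k A.c) (s : State X) : State X :=
  if A.γ * s.guess < s.svc ∨ (A.γ - 1) * A.k * A.logFactor < (s.fac.card : ℝ) then
    phaseChange A KM s
  else if A.h * Real.logb 2 A.Δ ≤ (s.count : ℝ) then { s with verbatim := true }
  else s

/-- A point `x` of weight `w` in the second sub-phase is stored as it is. Finding out whether it is
stored already is charged as a search in a balanced search tree. -/
def storeUpdate {X : Type u} [DecidableEq X] (s : State X) (x : X) (w : ℝ) : State X :=
  { s with
    fac := insert x s.fac
    wt := Function.update s.wt x (s.wt x + w)
    seen := insert x s.seen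
    clock := s.clock + 1
    time := s.time + Nat.log 2 (s.fac.card + 1) + 1 }

/-- The test after a point of the second sub-phase: change the phase once this sub-phase has seen
`h + k` distinct points. -/
def storeCheck {X : Type u} [MetricSpace X] [DecidableEq X] (A : Params)
    (KM : OfflineKMedian X A.k A.c) (s : State X) : State X :=
  if A.h + A.k ≤ (s.seen.card : ℝ) then phaseChange A KM s else s

/-- Processing the next point `x` of the stream, as a random state. -/
def step {X : Type u} [MetricSpace X] [DecidableEq X] (A : Params)
    (KM : OfflineKMedian X A.k A.c) (x : X) (s : State X) : PMF (State X) :=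
  let w := streamWeight A.h s.clock
  if s.verbatim then PMF.pure (storeCheck A KM (storeUpdate s x w).record)
  else
    (coin (openProb A s x w) (openProb_le_one A s x w)).bind fun heads =>
      PMF.pure (oflCheck A KM (oflUpdate s x w heads).record)

/-- Processing the next point in a list of independent parallel instances. -/
def stepAll {X : Type u} [MetricSpace X] [DecidableEq X] (A : Params)
    (KM : OfflineKMedian X A.k A.c) (x : X) : List (State X) → PMF (List (State X))
  | [] => PMF.pure []
  | s :: l => (step A KM x s).bind fun s' => (stepAll A KM x l).bind fun l' => PMF.pure (s' :: l')

/-- The states of `r` independent parallel instances after the first `n` points of the stream. -/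
def run {X : Type u} [MetricSpace X] [DecidableEq X] (A : Params)
    (KM : OfflineKMedian X A.k A.c) (p : ℕ → X) (r : ℕ) : ℕ → PMF (List (State X))
  | 0 => PMF.pure (List.replicate r (State.init X))
  | n + 1 => (run A KM p r n).bind (stepAll A KM (p n))

/-- The output: the facilities of an instance with the smallest guess, clustered by the offline
algorithm. -/
def output {X : Type u} [MetricSpace X] {k : ℕ} {c : ℝ} (KM : OfflineKMedian X k c)
    (l : List (State X)) : Finset X :=
  match l.argmin State.guess with
  | none => ∅
  | some s => KM.solve s.fac s.wt

/-- Total number of steps of all instances, including the computation of the output. -/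
def totalTime {X : Type u} [MetricSpace X] {k : ℕ} {c : ℝ} (KM : OfflineKMedian X k c)
    (l : List (State X)) : ℕ :=
  (l.map State.time).sum + l.length +
    match l.argmin State.guess with
    | none => 0
    | some s => KM.time s.fac s.wt

/-- Total memory of all instances (sum of their peaks), including the computation of the output. -/
def totalSpace {X : Type u} [MetricSpace X] {k : ℕ} {c : ℝ} (KM : OfflineKMedian X k c)
    (l : List (State X)) : ℕ :=
  (l.map State.peak).sum + k +
    match l.argmin State.guess with
    | none => 0
    | some s => KM.space s.fac s.wt

/-! ### Assumption on the stream -/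

/-- Among the first `n` points of the stream, nonzero distances are at least `1` and the ratio of
any distance to any nonzero distance is at most `Δ`. -/
def AspectRatioLE {X : Type u} [MetricSpace X] (p : ℕ → X) (n : ℕ) (Δ : ℝ) : Prop :=
  ∀ a < n, ∀ b < n, p a ≠ p b →
    1 ≤ dist (p a) (p b) ∧ ∀ i < n, ∀ j < n, dist (p i) (p j) ≤ Δ * dist (p a) (p b)

end ExpDecay

end

noncomputable section

set_option linter.unusedSectionVars false

namespace ExpDecay

/-! In every outcome the weighted facilities arise by moving the weights of the stream points, at a
total cost of at most a constant times the guess `L`. A phase adds at most `(γ + 1) L`, the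
clustering at its end at most `c γ` times the new guess, and the guesses grow at least by the factor
`β`, so these payments form a geometric series (`WeakInv`, `phaseChange_inv`). Hence an instance
outputs centres of cost `O(L + OPT)` (`Inv.streamCost_solve_le`). What remains is that a single
instance ends with `L = O(OPT)` with probability at least 1/4 (`value_init_le`). Since the instances
are independent and the smallest guess is used, all fail together with probability at most `(3/4) ^
r`.

Fix centres `S` of cost `O ≤ 2 OPT`, let `D` be the largest distance, and let `T` be the last time
with `h D w_T ≤ 2 O`.

After `T`: if a phase starts later and completes its second sub-phase, that sub-phase holds at least
`h` distinct points at distance at least `D / (2 Δ)` from `S`, whose weights are at least `Δ` times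
the weight at the start of the phase. They would cost more than `O`
(`BoundedStream.le_two_mul_streamCost`). So a late phase can end only by an overflow of its first
sub-phase. There the expected expense of online facility location is charged either to the cost of
`S` or to a halving of the distance from a centre to the facilities, and with suitable scales each
centre allows at most `1 + log₂ W` halvings. The supermartingale `critPot` turns this into an
overflow probability of at most 1/2 once `L > 16 O` (`value_le_critPot`). The first guess above `16
O` comes from one below it, so it is at most `jumpFactor * 16 O` (`value_le_half`).

Up to `T`: all points read before time `t` cost at most `2 h D w_t` with a single centre, so only
the factor `β` can carry the guess beyond this order. `longRunPot` measures by how much the guess,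
discounted by one half per period, exceeds a multiple of `costScale`. A completed phase lasts at
least a period and `β ≤ 2`, so it does not raise the excess. A service overflow happens only below
the threshold. An overflow of the number of facilities does raise the excess, but its expected
effect, prepaid as `credit` while facilities open, is covered by the growth of `costScale`. By
Markov's inequality the guess at time `T` is at most `16 O` with probability at least 3/4
(`value_le_longRunPot`).

Time is amortised: a phase reads at least `k` points and has at most twice as many facilities as
points, which pays for its clustering. -/

/-! ### Weights -/

theorem log_two_mul_le (y : ℝ) : Real.log 2 * y ≤ (2 : ℝ) ^ y - 1 := by
  rw [Real.rpow_def_of_pos (by norm_num : (0 : ℝ) < 2)]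
  have := Real.add_one_le_exp (Real.log 2 * y)
  linarith

theorem streamWeight_pos (h : ℝ) (t : ℕ) : 0 < streamWeight h t :=
  Real.rpow_pos_of_pos (by norm_num) _

theorem one_le_streamWeight {h : ℝ} (hh : 0 < h) (t : ℕ) : 1 ≤ streamWeight h t :=
  Real.one_le_rpow (by norm_num) (by positivity)

theorem streamWeight_add (h : ℝ) (a i : ℕ) :
    streamWeight h (a + i) = streamWeight h a * (2 : ℝ) ^ ((i : ℝ) / h) := by
  unfold streamWeight
  rw [← Real.rpow_add (by norm_num)]
  push_cast
  ring_nf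

theorem streamWeight_succ (h : ℝ) (t : ℕ) :
    streamWeight h (t + 1) = streamWeight h t * (2 : ℝ) ^ (1 / h) := by
  simpa using streamWeight_add h t 1

theorem streamWeight_mono {h : ℝ} (hh : 0 < h) : Monotone (streamWeight h) := by
  intro a b hab
  unfold streamWeight
  refine Real.rpow_le_rpow_of_exponent_le (by norm_num) ?_
  have : (a : ℝ) ≤ b := by exact_mod_cast hab
  gcongr

/-- A discrete form of integrating `2 ^ (s / h)`: one step increases `h w_t` by `h w_t (2 ^ (1 / h)
- 1)`, and the tangent of `2 ^ y` at zero bounds this below by `w_t log 2`, for small `h` as well.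
-/
theorem log_two_mul_sum_streamWeight_le {h : ℝ} (hh : 0 < h) (t : ℕ) :
    Real.log 2 * ∑ i ∈ Finset.range t, streamWeight h i ≤ h * streamWeight h t := by
  induction t with
  | zero => simpa using mul_nonneg hh.le (streamWeight_pos h 0).le
  | succ t ih =>
    rw [Finset.sum_range_succ, streamWeight_succ, mul_add]
    have h1 := log_two_mul_le (1 / h)
    have h2 := streamWeight_pos h t
    have h3 : h * (streamWeight h t * 2 ^ (1 / h)) =
        h * streamWeight h t + h * streamWeight h t * (2 ^ (1 / h) - 1) := by ring
    have h4 : h * streamWeight h t * (Real.log 2 * (1 / h)) ≤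
        h * streamWeight h t * (2 ^ (1 / h) - 1) :=
      mul_le_mul_of_nonneg_left h1 (by positivity)
    have h5 : h * streamWeight h t * (Real.log 2 * (1 / h)) = Real.log 2 * streamWeight h t := by
      field_simp
    linarith

theorem sum_streamWeight_le {h : ℝ} (hh : 0 < h) (t : ℕ) :
    ∑ i ∈ Finset.range t, streamWeight h i ≤ 2 * (h * streamWeight h t) := by
  have h1 := log_two_mul_sum_streamWeight_le hh t
  have h2 := Real.log_two_gt_d9
  have h3 : 0 ≤ ∑ i ∈ Finset.range t, streamWeight h i :=
    Finset.sum_nonneg fun i _ => (streamWeight_pos h i).le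
  nlinarith

/-- Number of points that a first sub-phase reads, unless it is cut short. -/
def phaseLen (h Δ : ℝ) : ℕ := max 1 ⌈h * Real.logb 2 Δ⌉₊

theorem one_le_phaseLen (h Δ : ℝ) : 1 ≤ phaseLen h Δ := le_max_left _ _

theorem le_phaseLen (h Δ : ℝ) : h * Real.logb 2 Δ ≤ phaseLen h Δ :=
  (Nat.le_ceil _).trans (by exact_mod_cast le_max_right _ _)

theorem lt_phaseLen {h Δ : ℝ} {j : ℕ} (hj : j = 0 ∨ (j : ℝ) < h * Real.logb 2 Δ) :
    j < phaseLen h Δ := by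
  rcases hj with rfl | hj
  · exact one_le_phaseLen h Δ
  · exact_mod_cast hj.trans_le (le_phaseLen h Δ)

theorem phaseLen_le {h Δ : ℝ} {j : ℕ} (hj : 1 ≤ j) (hj' : h * Real.logb 2 Δ ≤ j) :
    phaseLen h Δ ≤ j :=
  max_le hj (Nat.ceil_le.2 hj')

/-- A full first sub-phase raises the weights by a factor of at least `Δ`. This makes up for
distances that may be as small as a `Δ`-th of the diameter. -/
theorem le_two_rpow_phaseLen {h Δ : ℝ} (hh : 0 < h) (hΔ : 1 ≤ Δ) :
    Δ ≤ (2 : ℝ) ^ ((phaseLen h Δ : ℝ) / h) := by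
  have h1 : Real.logb 2 Δ ≤ (phaseLen h Δ : ℝ) / h := by
    rw [le_div_iff₀ hh, mul_comm]
    exact le_phaseLen h Δ
  calc Δ = (2 : ℝ) ^ Real.logb 2 Δ :=
        (Real.rpow_logb (by norm_num) (by norm_num) (by linarith)).symm
    _ ≤ _ := Real.rpow_le_rpow_of_exponent_le (by norm_num) h1

theorem one_le_phaseWeight (h Δ : ℝ) : 1 ≤ phaseWeight h Δ := by
  unfold phaseWeight
  have h0 : 0 ∈ Finset.range (max 1 ⌈h * Real.logb 2 Δ⌉₊) := by simp
  have := Finset.single_le_sum (f := fun i : ℕ => (2 : ℝ) ^ ((i : ℝ) / h))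
    (fun i _ => by positivity) h0
  simpa using this

theorem sum_Ico_streamWeight_le {h Δ : ℝ} (a b : ℕ) (hb : b ≤ a + phaseLen h Δ) :
    ∑ i ∈ Finset.Ico a b, streamWeight h i ≤ phaseWeight h Δ * streamWeight h a := by
  rw [Finset.sum_Ico_eq_sum_range, phaseWeight, Finset.sum_mul]
  refine (Finset.sum_le_sum_of_subset_of_nonneg (t := Finset.range (phaseLen h Δ)) ?_ ?_).trans
    (le_of_eq ?_)
  · intro i hi
    simp only [Finset.mem_range] at hi ⊢
    omega
  · intro i _ _
    exact (streamWeight_pos h _).le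
  · refine Finset.sum_congr rfl fun i _ => ?_
    rw [streamWeight_add, mul_comm]

/-! ### Nearest centres and the cost of weighted sets -/

section Metric

variable {X : Type u} [MetricSpace X]

theorem nearest_mem {C : Finset X} (hC : C.Nonempty) (x : X) : nearest C x ∈ C := by
  unfold nearest
  rw [dif_pos hC]
  exact (C.exists_min_image (fun q => dist x q) hC).choose_spec.1

theorem dist_nearest_le {C : Finset X} (x : X) {q : X} (hq : q ∈ C) :
    dist x (nearest C x) ≤ dist x q := by
  have hC : C.Nonempty := ⟨q, hq⟩
  unfold nearest
  rw [dif_pos hC]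
  exact (C.exists_min_image (fun q => dist x q) hC).choose_spec.2 q hq

theorem infDist_eq_dist_nearest {C : Finset X} (hC : C.Nonempty) (x : X) :
    Metric.infDist x (C : Set X) = dist x (nearest C x) := by
  refine le_antisymm (Metric.infDist_le_dist_of_mem (nearest_mem hC x)) ?_
  rw [Metric.le_infDist (by exact_mod_cast hC)]
  intro y hy
  exact dist_nearest_le x hy

theorem medianCost_nonneg {C : Finset X} {wt : X → ℝ} (hw : ∀ q ∈ C, 0 ≤ wt q) (K : Finset X) :
    0 ≤ medianCost C wt K :=
  Finset.sum_nonneg fun q hq => mul_nonneg (hw q hq) Metric.infDist_nonneg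

theorem streamCost_nonneg (h : ℝ) (p : ℕ → X) (n : ℕ) (K : Finset X) :
    0 ≤ streamCost h p n K :=
  Finset.sum_nonneg fun _ _ => mul_nonneg (streamWeight_pos h _).le Metric.infDist_nonneg

theorem medianOpt_le {k : ℕ} {Y : Set X} {φ : Finset X → ℝ} (hφ : ∀ K, 0 ≤ φ K) {K : Finset X}
    (hK : K.Nonempty) (hk : K.card ≤ k) (hY : (K : Set X) ⊆ Y) : medianOpt k Y φ ≤ φ K := by
  refine csInf_le ⟨0, ?_⟩ ⟨K, ⟨hK, hk, hY⟩, rfl⟩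
  rintro _ ⟨K', _, rfl⟩
  exact hφ K'

/-- Moving centres into the set costs a factor of two. -/
theorem medianOpt_le_two_mul {k : ℕ} {C : Finset X} {wt : X → ℝ} (hC : C.Nonempty)
    (hw : ∀ q ∈ C, 0 ≤ wt q) {S : Finset X} (hS : S.Nonempty) (hk : S.card ≤ k) :
    medianOpt k (C : Set X) (medianCost C wt) ≤ 2 * medianCost C wt S := by
  classical
  refine (medianOpt_le (K := S.image (nearest C)) (medianCost_nonneg hw) (hS.image _)
    (Finset.card_image_le.trans hk) ?_).trans ?_
  · intro x hx
    obtain ⟨s, _, rfl⟩ := Finset.mem_image.1 (Finset.mem_coe.1 hx)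
    exact nearest_mem hC s
  · unfold medianCost
    rw [Finset.mul_sum]
    refine Finset.sum_le_sum fun q hq => ?_
    have h1 : Metric.infDist q ((S.image (nearest C) : Finset X) : Set X) ≤
        dist q (nearest C (nearest S q)) :=
      Metric.infDist_le_dist_of_mem
        (Finset.mem_coe.2 (Finset.mem_image_of_mem _ (nearest_mem hS q)))
    -- The path goes from `q` to its centre and on to the point of `C` closest to that centre. As
    -- `q` itself lies in `C`, the second leg is no longer than the first.
    have h2 := dist_triangle q (nearest S q) (nearest C (nearest S q))
    have h3 := dist_nearest_le (C := C) (nearest S q) hq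
    rw [dist_comm (nearest S q) q] at h3
    rw [infDist_eq_dist_nearest hS]
    nlinarith [hw q hq]

/-- The weight function `wt` arises by moving, for `i < t`, the weight of the `i`-th point of the
stream to `g i`. -/
def IsPushforward [DecidableEq X] (h : ℝ) (t : ℕ) (g : ℕ → X) (wt : X → ℝ) : Prop :=
  ∀ q, wt q = ∑ i ∈ (Finset.range t).filter (fun i => g i = q), streamWeight h i

theorem IsPushforward.nonneg [DecidableEq X] {h : ℝ} {t : ℕ} {g : ℕ → X} {wt : X → ℝ}
    (hg : IsPushforward h t g wt) (q : X) : 0 ≤ wt q := by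
  rw [hg q]
  exact Finset.sum_nonneg fun i _ => (streamWeight_pos h i).le

theorem IsPushforward.sum_mul [DecidableEq X] {h : ℝ} {t : ℕ} {g : ℕ → X} {wt : X → ℝ}
    (hg : IsPushforward h t g wt) {C : Finset X} (hC : ∀ i < t, g i ∈ C) (φ : X → ℝ) :
    ∑ q ∈ C, wt q * φ q = ∑ i ∈ Finset.range t, streamWeight h i * φ (g i) := by
  rw [← Finset.sum_fiberwise_of_maps_to (s := Finset.range t) (t := C) (g := g)
    (fun i hi => hC i (Finset.mem_range.1 hi))]
  refine Finset.sum_congr rfl fun q _ => ?_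
  rw [hg q, Finset.sum_mul]
  refine Finset.sum_congr rfl fun i hi => ?_
  rw [(Finset.mem_filter.1 hi).2]

theorem IsPushforward.medianCost_eq [DecidableEq X] {h : ℝ} {t : ℕ} {g : ℕ → X} {wt : X → ℝ}
    (hg : IsPushforward h t g wt) {C : Finset X} (hC : ∀ i < t, g i ∈ C) (K : Finset X) :
    medianCost C wt K =
      ∑ i ∈ Finset.range t, streamWeight h i * Metric.infDist (g i) (K : Set X) :=
  hg.sum_mul hC _

theorem IsPushforward.medianCost_le [DecidableEq X] {h : ℝ} {t : ℕ} {g : ℕ → X} {wt : X → ℝ}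
    (hg : IsPushforward h t g wt) {C : Finset X} (hC : ∀ i < t, g i ∈ C) (p : ℕ → X)
    (K : Finset X) :
    medianCost C wt K ≤ streamCost h p t K +
      ∑ i ∈ Finset.range t, streamWeight h i * dist (p i) (g i) := by
  rw [hg.medianCost_eq hC, streamCost, ← Finset.sum_add_distrib]
  refine Finset.sum_le_sum fun i _ => ?_
  rw [← mul_add]
  refine mul_le_mul_of_nonneg_left ?_ (streamWeight_pos h i).le
  rw [dist_comm]
  exact Metric.infDist_le_infDist_add_dist

theorem IsPushforward.streamCost_le [DecidableEq X] {h : ℝ} {t : ℕ} {g : ℕ → X} {wt : X → ℝ}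
    (hg : IsPushforward h t g wt) {C : Finset X} (hC : ∀ i < t, g i ∈ C) (p : ℕ → X)
    (K : Finset X) :
    streamCost h p t K ≤ medianCost C wt K +
      ∑ i ∈ Finset.range t, streamWeight h i * dist (p i) (g i) := by
  rw [hg.medianCost_eq hC, streamCost, ← Finset.sum_add_distrib]
  refine Finset.sum_le_sum fun i _ => ?_
  rw [← mul_add]
  exact mul_le_mul_of_nonneg_left Metric.infDist_le_infDist_add_dist (streamWeight_pos h i).le

/-- One more point, moved to `q`. -/
theorem IsPushforward.succ [DecidableEq X] {h : ℝ} {t : ℕ} {g : ℕ → X} {wt : X → ℝ}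
    (hg : IsPushforward h t g wt) (q : X) :
    IsPushforward h (t + 1) (Function.update g t q)
      (Function.update wt q (wt q + streamWeight h t)) := by
  intro r
  have h1 : (Finset.range t).filter (fun i => Function.update g t q i = r) =
      (Finset.range t).filter (fun i => g i = r) := by
    refine Finset.filter_congr fun i hi => ?_
    rw [Function.update_of_ne (Finset.mem_range.1 hi).ne]
  rw [Finset.range_add_one, Finset.filter_insert, h1, Function.update_self]
  by_cases hr : q = r
  · subst hr
    rw [if_pos rfl, Finset.sum_insert (by simp), Function.update_self, hg q, add_comm]
  · rw [if_neg hr, Function.update_of_ne (Ne.symm hr), hg r]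

theorem sum_update_dist [DecidableEq X] (h : ℝ) (t : ℕ) (p g : ℕ → X) (q : X) :
    ∑ i ∈ Finset.range (t + 1), streamWeight h i * dist (p i) (Function.update g t q i) =
      ∑ i ∈ Finset.range t, streamWeight h i * dist (p i) (g i) +
        streamWeight h t * dist (p t) q := by
  rw [Finset.sum_range_succ, Function.update_self]
  congr 1
  refine Finset.sum_congr rfl fun i hi => ?_
  rw [Function.update_of_ne (Finset.mem_range.1 hi).ne]

/-- All weight is handed over to closest points of `S`. -/
theorem IsPushforward.map_nearest [DecidableEq X] {h : ℝ} {t : ℕ} {g : ℕ → X} {wt : X → ℝ}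
    (hg : IsPushforward h t g wt) {C : Finset X} (hC : ∀ i < t, g i ∈ C) (S : Finset X) :
    IsPushforward h t (fun i => nearest S (g i))
      (fun q => ∑ x ∈ C.filter (fun x => nearest S x = q), wt x) := by
  intro q
  have h1 := hg.sum_mul hC (fun x => if nearest S x = q then 1 else 0)
  simp only [mul_ite, mul_one, mul_zero] at h1
  rw [← Finset.sum_filter, ← Finset.sum_filter] at h1
  exact h1

end Metric

/-! ### Expectations -/

/-- Expectation of a nonnegative function. -/
def expect {α : Type*} (P : PMF α) (g : α → ENNReal) : ENNReal := ∑' a, P a * g a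

theorem expect_pure {α : Type*} (a : α) (g : α → ENNReal) : expect (PMF.pure a) g = g a := by
  unfold expect
  rw [tsum_eq_single a]
  · simp
  · intro b hb
    simp [PMF.pure_apply, hb]

theorem expect_bind {α β : Type*} (P : PMF α) (Q : α → PMF β) (g : β → ENNReal) :
    expect (P.bind Q) g = expect P (fun a => expect (Q a) g) := by
  unfold expect
  simp only [PMF.bind_apply, ← ENNReal.tsum_mul_right, ← ENNReal.tsum_mul_left]
  rw [ENNReal.tsum_comm]
  simp only [mul_assoc]

theorem expect_mono {α : Type*} {P : PMF α} {g₁ g₂ : α → ENNReal}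
    (hg : ∀ a ∈ P.support, g₁ a ≤ g₂ a) : expect P g₁ ≤ expect P g₂ := by
  refine ENNReal.tsum_le_tsum fun a => ?_
  by_cases ha : P a = 0
  · simp [ha]
  · gcongr
    exact hg a ((PMF.mem_support_iff _ _).2 ha)

theorem expect_const {α : Type*} (P : PMF α) (c : ENNReal) : expect P (fun _ => c) = c := by
  unfold expect
  rw [ENNReal.tsum_mul_right, PMF.tsum_coe, one_mul]

theorem expect_mul_left {α : Type*} (P : PMF α) (c : ENNReal) (g : α → ENNReal) :
    expect P (fun a => c * g a) = c * expect P g := by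
  unfold expect
  rw [← ENNReal.tsum_mul_left]
  exact tsum_congr fun a => by ring

theorem expect_coin (q : NNReal) (hq : q ≤ 1) (g : Bool → ENNReal) :
    expect (coin q hq) g = q * g true + ((1 - q : NNReal) : ENNReal) * g false := by
  unfold expect
  rw [tsum_fintype, Fintype.sum_bool]
  simp [coin, PMF.ofFintype_apply]

theorem toOuterMeasure_eq_expect {α : Type*} (P : PMF α) (s : Set α) [DecidablePred (· ∈ s)] :
    P.toOuterMeasure s = expect P (fun a => if a ∈ s then 1 else 0) := by
  rw [PMF.toOuterMeasure_apply]
  refine tsum_congr fun a => ?_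
  by_cases ha : a ∈ s <;> simp [ha]

/-- Markov's inequality: `g` dominates the indicator of failure on the support. -/
theorem one_sub_le_toOuterMeasure {α : Type*} (P : PMF α) (s : Set α) {q : ENNReal}
    {g : α → ENNReal} (hg : ∀ a ∈ P.support, a ∉ s → 1 ≤ g a) (hq : expect P g ≤ q) :
    1 - q ≤ P.toOuterMeasure s := by
  classical
  rw [tsub_le_iff_right, toOuterMeasure_eq_expect]
  calc (1 : ENNReal) = expect P (fun _ => 1) := (expect_const P 1).symm
    _ ≤ expect P (fun a => (if a ∈ s then 1 else 0) + g a) := by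
        refine expect_mono fun a ha => ?_
        by_cases has : a ∈ s
        · simp [has]
        · simpa [has] using hg a ha has
    _ = expect P (fun a => if a ∈ s then 1 else 0) + expect P g := by
        unfold expect
        rw [← ENNReal.tsum_add]
        exact tsum_congr fun a => by ring
    _ ≤ _ := by gcongr

/-! ### Admissible parameters and streams -/

/-- The assumptions on the parameters. -/
structure Params.Valid (A : Params) : Prop where
  k_pos : 0 < A.k
  h_pos : 0 < A.h
  one_le_Δ : 1 ≤ A.Δ
  le_W : phaseWeight A.h A.Δ ≤ A.W
  one_lt_β : 1 < A.β
  β_le : A.β ≤ 2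
  le_γ : 9 ≤ A.γ
  one_le_c : 1 ≤ A.c

/-- The number `k (1 + log₂ W)`. -/
def Params.kap (A : Params) : ℝ := A.k * A.logFactor

theorem Params.facilityCost_eq (A : Params) (L : ℝ) : A.facilityCost L = L / A.kap := rfl

namespace Params.Valid

variable {A : Params}

theorem one_le_k (hA : A.Valid) : (1 : ℝ) ≤ A.k := by exact_mod_cast hA.k_pos

theorem one_le_W (hA : A.Valid) : 1 ≤ A.W := (one_le_phaseWeight _ _).trans hA.le_W

theorem one_le_logFactor (hA : A.Valid) : 1 ≤ A.logFactor := by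
  have := Real.logb_nonneg (b := 2) (by norm_num) hA.one_le_W
  unfold Params.logFactor
  linarith

theorem k_le_kap (hA : A.Valid) : (A.k : ℝ) ≤ A.kap :=
  le_mul_of_one_le_right (Nat.cast_nonneg _) hA.one_le_logFactor

theorem one_le_kap (hA : A.Valid) : 1 ≤ A.kap := hA.one_le_k.trans hA.k_le_kap

theorem kap_pos (hA : A.Valid) : 0 < A.kap := by linarith [hA.one_le_kap]

theorem facilityCost_pos (hA : A.Valid) {L : ℝ} (hL : 0 < L) : 0 < A.facilityCost L := by
  rw [A.facilityCost_eq]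
  exact div_pos hL hA.kap_pos

theorem facilityCost_le (hA : A.Valid) {L : ℝ} (hL : 0 ≤ L) : A.facilityCost L ≤ L := by
  rw [A.facilityCost_eq]
  exact div_le_self hL hA.one_le_kap

end Params.Valid

/-- The largest distance among the first `n` points is at most `D`, the smallest nonzero distance
is at least `1` and at least `D / Δ`. -/
structure BoundedStream {X : Type u} [MetricSpace X] (p : ℕ → X) (n : ℕ) (Δ D : ℝ) : Prop where
  dist_le : ∀ i < n, ∀ j < n, dist (p i) (p j) ≤ D
  le_mul_dist : ∀ i < n, ∀ j < n, p i ≠ p j → D ≤ Δ * dist (p i) (p j)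
  one_le_dist : ∀ i < n, ∀ j < n, p i ≠ p j → 1 ≤ dist (p i) (p j)
  nonneg : 0 ≤ D

theorem AspectRatioLE.exists_boundedStream {X : Type u} [MetricSpace X] {p : ℕ → X} {n : ℕ} {Δ : ℝ}
    (hp : AspectRatioLE p n Δ) (hn : 0 < n) : ∃ D, BoundedStream p n Δ D := by
  have hne : (Finset.range n ×ˢ Finset.range n).Nonempty := ⟨(0, 0), by simp [hn]⟩
  obtain ⟨⟨a, b⟩, hab, hmax⟩ := Finset.exists_max_image _ (fun ij => dist (p ij.1) (p ij.2)) hne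
  simp only [Finset.mem_product, Finset.mem_range] at hab hmax
  refine ⟨dist (p a) (p b), fun i hi j hj => hmax (i, j) ⟨hi, hj⟩, fun i hi j hj hij => ?_,
    fun i hi j hj hij => (hp i hi j hj hij).1, dist_nonneg⟩
  exact (hp i hi j hj hij).2 a hab.1 b hab.2

section Algorithm

variable {X : Type u} [MetricSpace X] [DecidableEq X]

/-! ### The opening probability and the support of a step -/

/-- A point that can fail to open costs less than one facility, so the service cost overshoots its
threshold by at most `f ≤ L`. -/
theorem openProb_lt_one {A : Params} (hA : A.Valid) {s : State X} (hs : 1 ≤ s.guess) {x : X}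
    {w : ℝ} (h : openProb A s x w < 1) :
    s.fac.Nonempty ∧ w * dist x (nearest s.fac x) < A.facilityCost s.guess := by
  unfold openProb at h
  split_ifs at h with h0
  · exact absurd h (lt_irrefl _)
  · refine ⟨Finset.nonempty_iff_ne_empty.2 h0, ?_⟩
    rw [min_lt_iff] at h
    have h1 := h.resolve_right (lt_irrefl _)
    rw [Real.toNNReal_lt_one, div_lt_one (hA.facilityCost_pos (by linarith))] at h1
    exact h1

theorem openProb_le {A : Params} {s : State X} (hs : s.fac.Nonempty) {x : X} {w : ℝ}
    (h : 0 ≤ w * dist x (nearest s.fac x) / A.facilityCost s.guess) :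
    (openProb A s x w : ℝ) ≤ w * dist x (nearest s.fac x) / A.facilityCost s.guess := by
  unfold openProb
  rw [if_neg (Finset.nonempty_iff_ne_empty.1 hs), NNReal.coe_min, Real.coe_toNNReal _ h]
  exact min_le_left _ _

theorem openProb_eq {A : Params} {s : State X} (hs : s.fac.Nonempty) {x : X} {w : ℝ}
    (h : 0 ≤ w * dist x (nearest s.fac x) / A.facilityCost s.guess) :
    (openProb A s x w : ℝ) =
      min (w * dist x (nearest s.fac x) / A.facilityCost s.guess) 1 := by
  unfold openProb
  rw [if_neg (Finset.nonempty_iff_ne_empty.1 hs), NNReal.coe_min, Real.coe_toNNReal _ h]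
  rfl

theorem step_of_verbatim (A : Params) (KM : OfflineKMedian X A.k A.c) (x : X) {s : State X}
    (hs : s.verbatim = true) :
    step A KM x s =
      PMF.pure (storeCheck A KM (storeUpdate s x (streamWeight A.h s.clock)).record) := by
  unfold step
  rw [if_pos hs]

theorem expect_step_of_verbatim (A : Params) (KM : OfflineKMedian X A.k A.c) (x : X) {s : State X}
    (hs : s.verbatim = true) (g : State X → ENNReal) :
    expect (step A KM x s) g =
      g (storeCheck A KM (storeUpdate s x (streamWeight A.h s.clock)).record) := by
  rw [step_of_verbatim A KM x hs, expect_pure]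

theorem step_of_not_verbatim (A : Params) (KM : OfflineKMedian X A.k A.c) (x : X) {s : State X}
    (hs : s.verbatim = false) :
    step A KM x s =
      (coin (openProb A s x (streamWeight A.h s.clock)) (openProb_le_one A s x _)).bind
        fun heads => PMF.pure
          (oflCheck A KM (oflUpdate s x (streamWeight A.h s.clock) heads).record) := by
  unfold step
  rw [if_neg (by simp [hs])]

theorem expect_step_of_not_verbatim (A : Params) (KM : OfflineKMedian X A.k A.c) (x : X)
    {s : State X} (hs : s.verbatim = false) (g : State X → ENNReal) :
    expect (step A KM x s) g =
      openProb A s x (streamWeight A.h s.clock) *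
          g (oflCheck A KM (oflUpdate s x (streamWeight A.h s.clock) true).record) +
        ((1 - openProb A s x (streamWeight A.h s.clock) : NNReal) : ENNReal) *
          g (oflCheck A KM (oflUpdate s x (streamWeight A.h s.clock) false).record) := by
  rw [step_of_not_verbatim A KM x hs, expect_bind, expect_coin, expect_pure, expect_pure]

theorem mem_support_step (A : Params) (KM : OfflineKMedian X A.k A.c) {x : X} {s s' : State X}
    (h : s' ∈ (step A KM x s).support) :
    (s.verbatim = true ∧
      s' = storeCheck A KM (storeUpdate s x (streamWeight A.h s.clock)).record) ∨
    (s.verbatim = false ∧ ∃ heads,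
      (heads = false → openProb A s x (streamWeight A.h s.clock) < 1) ∧
      s' = oflCheck A KM (oflUpdate s x (streamWeight A.h s.clock) heads).record) := by
  cases hs : s.verbatim with
  | true =>
    rw [step_of_verbatim A KM x hs, PMF.support_pure] at h
    exact Or.inl ⟨rfl, h⟩
  | false =>
    rw [step_of_not_verbatim A KM x hs, PMF.mem_support_bind_iff] at h
    obtain ⟨heads, hc, hh⟩ := h
    rw [PMF.support_pure] at hh
    refine Or.inr ⟨rfl, heads, fun hf => ?_, hh⟩
    subst hf
    rw [PMF.mem_support_iff] at hc
    refine lt_of_le_of_ne (openProb_le_one A s x _) fun h1 => hc ?_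
    simp [coin, PMF.ofFintype_apply, h1]

/-! ### Invariants -/

/-- Total cost of moving the points of the stream to the facilities, in units of the guess, at the
start of a phase. -/
def Params.moveFactor (A : Params) : ℝ := (A.γ + 1 + A.c * A.γ * A.β) / (A.β - 1)

theorem Params.Valid.moveFactor_nonneg {A : Params} (hA : A.Valid) : 0 ≤ A.moveFactor := by
  have := hA.one_lt_β
  have := hA.le_γ
  have := hA.one_le_c
  unfold Params.moveFactor
  apply div_nonneg <;> nlinarith [mul_nonneg (by linarith : 0 ≤ A.c) (by linarith : 0 ≤ A.γ)]

/-- What holds after `t` points, also before the test that may change the phase. -/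
structure WeakInv (A : Params) (p : ℕ → X) (D : ℝ) (t : ℕ) (s : State X) : Prop where
  clock_eq : s.clock = t
  one_le_guess : 1 ≤ s.guess
  count_le : s.count + s.seen.card ≤ t
  seen_subset : s.seen ⊆ s.fac
  fac_subset : s.fac ⊆ (Finset.range t).image p
  svc_nonneg : 0 ≤ s.svc
  svc_le_weak : s.svc ≤ (A.γ + 1) * s.guess
  svc_le_count : s.svc ≤ s.count * A.facilityCost s.guess
  svc_le_sum : s.svc ≤ D * ∑ i ∈ Finset.range t, streamWeight A.h i
  card_le_count : s.fac.card ≤ A.k + s.count + s.seen.card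
  all_or : (s.fac = (Finset.range t).image p ∧ s.guess = 1 ∧ s.svc = 0) ∨ A.k ≤ s.fac.card
  assign : ∃ g : ℕ → X, IsPushforward A.h t g s.wt ∧ (∀ i < t, g i ∈ s.fac) ∧
    ∑ i ∈ Finset.range t, streamWeight A.h i * dist (p i) (g i) ≤
      s.svc + A.moveFactor * s.guess

/-- What holds after `t` points. -/
structure Inv (A : Params) (p : ℕ → X) (D : ℝ) (t : ℕ) (s : State X) : Prop
    extends WeakInv A p D t s where
  first : s.verbatim = false →
    s.seen = ∅ ∧ (s.count = 0 ∨ (s.count : ℝ) < A.h * Real.logb 2 A.Δ)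
  second : s.verbatim = true → 1 ≤ s.count ∧ A.h * Real.logb 2 A.Δ ≤ s.count
  seen_lt : (s.seen.card : ℝ) < A.h + A.k
  svc_le : s.svc ≤ A.γ * s.guess
  card_le : (s.fac.card : ℝ) ≤ (A.γ - 1) * A.k * A.logFactor + s.seen.card

theorem WeakInv.record {A : Params} {p : ℕ → X} {D : ℝ} {t : ℕ} {s : State X}
    (hs : WeakInv A p D t s) : WeakInv A p D t s.record :=
  ⟨hs.clock_eq, hs.one_le_guess, hs.count_le, hs.seen_subset, hs.fac_subset, hs.svc_nonneg,
    hs.svc_le_weak, hs.svc_le_count, hs.svc_le_sum, hs.card_le_count, hs.all_or, hs.assign⟩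

theorem WeakInv.fac_nonempty {A : Params} {p : ℕ → X} {D : ℝ} {t : ℕ} {s : State X}
    (hs : WeakInv A p D t s) (ht : 0 < t) : s.fac.Nonempty := by
  obtain ⟨g, _, hg, _⟩ := hs.assign
  exact ⟨g 0, hg 0 ht⟩

theorem WeakInv.fac_eq_or {A : Params} {p : ℕ → X} {D : ℝ} {t : ℕ} {s : State X}
    (hs : WeakInv A p D t s) {q : X} (hq : q ∈ s.fac) : ∃ i < t, p i = q := by
  obtain ⟨i, hi, rfl⟩ := Finset.mem_image.1 (hs.fac_subset hq)
  exact ⟨i, Finset.mem_range.1 hi, rfl⟩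

theorem init_inv {A : Params} (hA : A.Valid) (p : ℕ → X) (D : ℝ) :
    Inv A p D 0 (State.init X) where
  clock_eq := rfl
  one_le_guess := le_rfl
  count_le := by simp [State.init]
  seen_subset := by simp [State.init]
  fac_subset := by simp [State.init]
  svc_nonneg := le_rfl
  svc_le_weak := by
    have := hA.le_γ
    simp only [State.init]
    linarith
  svc_le_count := by simp [State.init]
  svc_le_sum := by simp [State.init]
  card_le_count := by simp [State.init]
  all_or := Or.inl ⟨by simp [State.init], rfl, rfl⟩
  assign := by
    refine ⟨p, fun q => by simp [State.init], by simp, ?_⟩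
    simpa [State.init] using hA.moveFactor_nonneg
  first := fun _ => ⟨rfl, Or.inl rfl⟩
  second := fun h => by simp [State.init] at h
  seen_lt := by
    have := hA.h_pos
    have := hA.one_le_k
    simp only [State.init, Finset.card_empty, Nat.cast_zero]
    linarith
  svc_le := by
    have := hA.le_γ
    simp only [State.init]
    linarith
  card_le := by
    have h1 := hA.le_γ
    have h2 := hA.one_le_logFactor
    have h3 := hA.one_le_k
    simp only [State.init, Finset.card_empty, Nat.cast_zero, add_zero]
    have : 0 ≤ A.γ - 1 := by linarith
    positivity

/-- The cost of the offline clustering, compared with any centres. -/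
theorem WeakInv.solve_cost_le {A : Params} (hA : A.Valid) (KM : OfflineKMedian X A.k A.c)
    {p : ℕ → X} {D : ℝ} {t : ℕ} {s : State X} (hs : WeakInv A p D t s) (ht : 0 < t)
    {S : Finset X} (hS : S.Nonempty) (hk : S.card ≤ A.k) :
    medianCost s.fac s.wt (KM.solve s.fac s.wt) ≤
      2 * A.c * (streamCost A.h p t S + s.svc + A.moveFactor * s.guess) := by
  obtain ⟨g, hg, hgf, hmv⟩ := hs.assign
  have hc := hA.one_le_c
  have hne := hs.fac_nonempty ht
  have h1 := KM.solve_cost s.fac s.wt hne (fun q _ => hg.nonneg q)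
  have h2 := medianOpt_le_two_mul hne (fun q _ => hg.nonneg q) hS hk
  have h3 := hg.medianCost_le hgf p S
  calc _ ≤ A.c * medianOpt A.k (s.fac : Set X) (medianCost s.fac s.wt) := h1
    _ ≤ A.c * (2 * (streamCost A.h p t S + s.svc + A.moveFactor * s.guess)) := by
        gcongr
        linarith
    _ = _ := by ring

/-- The cost of the offline clustering, compared with a single centre. -/
theorem WeakInv.solve_cost_le_sum {A : Params} (hA : A.Valid) (KM : OfflineKMedian X A.k A.c)
    {p : ℕ → X} {n : ℕ} {D : ℝ} (hp : BoundedStream p n A.Δ D) {t : ℕ} {s : State X}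
    (hs : WeakInv A p D t s) (ht : 0 < t) (htn : t ≤ n) :
    medianCost s.fac s.wt (KM.solve s.fac s.wt) ≤
      A.c * (D * ∑ i ∈ Finset.range t, streamWeight A.h i) := by
  obtain ⟨g, hg, hgf, hmv⟩ := hs.assign
  have hc := hA.one_le_c
  have hne := hs.fac_nonempty ht
  have h1 := KM.solve_cost s.fac s.wt hne (fun q _ => hg.nonneg q)
  obtain ⟨q, hq⟩ := hne
  refine h1.trans (mul_le_mul_of_nonneg_left ?_ (by linarith))
  refine (medianOpt_le (K := {q}) (medianCost_nonneg fun q _ => hg.nonneg q)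
    (Finset.singleton_nonempty q) (by rw [Finset.card_singleton]; exact hA.k_pos)
    (by simpa using hq)).trans ?_
  rw [hg.medianCost_eq hgf, Finset.mul_sum]
  refine Finset.sum_le_sum fun i hi => ?_
  rw [mul_comm D]
  refine mul_le_mul_of_nonneg_left ?_ (streamWeight_pos _ _).le
  rw [Finset.coe_singleton, Metric.infDist_singleton]
  obtain ⟨a, ha, rfl⟩ := hs.fac_eq_or hq
  obtain ⟨b, hb, hb'⟩ := hs.fac_eq_or (hgf i (Finset.mem_range.1 hi))
  rw [← hb']
  exact hp.dist_le b (by omega) a (by omega)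

theorem phaseChange_guess (A : Params) (KM : OfflineKMedian X A.k A.c) (s : State X) :
    (phaseChange A KM s).guess = max (A.β * s.guess)
      (medianCost s.fac s.wt (KM.solve s.fac s.wt) / (A.c * A.γ)) := rfl

theorem phaseChange_fac (A : Params) (KM : OfflineKMedian X A.k A.c) (s : State X) :
    (phaseChange A KM s).fac = KM.solve s.fac s.wt := rfl

/-- With at least `k` facilities available, the clustering keeps exactly `k`. The moving cost of the
new phase is that of the old one plus the clustering cost, and the latter is at most `c γ` times the
new guess because the guess is raised to `lam / (c γ)`. -/
theorem phaseChange_inv {A : Params} (hA : A.Valid) (KM : OfflineKMedian X A.k A.c)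
    {p : ℕ → X} {D : ℝ} (hD : 0 ≤ D) {t : ℕ} {s : State X} (hs : WeakInv A p D t s)
    (hk : A.k ≤ s.fac.card) : Inv A p D t (phaseChange A KM s) := by
  have hβ := hA.one_lt_β
  have hγ := hA.le_γ
  have hc := hA.one_le_c
  have hkap := hA.k_le_kap
  have hk1 := hA.one_le_k
  have hh := hA.h_pos
  have hg1 := hs.one_le_guess
  have hcard : (phaseChange A KM s).fac.card = A.k := by
    rw [phaseChange_fac, KM.solve_card, min_eq_left hk]
  have hguess : A.β * s.guess ≤ (phaseChange A KM s).guess := le_max_left _ _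
  have hguess1 : 1 ≤ (phaseChange A KM s).guess := by nlinarith
  have hlam : medianCost s.fac s.wt (KM.solve s.fac s.wt) ≤
      A.c * A.γ * (phaseChange A KM s).guess := by
    have h1 : medianCost s.fac s.wt (KM.solve s.fac s.wt) / (A.c * A.γ) ≤
        (phaseChange A KM s).guess := le_max_right _ _
    rw [div_le_iff₀ (by positivity)] at h1
    linarith
  have hsum : 0 ≤ D * ∑ i ∈ Finset.range t, streamWeight A.h i :=
    mul_nonneg hD (Finset.sum_nonneg fun i _ => (streamWeight_pos _ i).le)
  have hS : (KM.solve s.fac s.wt).Nonempty := by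
    rw [← Finset.card_pos, KM.solve_card, min_eq_left hk]
    exact hA.k_pos
  refine ⟨⟨hs.clock_eq, hguess1, ?_, ?_, ?_, le_rfl, ?_, ?_, hsum, ?_, Or.inr hcard.ge, ?_⟩,
    fun _ => ⟨rfl, Or.inl rfl⟩, fun h => ?_, ?_, ?_, ?_⟩
  · simp [phaseChange]
  · simp [phaseChange]
  · exact (KM.solve_subset _ _).trans hs.fac_subset
  · have : 0 ≤ (A.γ + 1) * (phaseChange A KM s).guess := by nlinarith
    exact this
  · simp [phaseChange]
  · rw [hcard]
    omega
  · obtain ⟨g, hg, hgf, hmv⟩ := hs.assign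
    refine ⟨fun i => nearest (KM.solve s.fac s.wt) (g i), hg.map_nearest hgf _,
      fun i _ => nearest_mem hS _, ?_⟩
    have h1 : ∑ i ∈ Finset.range t,
        streamWeight A.h i * dist (p i) (nearest (KM.solve s.fac s.wt) (g i)) ≤
        ∑ i ∈ Finset.range t, streamWeight A.h i * dist (p i) (g i) +
          medianCost s.fac s.wt (KM.solve s.fac s.wt) := by
      rw [hg.medianCost_eq hgf, ← Finset.sum_add_distrib]
      refine Finset.sum_le_sum fun i _ => ?_
      rw [← mul_add, infDist_eq_dist_nearest hS]
      exact mul_le_mul_of_nonneg_left (dist_triangle _ _ _) (streamWeight_pos _ _).le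
    -- `moveFactor` is the solution `m` of `(γ + 1 + m) / β + c γ = m`: the old guess is at most the
    -- new one divided by `β`, and the clustering adds `c γ` times the new one.
    have h2 : A.moveFactor * (A.β - 1) = A.γ + 1 + A.c * A.γ * A.β := by
      unfold Params.moveFactor
      rw [div_mul_cancel₀]
      linarith
    have h3 := hs.svc_le_weak
    have h4 : (A.γ + 1 + A.moveFactor) * (A.β * s.guess) ≤
        (A.γ + 1 + A.moveFactor) * (phaseChange A KM s).guess :=
      mul_le_mul_of_nonneg_left hguess (by linarith [hA.moveFactor_nonneg])
    have h5 : A.β * ((A.γ + 1 + A.moveFactor) * s.guess + A.c * A.γ *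
        (phaseChange A KM s).guess) ≤ A.β * (A.moveFactor * (phaseChange A KM s).guess) := by
      have : A.moveFactor * A.β = A.moveFactor + (A.γ + 1 + A.c * A.γ * A.β) := by linarith
      calc _ = (A.γ + 1 + A.moveFactor) * (A.β * s.guess) +
            A.c * A.γ * A.β * (phaseChange A KM s).guess := by ring
        _ ≤ (A.γ + 1 + A.moveFactor) * (phaseChange A KM s).guess +
            A.c * A.γ * A.β * (phaseChange A KM s).guess := by linarith
        _ = (A.moveFactor * A.β) * (phaseChange A KM s).guess := by rw [this]; ring
        _ = _ := by ring
    have h6 := le_of_mul_le_mul_left h5 (by linarith)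
    have h7 : (phaseChange A KM s).svc = 0 := rfl
    rw [h7]
    nlinarith
  · simp [phaseChange] at h
  · simp only [phaseChange, Finset.card_empty, Nat.cast_zero]
    linarith
  · have : 0 ≤ A.γ * (phaseChange A KM s).guess := by nlinarith
    exact this
  · rw [hcard]
    have : (phaseChange A KM s).seen = ∅ := rfl
    rw [this, Finset.card_empty, Nat.cast_zero, add_zero, mul_assoc]
    change (A.k : ℝ) ≤ (A.γ - 1) * A.kap
    nlinarith

/-- Heads moves nothing. Tails is possible only for a service cost below `f ≤ L`, which gives `γ +
1` in place of `γ` and at most one `f` per point of the phase. -/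
theorem oflUpdate_weakInv {A : Params} (hA : A.Valid) {p : ℕ → X} {n : ℕ} {D : ℝ}
    (hp : BoundedStream p n A.Δ D) {t : ℕ} (htn : t < n) {s : State X} (hs : Inv A p D t s)
    {heads : Bool}
    (hh : heads = false → openProb A s (p t) (streamWeight A.h s.clock) < 1) :
    WeakInv A p D (t + 1) (oflUpdate s (p t) (streamWeight A.h s.clock) heads) := by
  have hγ := hA.le_γ
  have hg1 := hs.one_le_guess
  have hf := hA.facilityCost_pos (L := s.guess) (by linarith)
  have hfl := hA.facilityCost_le (L := s.guess) (by linarith)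
  have hw := streamWeight_pos A.h t
  have hsum : D * ∑ i ∈ Finset.range t, streamWeight A.h i ≤
      D * ∑ i ∈ Finset.range (t + 1), streamWeight A.h i := by
    rw [Finset.sum_range_succ]
    nlinarith [hp.nonneg]
  have himg : (Finset.range (t + 1)).image p = insert (p t) ((Finset.range t).image p) := by
    rw [Finset.range_add_one, Finset.image_insert]
  obtain ⟨g, hg, hgf, hmv⟩ := hs.assign
  rw [hs.clock_eq] at hh ⊢
  cases heads with
  | true =>
    simp only [oflUpdate, if_true]
    refine ⟨by simp [hs.clock_eq], hg1, ?_, ?_, ?_, hs.svc_nonneg, hs.svc_le_weak, ?_,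
      hs.svc_le_sum.trans hsum, ?_, ?_, ?_⟩
    · have := hs.count_le
      simp only
      omega
    · exact hs.seen_subset.trans (Finset.subset_insert _ _)
    · rw [himg]
      exact Finset.insert_subset_insert _ hs.fac_subset
    · simp only
      push_cast
      nlinarith [hs.svc_le_count]
    · have := hs.card_le_count
      have := Finset.card_insert_le (p t) s.fac
      simp only
      omega
    · rcases hs.all_or with ⟨h1, h2, h3⟩ | h1
      · exact Or.inl ⟨by rw [himg, ← h1], h2, h3⟩
      · exact Or.inr (h1.trans (Finset.card_le_card (Finset.subset_insert _ _)))
    · refine ⟨Function.update g t (p t), hg.succ _, fun i hi => ?_, ?_⟩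
      · rcases Nat.lt_succ_iff_lt_or_eq.1 hi with hi | rfl
        · rw [Function.update_of_ne hi.ne]
          exact Finset.mem_insert_of_mem (hgf i hi)
        · rw [Function.update_self]
          exact Finset.mem_insert_self _ _
      · rw [sum_update_dist, dist_self, mul_zero, add_zero]
        exact hmv
  | false =>
    obtain ⟨hne, hlt⟩ := openProb_lt_one hA hg1 (hh rfl)
    have hd0 : 0 ≤ streamWeight A.h t * dist (p t) (nearest s.fac (p t)) := by positivity
    obtain ⟨j, hj, hj'⟩ := hs.fac_eq_or (nearest_mem hne (p t))
    simp only [oflUpdate, Bool.false_eq_true, if_false]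
    refine ⟨by simp [hs.clock_eq], hg1, ?_, hs.seen_subset, ?_, ?_, ?_, ?_, ?_, ?_, ?_, ?_⟩
    · have := hs.count_le
      simp only
      omega
    · rw [himg]
      exact hs.fac_subset.trans (Finset.subset_insert _ _)
    · have := hs.svc_nonneg
      simp only
      linarith
    · have := hs.svc_le
      simp only
      linarith
    · have := hs.svc_le_count
      simp only
      push_cast
      linarith
    · rw [Finset.sum_range_succ, mul_add]
      have h1 : dist (p t) (nearest s.fac (p t)) ≤ D := by
        rw [← hj']
        exact hp.dist_le t htn j (by omega)
      have h2 := hs.svc_le_sum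
      simp only
      nlinarith
    · have := hs.card_le_count
      simp only
      omega
    · rcases hs.all_or with ⟨h1, h2, h3⟩ | h1
      · left
        -- With guess 1 the facility cost is at most 1, while weights and nonzero distances are at
        -- least 1. A point not yet stored would therefore open with certainty, so tails means a
        -- repetition. Up to the first phase change all distinct points are thus facilities.
        have h4 : p t = p j := by
          by_contra hne'
          have h5 := hp.one_le_dist t htn j (by omega) hne'
          rw [← hj'] at hlt
          have h6 := one_le_streamWeight hA.h_pos t
          have h7 : (1 : ℝ) ≤ streamWeight A.h t * dist (p t) (p j) := by nlinarith
          linarith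
        have h8 : p t ∈ s.fac := by
          rw [h4, hj']
          exact nearest_mem hne _
        refine ⟨?_, h2, ?_⟩
        · rw [himg, ← h1, Finset.insert_eq_of_mem h8]
        · simp only
          rw [← hj', h4, dist_self, h3]
          simp
      · exact Or.inr h1
    · refine ⟨Function.update g t (nearest s.fac (p t)), hg.succ _, fun i hi => ?_, ?_⟩
      · rcases Nat.lt_succ_iff_lt_or_eq.1 hi with hi | rfl
        · rw [Function.update_of_ne hi.ne]
          exact hgf i hi
        · rw [Function.update_self]
          exact nearest_mem hne _
      · rw [sum_update_dist]
        simp only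
        linarith

theorem storeUpdate_weakInv {A : Params} {p : ℕ → X} {D : ℝ} (hD : 0 ≤ D) {t : ℕ} {s : State X}
    (hs : Inv A p D t s) :
    WeakInv A p D (t + 1) (storeUpdate s (p t) (streamWeight A.h s.clock)) := by
  have hw := streamWeight_pos A.h t
  have himg : (Finset.range (t + 1)).image p = insert (p t) ((Finset.range t).image p) := by
    rw [Finset.range_add_one, Finset.image_insert]
  obtain ⟨g, hg, hgf, hmv⟩ := hs.assign
  rw [hs.clock_eq]
  simp only [storeUpdate]
  refine ⟨by simp [hs.clock_eq], hs.one_le_guess, ?_, ?_, ?_, hs.svc_nonneg, hs.svc_le_weak,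
    hs.svc_le_count, ?_, ?_, ?_, ?_⟩
  · have := hs.count_le
    have := Finset.card_insert_le (p t) s.seen
    simp only
    omega
  · exact Finset.insert_subset_insert _ hs.seen_subset
  · rw [himg]
    exact Finset.insert_subset_insert _ hs.fac_subset
  · rw [Finset.sum_range_succ, mul_add]
    have := hs.svc_le_sum
    simp only
    nlinarith
  · have h1 := hs.card_le_count
    simp only
    by_cases hx : p t ∈ s.fac
    · rw [Finset.insert_eq_of_mem hx]
      have := Finset.card_le_card (Finset.subset_insert (p t) s.seen)
      omega
    · rw [Finset.card_insert_of_notMem hx,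
        Finset.card_insert_of_notMem (fun h => hx (hs.seen_subset h))]
      omega
  · rcases hs.all_or with ⟨h1, h2, h3⟩ | h1
    · exact Or.inl ⟨by rw [himg, ← h1], h2, h3⟩
    · exact Or.inr (h1.trans (Finset.card_le_card (Finset.subset_insert _ _)))
  · refine ⟨Function.update g t (p t), hg.succ _, fun i hi => ?_, ?_⟩
    · rcases Nat.lt_succ_iff_lt_or_eq.1 hi with hi | rfl
      · rw [Function.update_of_ne hi.ne]
        exact Finset.mem_insert_of_mem (hgf i hi)
      · rw [Function.update_self]
        exact Finset.mem_insert_self _ _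
    · rw [sum_update_dist, dist_self, mul_zero, add_zero]
      exact hmv

/-- A phase change out of the first sub-phase finds at least `k` facilities. -/
theorem WeakInv.le_card_of_overflow {A : Params} (hA : A.Valid) {p : ℕ → X} {D : ℝ} {t : ℕ}
    {s : State X} (hs : WeakInv A p D t s)
    (h : A.γ * s.guess < s.svc ∨ (A.γ - 1) * A.k * A.logFactor < (s.fac.card : ℝ)) :
    A.k ≤ s.fac.card := by
  have hγ := hA.le_γ
  rcases h with h | h
  · rcases hs.all_or with ⟨_, h2, h3⟩ | h1
    · rw [h2, h3] at h
      linarith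
    · exact h1
  · rw [mul_assoc] at h
    change (A.γ - 1) * A.kap < _ at h
    have := hA.k_le_kap
    have := hA.one_le_kap
    have h1 : (A.k : ℝ) ≤ s.fac.card := by nlinarith
    exact_mod_cast h1

theorem oflCheck_inv {A : Params} (hA : A.Valid) (KM : OfflineKMedian X A.k A.c) {p : ℕ → X}
    {D : ℝ} (hD : 0 ≤ D) {t : ℕ} {s : State X} (hs : WeakInv A p D t s)
    (hv : s.verbatim = false) (hseen : s.seen = ∅) (hcount : 1 ≤ s.count) :
    Inv A p D t (oflCheck A KM s) := by
  have hh := hA.h_pos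
  have hk := hA.one_le_k
  unfold oflCheck
  split_ifs with h1 h2
  · exact phaseChange_inv hA KM hD hs (hs.le_card_of_overflow hA h1)
  · rw [not_or, not_lt, not_lt] at h1
    refine ⟨⟨hs.clock_eq, hs.one_le_guess, hs.count_le, hs.seen_subset, hs.fac_subset,
      hs.svc_nonneg, hs.svc_le_weak, hs.svc_le_count, hs.svc_le_sum, hs.card_le_count, hs.all_or,
      hs.assign⟩, fun h => by simp at h, fun _ => ⟨hcount, h2⟩, ?_, h1.1, ?_⟩
    · simp only [hseen, Finset.card_empty, Nat.cast_zero]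
      linarith
    · simp only [hseen, Finset.card_empty, Nat.cast_zero, add_zero]
      exact h1.2
  · rw [not_or, not_lt, not_lt] at h1
    refine ⟨hs, fun _ => ⟨hseen, Or.inr (not_le.1 h2)⟩, fun h => by simp [hv] at h, ?_, h1.1, ?_⟩
    · simp only [hseen, Finset.card_empty, Nat.cast_zero]
      linarith
    · simp only [hseen, Finset.card_empty, Nat.cast_zero, add_zero]
      exact h1.2

theorem step_inv {A : Params} (hA : A.Valid) (KM : OfflineKMedian X A.k A.c) {p : ℕ → X} {n : ℕ}
    {D : ℝ} (hp : BoundedStream p n A.Δ D) {t : ℕ} (htn : t < n) {s s' : State X}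
    (hs : Inv A p D t s) (hs' : s' ∈ (step A KM (p t) s).support) : Inv A p D (t + 1) s' := by
  rcases mem_support_step A KM hs' with ⟨hv, rfl⟩ | ⟨hv, heads, hheads, rfl⟩
  · have hw := (storeUpdate_weakInv hp.nonneg hs).record
    unfold storeCheck
    split_ifs with h1
    · refine phaseChange_inv hA KM hp.nonneg hw ?_
      have h2 := Finset.card_le_card hw.seen_subset
      have h3 : (A.k : ℝ) ≤
          ((storeUpdate s (p t) (streamWeight A.h s.clock)).record.seen.card : ℝ) := by
        linarith [hA.h_pos]
      exact (by exact_mod_cast h3 : A.k ≤ _).trans h2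
    · refine ⟨hw, fun h => ?_, fun _ => hs.second hv, not_le.1 h1, hs.svc_le, ?_⟩
      · simp [State.record, storeUpdate, hv] at h
      · have h2 := hs.card_le
        simp only [State.record, storeUpdate]
        by_cases hx : p t ∈ s.fac
        · rw [Finset.insert_eq_of_mem hx]
          have : (s.seen.card : ℝ) ≤ (insert (p t) s.seen).card := by
            exact_mod_cast Finset.card_le_card (Finset.subset_insert (p t) s.seen)
          linarith
        · rw [Finset.card_insert_of_notMem hx,
            Finset.card_insert_of_notMem (fun h => hx (hs.seen_subset h))]
          push_cast
          linarith
  · exact oflCheck_inv hA KM hp.nonneg (oflUpdate_weakInv hA hp htn hs hheads).record rfl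
      (hs.first hv).1 (Nat.succ_le_succ (Nat.zero_le _))

end Algorithm

section Algorithm

variable {X : Type u} [MetricSpace X] [DecidableEq X]

/-! ### Several instances in parallel -/

/-- Expectation of `g` after `m` more points, when the next point to read is the `t`-th. -/
def value (A : Params) (KM : OfflineKMedian X A.k A.c) (p : ℕ → X) (g : State X → ENNReal) :
    ℕ → ℕ → State X → ENNReal
  | 0, _, s => g s
  | m + 1, t, s => expect (step A KM (p t) s) (value A KM p g m (t + 1))

theorem value_le_one (A : Params) (KM : OfflineKMedian X A.k A.c) (p : ℕ → X)
    {g : State X → ENNReal} (hg : ∀ s, g s ≤ 1) (m t : ℕ) (s : State X) :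
    value A KM p g m t s ≤ 1 := by
  induction m generalizing t s with
  | zero => exact hg s
  | succ m ih =>
    refine (expect_mono fun s' _ => ih (t + 1) s').trans ?_
    rw [expect_const]

/-- Independence of the instances in the only form needed: the expectation of a product is the
product of the expectations. -/
theorem expect_stepAll (A : Params) (KM : OfflineKMedian X A.k A.c) (x : X)
    (g : State X → ENNReal) (l : List (State X)) :
    expect (stepAll A KM x l) (fun l' => (l'.map g).prod) =
      (l.map fun s => expect (step A KM x s) g).prod := by
  induction l with
  | nil => simp [stepAll, expect_pure]
  | cons s l ih =>
    simp only [stepAll, expect_bind, expect_pure, List.map_cons, List.prod_cons, ← ih,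
      expect_mul_left]
    simp only [mul_comm (g _), expect_mul_left]
    rw [mul_comm]

theorem expect_run_add (A : Params) (KM : OfflineKMedian X A.k A.c) (p : ℕ → X) (r : ℕ)
    (g : State X → ENNReal) (m t : ℕ) :
    expect (run A KM p r (t + m)) (fun l => (l.map g).prod) =
      expect (run A KM p r t) (fun l => (l.map (value A KM p g m t)).prod) := by
  induction m generalizing t with
  | zero => rfl
  | succ m ih =>
    rw [show t + (m + 1) = t + 1 + m by ring, ih (t + 1)]
    simp only [run, expect_bind, expect_stepAll]
    rfl

theorem expect_run (A : Params) (KM : OfflineKMedian X A.k A.c) (p : ℕ → X) (r n : ℕ)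
    (g : State X → ENNReal) :
    expect (run A KM p r n) (fun l => (l.map g).prod) =
      (value A KM p g n 0 (State.init X)) ^ r := by
  have := expect_run_add A KM p r g n 0
  rw [zero_add] at this
  rw [this]
  simp [run, expect_pure]

theorem mem_support_stepAll (A : Params) (KM : OfflineKMedian X A.k A.c) {x : X}
    {l l' : List (State X)} (h : l' ∈ (stepAll A KM x l).support) :
    List.Forall₂ (fun s s' => s' ∈ (step A KM x s).support) l l' := by
  induction l generalizing l' with
  | nil =>
    simp only [stepAll, PMF.support_pure, Set.mem_singleton_iff] at h
    subst h
    exact List.Forall₂.nil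
  | cons s l ih =>
    simp only [stepAll, PMF.mem_support_bind_iff, PMF.support_pure, Set.mem_singleton_iff] at h
    obtain ⟨s', hs', l'', hl'', rfl⟩ := h
    exact List.Forall₂.cons hs' (ih hl'')

/-- An invariant of the steps holds for all instances in all outcomes. -/
theorem mem_support_run (A : Params) (KM : OfflineKMedian X A.k A.c) (p : ℕ → X) (r n : ℕ)
    {Q : ℕ → State X → Prop} (h0 : Q 0 (State.init X))
    (hstep : ∀ t < n, ∀ s, Q t s → ∀ s' ∈ (step A KM (p t) s).support, Q (t + 1) s')
    {l : List (State X)} (hl : l ∈ (run A KM p r n).support) :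
    l.length = r ∧ ∀ s ∈ l, Q n s := by
  suffices H : ∀ t ≤ n, ∀ l ∈ (run A KM p r t).support, l.length = r ∧ ∀ s ∈ l, Q t s from
    H n le_rfl l hl
  intro t
  induction t with
  | zero =>
    intro _ l hl
    simp only [run, PMF.support_pure, Set.mem_singleton_iff] at hl
    subst hl
    refine ⟨List.length_replicate, fun s hs => ?_⟩
    rw [List.eq_of_mem_replicate hs]
    exact h0
  | succ t ih =>
    intro ht l hl
    simp only [run, PMF.mem_support_bind_iff] at hl
    obtain ⟨l₀, hl₀, hl⟩ := hl
    obtain ⟨h1, h2⟩ := ih (by omega) l₀ hl₀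
    have h3 := mem_support_stepAll A KM hl
    refine ⟨h3.length_eq ▸ h1, fun s' hs' => ?_⟩
    obtain ⟨i, hi, rfl⟩ := List.mem_iff_getElem.1 hs'
    have hi' : i < l₀.length := by rw [h3.length_eq]; exact hi
    exact hstep t ht _ (h2 _ (List.getElem_mem hi')) _ (h3.get hi' hi)

/-! ### Time and space -/

/-- A phase reads at least `k` points. -/
theorem WeakInv.le_count_of_overflow {A : Params} (hA : A.Valid) {p : ℕ → X} {D : ℝ} {t : ℕ}
    {s : State X} (hs : WeakInv A p D t s) (hseen : s.seen = ∅)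
    (h : A.γ * s.guess < s.svc ∨ (A.γ - 1) * A.k * A.logFactor < (s.fac.card : ℝ)) :
    A.k ≤ s.count := by
  have hγ := hA.le_γ
  have hk := hA.k_le_kap
  have hκ := hA.one_le_kap
  have hg := hs.one_le_guess
  have : (A.k : ℝ) ≤ s.count := by
    rcases h with h | h
    -- Every point adds at most `f = L / κ`, with `κ = A.kap`, to the service cost, so exceeding `γ
    -- L` takes more than `γ κ` points.
    · have h1 := hs.svc_le_count
      rw [A.facilityCost_eq, ← mul_div_assoc, le_div_iff₀ hA.kap_pos] at h1
      have h2 : A.γ * s.guess * A.kap < s.count * s.guess := by nlinarith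
      have h3 : A.γ * A.kap < s.count := by
        by_contra hcon
        rw [not_lt] at hcon
        nlinarith
      nlinarith
    · rw [mul_assoc] at h
      change (A.γ - 1) * A.kap < _ at h
      have h1 : (s.fac.card : ℝ) ≤ A.k + s.count := by
        have := hs.card_le_count
        rw [hseen, Finset.card_empty, add_zero] at this
        exact_mod_cast this
      nlinarith
  exact_mod_cast this

/-- Bound on the number of facilities. -/
def Params.maxFac (A : Params) : ℝ := (A.γ - 1) * A.kap + A.h + A.k + 1

theorem Inv.card_le_maxFac {A : Params} {p : ℕ → X} {D : ℝ} {t : ℕ} {s : State X}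
    (hs : Inv A p D t s) : (s.fac.card : ℝ) + 1 ≤ A.maxFac := by
  have h1 := hs.card_le
  have h2 := hs.seen_lt
  rw [mul_assoc] at h1
  change _ ≤ (A.γ - 1) * A.kap + _ at h1
  unfold Params.maxFac
  linarith

theorem phaseChange_time (A : Params) (KM : OfflineKMedian X A.k A.c) (s : State X) :
    (phaseChange A KM s).time = s.time + KM.time s.fac s.wt + A.k * s.fac.card + 1 := rfl

/-- The time that a phase change takes is paid for by the points of the phase. -/
theorem WeakInv.phaseChange_time_le {A : Params} (hA : A.Valid) {KM : OfflineKMedian X A.k A.c}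
    {τ : ℝ} (hτ : 0 ≤ τ) (hKM : ∀ S w, (KM.time S w : ℝ) ≤ τ * (A.k * S.card))
    {p : ℕ → X} {D : ℝ} {t : ℕ} {s : State X} (hs : WeakInv A p D t s)
    (hk : A.k ≤ s.count + s.seen.card) :
    ((phaseChange A KM s).time : ℝ) ≤
      s.time + 3 * (1 + τ) * A.k * (s.count + s.seen.card : ℕ) := by
  have h1 := hKM s.fac s.wt
  have hk1 := hA.one_le_k
  -- The phase began with at most `k` facilities and gained at most one per point; with at least `k`
  -- points read this is at most twice their number.
  have h2 : (s.fac.card : ℝ) ≤ 2 * (s.count + s.seen.card : ℕ) := by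
    have := hs.card_le_count
    exact_mod_cast (by omega : s.fac.card ≤ 2 * (s.count + s.seen.card))
  have h3 : (1 : ℝ) ≤ (s.count + s.seen.card : ℕ) := by
    exact_mod_cast hA.k_pos.trans_le hk
  rw [phaseChange_time]
  push_cast at h2 h3 ⊢
  have h4 : (1 + τ) * (A.k * (s.fac.card : ℝ)) ≤
      (1 + τ) * (A.k * (2 * ((s.count : ℝ) + s.seen.card))) := by gcongr
  have h5 : 1 ≤ (1 + τ) * (A.k * ((s.count : ℝ) + s.seen.card)) :=
    one_le_mul_of_one_le_of_one_le (by linarith) (one_le_mul_of_one_le_of_one_le hk1 h3)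
  linarith

/-- Time bound: `u` bounds the time that one point takes, apart from phase changes. -/
def TimeInv (A : Params) (τ u : ℝ) (t : ℕ) (s : State X) : Prop :=
  (s.time : ℝ) + 3 * (1 + τ) * A.k * (s.count + s.seen.card : ℕ) ≤
    (u + 3 * (1 + τ) * A.k) * t

/-- Amortisation: each point of a first sub-phase and each new distinct point of a second one
deposits `3 (1 + τ) k` steps. The balance is proportional to `count + seen.card` and is spent at the
phase change. -/
theorem step_timeInv {A : Params} (hA : A.Valid) {KM : OfflineKMedian X A.k A.c}
    {τ u : ℝ} (hτ : 0 ≤ τ) (hKM : ∀ S w, (KM.time S w : ℝ) ≤ τ * (A.k * S.card))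
    (hu₁ : (A.γ - 1) * A.kap + 1 ≤ u) (hu₂ : Real.logb 2 A.maxFac + 1 ≤ u)
    {p : ℕ → X} {n : ℕ} {D : ℝ} (hp : BoundedStream p n A.Δ D) {t : ℕ} (htn : t < n)
    {s s' : State X} (hs : Inv A p D t s) (ht : TimeInv A τ u t s)
    (hs' : s' ∈ (step A KM (p t) s).support) : TimeInv A τ u (t + 1) s' := by
  have ha : 0 ≤ 3 * (1 + τ) * (A.k : ℝ) := by positivity
  have hpc : ∀ s₁ : State X, WeakInv A p D (t + 1) s₁ → A.k ≤ s₁.count + s₁.seen.card →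
      TimeInv A τ u (t + 1) s₁ → TimeInv A τ u (t + 1) (phaseChange A KM s₁) := by
    intro s₁ h1 h2 h3
    have h4 := h1.phaseChange_time_le hA hτ hKM h2
    unfold TimeInv at h3 ⊢
    have h5 : (phaseChange A KM s₁).count + (phaseChange A KM s₁).seen.card = 0 := by
      simp [phaseChange]
    rw [h5, Nat.cast_zero, mul_zero, add_zero]
    linarith
  rcases mem_support_step A KM hs' with ⟨hv, rfl⟩ | ⟨hv, heads, hheads, rfl⟩
  · have hw := (storeUpdate_weakInv hp.nonneg hs).record
    have h1 : TimeInv A τ u (t + 1)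
        (storeUpdate s (p t) (streamWeight A.h s.clock)).record := by
      unfold TimeInv at ht ⊢
      simp only [State.record, storeUpdate]
      have h2 : ((insert (p t) s.seen).card : ℝ) ≤ s.seen.card + 1 := by
        exact_mod_cast Finset.card_insert_le (p t) s.seen
      have h3 : (Nat.log 2 (s.fac.card + 1) : ℝ) ≤ Real.logb 2 A.maxFac := by
        refine (Real.natLog_le_logb _ _).trans ?_
        refine Real.logb_le_logb_of_le (by norm_num) (by positivity) ?_
        push_cast
        exact hs.card_le_maxFac
      push_cast at ht ⊢
      have h4 := mul_le_mul_of_nonneg_left h2 ha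
      linarith
    unfold storeCheck
    split_ifs with h2
    · refine hpc _ hw ?_ h1
      have h3 : (A.k : ℝ) ≤
          ((storeUpdate s (p t) (streamWeight A.h s.clock)).record.seen.card : ℝ) := by
        linarith [hA.h_pos]
      exact (by exact_mod_cast h3 : A.k ≤ _).trans (Nat.le_add_left _ _)
    · exact h1
  · have hw := (oflUpdate_weakInv hA hp htn hs hheads).record
    have hseen := (hs.first hv).1
    have h1 : TimeInv A τ u (t + 1)
        (oflUpdate s (p t) (streamWeight A.h s.clock) heads).record := by
      unfold TimeInv at ht ⊢
      simp only [State.record, oflUpdate]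
      have h3 := hs.card_le
      rw [hseen, Finset.card_empty, Nat.cast_zero, add_zero, mul_assoc] at h3
      change _ ≤ (A.γ - 1) * A.kap at h3
      push_cast at ht ⊢
      linarith
    unfold oflCheck
    split_ifs with h2 h3
    · exact hpc _ hw ((hw.le_count_of_overflow hA hseen h2).trans (Nat.le_add_right _ _)) h1
    · exact h1
    · exact h1

/-- Space bound. -/
def SpaceInv (A : Params) (τ : ℝ) (s : State X) : Prop :=
  (s.peak : ℝ) ≤ 2 * A.maxFac + (A.h + A.k + 1) + 8 + τ * A.maxFac + 2 * A.k

theorem step_spaceInv {A : Params} (hA : A.Valid) {KM : OfflineKMedian X A.k A.c}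
    {τ : ℝ} (hτ : 0 ≤ τ) (hKM : ∀ S w, (KM.space S w : ℝ) ≤ τ * S.card)
    {p : ℕ → X} {D : ℝ} {t : ℕ}
    {s s' : State X} (hs : Inv A p D t s) (ht : SpaceInv A τ s)
    (hs' : s' ∈ (step A KM (p t) s).support) : SpaceInv A τ s' := by
  have hk := hA.one_le_k
  have hm : 0 ≤ A.maxFac := by
    have := hs.card_le_maxFac
    have : (0 : ℝ) ≤ s.fac.card := Nat.cast_nonneg _
    linarith
  have hrec : ∀ s₁ : State X, (s₁.fac.card : ℝ) ≤ A.maxFac →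
      (s₁.seen.card : ℝ) ≤ A.h + A.k + 1 → SpaceInv A τ s₁ → SpaceInv A τ s₁.record := by
    intro s₁ h1 h2 h3
    unfold SpaceInv at h3 ⊢
    simp only [State.record, State.words, Nat.cast_max]
    refine max_le h3 ?_
    push_cast
    have := mul_nonneg hτ hm
    linarith
  have hpc : ∀ s₁ : State X, (s₁.fac.card : ℝ) ≤ A.maxFac →
      (s₁.seen.card : ℝ) ≤ A.h + A.k + 1 → SpaceInv A τ s₁ →
      SpaceInv A τ (phaseChange A KM s₁) := by
    intro s₁ h1 h2 h3
    unfold SpaceInv at h3 ⊢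
    simp only [phaseChange, State.words, Nat.cast_max]
    refine max_le h3 ?_
    have h4 := hKM s₁.fac s₁.wt
    have h5 := mul_le_mul_of_nonneg_left h1 hτ
    push_cast
    linarith
  have hcard := hs.card_le_maxFac
  have hseen := hs.seen_lt
  rcases mem_support_step A KM hs' with ⟨hv, rfl⟩ | ⟨hv, heads, hheads, rfl⟩
  · have h1 : (((storeUpdate s (p t) (streamWeight A.h s.clock)).fac.card : ℕ) : ℝ) ≤
        A.maxFac := by
      refine le_trans ?_ hcard
      exact_mod_cast Finset.card_insert_le (p t) s.fac
    have h2 : (((storeUpdate s (p t) (streamWeight A.h s.clock)).seen.card : ℕ) : ℝ) ≤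
        A.h + A.k + 1 := by
      have : (((storeUpdate s (p t) (streamWeight A.h s.clock)).seen.card : ℕ) : ℝ) ≤
          s.seen.card + 1 := by exact_mod_cast Finset.card_insert_le (p t) s.seen
      linarith
    have h3 := hrec _ h1 h2 ht
    unfold storeCheck
    split_ifs
    · exact hpc _ h1 h2 h3
    · exact h3
  · have h1 : (((oflUpdate s (p t) (streamWeight A.h s.clock) heads).fac.card : ℕ) : ℝ) ≤
        A.maxFac := by
      refine le_trans ?_ hcard
      cases heads
      · simp [oflUpdate]
      · exact_mod_cast Finset.card_insert_le (p t) s.fac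
    have h2 : (((oflUpdate s (p t) (streamWeight A.h s.clock) heads).seen.card : ℕ) : ℝ) ≤
        A.h + A.k + 1 := by
      change (s.seen.card : ℝ) ≤ _
      linarith
    have h3 := hrec _ h1 h2 ht
    unfold oflCheck
    split_ifs
    · exact hpc _ h1 h2 h3
    · exact h3
    · exact h3

/-! ### The resource bounds in terms of the parameters -/

/-- The factor by which `1 + log₂ W` may exceed `log₂ (2 + h Δ)` if `W ≤ ω h Δ`. -/
def logRatio (ω : ℝ) : ℝ := 2 + |Real.logb 2 ω|

theorem one_le_logb_two_add {y : ℝ} (hy : 0 ≤ y) : 1 ≤ Real.logb 2 (2 + y) := by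
  rw [Real.le_logb_iff_rpow_le (by norm_num) (by linarith), Real.rpow_one]
  linarith

theorem Params.Valid.logFactor_le {A : Params} (hA : A.Valid) {ω : ℝ} (hω : 0 < ω)
    (hW : A.W ≤ ω * (A.h * A.Δ)) :
    A.logFactor ≤ logRatio ω * Real.logb 2 (2 + A.h * A.Δ) := by
  have hh := hA.h_pos
  have hΔ := hA.one_le_Δ
  have h0 : 0 < A.h * A.Δ := by positivity
  have h1 : Real.logb 2 A.W ≤ Real.logb 2 ω + Real.logb 2 (2 + A.h * A.Δ) := by
    rw [← Real.logb_mul (by positivity) (by positivity)]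
    refine Real.logb_le_logb_of_le (by norm_num) (by linarith [hA.one_le_W]) (hW.trans ?_)
    gcongr
    linarith
  have h2 := one_le_logb_two_add h0.le
  have h3 := le_abs_self (Real.logb 2 ω)
  have h4 := abs_nonneg (Real.logb 2 ω)
  unfold Params.logFactor logRatio
  nlinarith

theorem Params.Valid.kap_le {A : Params} (hA : A.Valid) {ω : ℝ} (hω : 0 < ω)
    (hW : A.W ≤ ω * (A.h * A.Δ)) :
    A.kap ≤ logRatio ω * (A.k * Real.logb 2 (2 + A.h * A.Δ)) := by
  have := mul_le_mul_of_nonneg_left (hA.logFactor_le hω hW) (Nat.cast_nonneg (α := ℝ) A.k)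
  unfold Params.kap
  linarith

/-- The `h` verbatim points enter the look-up time only through a logarithm, so the time bound has
no term linear in `h`. -/
theorem Params.Valid.logb_maxFac_le {A : Params} (hA : A.Valid) :
    Real.logb 2 A.maxFac ≤ 2 * A.γ * A.kap + Real.logb 2 (2 + A.h * A.Δ) := by
  have hh := hA.h_pos
  have hΔ := hA.one_le_Δ
  have hγ := hA.le_γ
  have hκ := hA.one_le_kap
  have hk := hA.k_le_kap
  have h1 : A.maxFac ≤ (1 + A.γ * A.kap) * (2 + A.h * A.Δ) := by
    have h2 : A.h ≤ A.h * A.Δ := le_mul_of_one_le_right hh.le hΔ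
    have h3 : 0 ≤ A.γ * A.kap := by positivity
    have h4 : 0 ≤ A.γ * A.kap * (A.h * A.Δ) := by positivity
    unfold Params.maxFac
    nlinarith
  have h2 : 0 < A.maxFac := by
    unfold Params.maxFac
    nlinarith
  have h3 : 0 < 1 + A.γ * A.kap := by positivity
  have h4 : 0 < 2 + A.h * A.Δ := by positivity
  have h5 := Real.logb_le_logb_of_le (b := 2) (by norm_num) h2 h1
  rw [Real.logb_mul h3.ne' h4.ne'] at h5
  have h6 : Real.logb 2 (1 + A.γ * A.kap) ≤ 2 * (A.γ * A.kap) := by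
    rw [Real.logb, div_le_iff₀ (Real.log_pos (by norm_num))]
    have h7 := Real.log_le_sub_one_of_pos h3
    have h8 := Real.log_two_gt_d9
    have h9 : 0 ≤ A.γ * A.kap := by positivity
    nlinarith
  linarith

/-- The constant in the resource bounds. -/
def resourceConst (γ ω : ℝ) : ℝ := 3 * γ * logRatio ω + 20

theorem totalTime_le {A : Params} (hA : A.Valid) {ω : ℝ} (hω : 0 < ω)
    (hW : A.W ≤ ω * (A.h * A.Δ)) {KM : OfflineKMedian X A.k A.c}
    {τ : ℝ} (hτ : 0 ≤ τ) (hKM : ∀ S w, (KM.time S w : ℝ) ≤ τ * (A.k * S.card))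
    {p : ℕ → X} {n : ℕ} (hn : 0 < n) {D : ℝ} (hp : BoundedStream p n A.Δ D) {r : ℕ} (hr : 1 ≤ r)
    {l : List (State X)} (hl : l ∈ (run A KM p r n).support) :
    (totalTime KM l : ℝ) ≤ resourceConst A.γ ω * (1 + τ) * r *
      (n * A.k * Real.logb 2 (2 + A.h * A.Δ)) := by
  have hk := hA.one_le_k
  have hγ := hA.le_γ
  have hκ := hA.kap_le hω hW
  have hκ1 := hA.one_le_kap
  have hΛ := one_le_logb_two_add (mul_nonneg hA.h_pos.le (by linarith [hA.one_le_Δ] : 0 ≤ A.Δ))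
  set Λ := Real.logb 2 (2 + A.h * A.Δ)
  have hU1 : (A.k : ℝ) ≤ A.k * Λ := le_mul_of_one_le_right (by linarith) hΛ
  have hU2 : Λ ≤ A.k * Λ := le_mul_of_one_le_left (by linarith) hk
  set U := A.k * Λ
  have hlr : 2 ≤ logRatio ω := by
    unfold logRatio
    linarith [abs_nonneg (Real.logb 2 ω)]
  -- Large enough for a linear search among `(γ - 1) κ` facilities as well as for a look-up among
  -- `maxFac` points.
  set u := (2 * A.γ * logRatio ω + 2) * U with hu
  have hγκ : A.γ * A.kap ≤ A.γ * (logRatio ω * U) := by gcongr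
  obtain ⟨hlen, hall⟩ := mem_support_run A KM p r n
    (Q := fun t s => Inv A p D t s ∧ TimeInv A τ u t s)
    ⟨init_inv hA p D, by simp [TimeInv, State.init]⟩
    (fun t ht s hs s' hs' => ⟨step_inv hA KM hp ht hs.1 hs',
      step_timeInv hA hτ hKM (by nlinarith)
        (by linarith [hA.logb_maxFac_le]) hp ht hs.1 hs.2 hs'⟩) hl
  have hn1 : (1 : ℝ) ≤ n := by exact_mod_cast hn
  have hr1 : (1 : ℝ) ≤ r := by exact_mod_cast hr
  have htime : ((l.map State.time).sum : ℝ) ≤ r * ((u + 3 * (1 + τ) * A.k) * n) := by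
    have h1 := List.sum_le_card_nsmul (l.map fun s => (s.time : ℝ))
      ((u + 3 * (1 + τ) * A.k) * n) (by
        intro x hx
        obtain ⟨s, hs, rfl⟩ := List.mem_map.1 hx
        have h2 := (hall s hs).2
        unfold TimeInv at h2
        have : 0 ≤ 3 * (1 + τ) * (A.k : ℝ) * (s.count + s.seen.card : ℕ) := by positivity
        linarith)
    rw [List.length_map, hlen, nsmul_eq_mul] at h1
    refine le_trans (le_of_eq ?_) h1
    rw [Nat.cast_list_sum, List.map_map]
    rfl
  have hout : (((match l.argmin State.guess with
      | none => 0
      | some s => KM.time s.fac s.wt) : ℕ) : ℝ) ≤ τ * (U * n) := by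
    split
    · simpa using by positivity
    · rename_i s hs
      have h1 := (hall s (List.argmin_mem hs)).1
      have h2 : (s.fac.card : ℝ) ≤ n := by
        have := Finset.card_le_card h1.fac_subset
        have h3 := Finset.card_image_le (s := Finset.range n) (f := p)
        rw [Finset.card_range] at h3
        exact_mod_cast this.trans h3
      refine (hKM _ _).trans ?_
      gcongr
  unfold totalTime
  rw [Nat.cast_add, Nat.cast_add]
  rw [hlen]
  have hUn : 1 ≤ U * n := one_le_mul_of_one_le_of_one_le (hk.trans hU1) hn1
  have h1 : r * ((u + 3 * (1 + τ) * A.k) * n) ≤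
      (1 + τ) * r * ((2 * A.γ * logRatio ω + 5) * (U * n)) := by
    have h2 : u + 3 * (1 + τ) * A.k ≤ (1 + τ) * ((2 * A.γ * logRatio ω + 5) * U) := by
      have h3 : 0 ≤ u := by positivity
      have h4 : (1 + τ) * (A.k : ℝ) ≤ (1 + τ) * U := by gcongr
      nlinarith
    calc r * ((u + 3 * (1 + τ) * A.k) * n) ≤
        r * (((1 + τ) * ((2 * A.γ * logRatio ω + 5) * U)) * n) := by gcongr
      _ = _ := by ring
  have h2 : (r : ℝ) ≤ (1 + τ) * r * (U * n) := by
    have : (1 : ℝ) ≤ (1 + τ) * (U * n) :=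
      one_le_mul_of_one_le_of_one_le (by linarith) hUn
    nlinarith
  have h3 : τ * (U * n) ≤ (1 + τ) * r * (U * n) := by
    have : τ ≤ (1 + τ) * r := by nlinarith
    gcongr
  have h4 : resourceConst A.γ ω * (1 + τ) * r * (n * A.k * Λ) =
      (1 + τ) * r * ((3 * A.γ * logRatio ω + 20) * (U * n)) := by
    unfold resourceConst
    simp only [U]
    ring
  rw [h4]
  have h5 : (1 + τ) * r * ((2 * A.γ * logRatio ω + 7) * (U * n)) ≤
      (1 + τ) * r * ((3 * A.γ * logRatio ω + 20) * (U * n)) := by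
    gcongr
    · norm_num
    · norm_num
  refine (add_le_add (add_le_add htime le_rfl) hout).trans ?_
  linarith

theorem totalSpace_le {A : Params} (hA : A.Valid) {ω : ℝ} (hω : 0 < ω)
    (hW : A.W ≤ ω * (A.h * A.Δ)) {KM : OfflineKMedian X A.k A.c}
    {τ : ℝ} (hτ : 0 ≤ τ) (hKM : ∀ S w, (KM.space S w : ℝ) ≤ τ * S.card)
    {p : ℕ → X} {n : ℕ} {D : ℝ} (hp : BoundedStream p n A.Δ D) {r : ℕ} (hr : 1 ≤ r)
    {l : List (State X)} (hl : l ∈ (run A KM p r n).support) :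
    (totalSpace KM l : ℝ) ≤ resourceConst A.γ ω * (1 + τ) * r *
      (A.k * Real.logb 2 (2 + A.h * A.Δ) + A.h) := by
  have hk := hA.one_le_k
  have hh := hA.h_pos
  have hγ := hA.le_γ
  have hκ := hA.kap_le hω hW
  have hκ1 := hA.one_le_kap
  have hΛ := one_le_logb_two_add (mul_nonneg hA.h_pos.le (by linarith [hA.one_le_Δ] : 0 ≤ A.Δ))
  set Λ := Real.logb 2 (2 + A.h * A.Δ)
  have hU1 : (A.k : ℝ) ≤ A.k * Λ := le_mul_of_one_le_right (by linarith) hΛ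
  set U := A.k * Λ
  have hlr : 2 ≤ logRatio ω := by
    unfold logRatio
    linarith [abs_nonneg (Real.logb 2 ω)]
  have hγκ : A.γ * A.kap ≤ A.γ * (logRatio ω * U) := by gcongr
  have hm0 : 0 ≤ A.maxFac := by
    unfold Params.maxFac
    nlinarith
  have hm : A.maxFac ≤ (A.γ * logRatio ω + 1) * U + A.h := by
    unfold Params.maxFac
    linarith
  obtain ⟨hlen, hall⟩ := mem_support_run A KM p r n
    (Q := fun t s => Inv A p D t s ∧ SpaceInv A τ s)
    ⟨init_inv hA p D, by
      simp only [SpaceInv, State.init]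
      push_cast
      have := mul_nonneg hτ hm0
      linarith⟩
    (fun t ht s hs s' hs' => ⟨step_inv hA KM hp ht hs.1 hs',
      step_spaceInv hA hτ hKM hs.1 hs.2 hs'⟩) hl
  have hr1 : (1 : ℝ) ≤ r := by exact_mod_cast hr
  set B := 2 * A.maxFac + (A.h + A.k + 1) + 8 + τ * A.maxFac + 2 * A.k with hB
  have hpeak : ((l.map State.peak).sum : ℝ) ≤ r * B := by
    have h1 := List.sum_le_card_nsmul (l.map fun s => (s.peak : ℝ)) B (by
        intro x hx
        obtain ⟨s, hs, rfl⟩ := List.mem_map.1 hx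
        exact (hall s hs).2)
    rw [List.length_map, hlen, nsmul_eq_mul] at h1
    refine le_trans (le_of_eq ?_) h1
    rw [Nat.cast_list_sum, List.map_map]
    rfl
  have hout : (((match l.argmin State.guess with
      | none => 0
      | some s => KM.space s.fac s.wt) : ℕ) : ℝ) ≤ τ * A.maxFac := by
    split
    · simpa using mul_nonneg hτ hm0
    · rename_i s hs
      have h1 := (hall s (List.argmin_mem hs)).1.card_le_maxFac
      refine (hKM _ _).trans ?_
      gcongr
      linarith
  unfold totalSpace
  rw [Nat.cast_add, Nat.cast_add]
  have h1 : B + U + τ * A.maxFac ≤ (1 + τ) * (resourceConst A.γ ω * (U + A.h)) := by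
    have h2 : 2 * A.maxFac + (A.h + A.k + 1) + 8 + 2 * A.k + U ≤
        resourceConst A.γ ω * (U + A.h) := by
      have h3 : 0 ≤ A.γ * logRatio ω * A.h := by positivity
      have h4 : 0 ≤ A.γ * logRatio ω * U := by positivity
      unfold resourceConst
      linarith
    have h5 : 2 * A.maxFac ≤ resourceConst A.γ ω * (U + A.h) := by
      have h3 : 0 ≤ A.γ * logRatio ω * A.h := by positivity
      have h4 : 0 ≤ A.γ * logRatio ω * U := by positivity
      unfold resourceConst
      linarith
    have h6 := mul_le_mul_of_nonneg_left h5 hτ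
    linarith
  have h2 : (A.k : ℝ) + τ * A.maxFac ≤ r * (U + τ * A.maxFac) := by
    have h3 : 0 ≤ U + τ * A.maxFac := by
      have := mul_nonneg hτ hm0
      linarith
    nlinarith
  refine (add_le_add (add_le_add hpeak le_rfl) hout).trans ?_
  calc _ ≤ r * (B + U + τ * A.maxFac) := by linarith
    _ ≤ r * ((1 + τ) * (resourceConst A.γ ω * (U + A.h))) := by gcongr
    _ = _ := by ring

end Algorithm

section Algorithm

variable {X : Type u} [MetricSpace X] [DecidableEq X]

/-! ### Lower bounds for the optimal cost -/

/-- Every centre is close to at most one point of a separated set. -/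
theorem card_filter_infDist_lt_le {Q S : Finset X} (hS : S.Nonempty) {ε : ℝ}
    (hQ : ∀ x ∈ Q, ∀ y ∈ Q, x ≠ y → 2 * ε ≤ dist x y) :
    (Q.filter fun x => Metric.infDist x (S : Set X) < ε).card ≤ S.card := by
  refine Finset.card_le_card_of_injOn (nearest S) (fun x _ => nearest_mem hS x) ?_
  intro x hx y hy hxy
  simp only [Finset.coe_filter, Set.mem_ofPred_eq, infDist_eq_dist_nearest hS] at hx hy
  by_contra hne
  have h1 := hQ x hx.1 y hy.1 hne
  have h2 := dist_triangle_right x y (nearest S x)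
  have h3 := hy.2
  rw [← hxy] at h3
  linarith [hx.2]

/-- Each centre is within `ε` of at most one point of `Q`, so all but `S.card` points pay at least
`ε`. -/
theorem le_sum_infDist {Q S : Finset X} (hS : S.Nonempty) {ε : ℝ} (hε : 0 ≤ ε)
    (hQ : ∀ x ∈ Q, ∀ y ∈ Q, x ≠ y → 2 * ε ≤ dist x y) :
    ((Q.card : ℝ) - S.card) * ε ≤ ∑ x ∈ Q, Metric.infDist x (S : Set X) := by
  have h1 := card_filter_infDist_lt_le hS hQ
  have h2 := Finset.card_filter_add_card_filter_not (s := Q)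
    (fun x => Metric.infDist x (S : Set X) < ε)
  have h3 : (Q.card : ℝ) - S.card ≤
      (Q.filter fun x => ¬ Metric.infDist x (S : Set X) < ε).card := by
    rw [sub_le_iff_le_add]
    exact_mod_cast (by omega)
  calc ((Q.card : ℝ) - S.card) * ε ≤
        (Q.filter fun x => ¬ Metric.infDist x (S : Set X) < ε).card * ε := by gcongr
    _ ≤ ∑ x ∈ Q.filter fun x => ¬ Metric.infDist x (S : Set X) < ε,
          Metric.infDist x (S : Set X) := by
        rw [← nsmul_eq_mul]
        refine Finset.card_nsmul_le_sum _ _ _ fun x hx => ?_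
        exact not_lt.1 (Finset.mem_filter.1 hx).2
    _ ≤ _ := Finset.sum_le_sum_of_subset_of_nonneg (Finset.filter_subset _ _)
        fun x _ _ => Metric.infDist_nonneg

theorem sum_image_infDist_le (p : ℕ → X) (I : Finset ℕ) (S : Finset X) :
    ∑ x ∈ I.image p, Metric.infDist x (S : Set X) ≤
      ∑ i ∈ I, Metric.infDist (p i) (S : Set X) := by
  rw [← Finset.sum_fiberwise_of_maps_to (s := I) (t := I.image p) (g := p)
    (fun i hi => Finset.mem_image_of_mem p hi)]
  refine Finset.sum_le_sum fun x hx => ?_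
  obtain ⟨i, hi, rfl⟩ := Finset.mem_image.1 hx
  exact Finset.single_le_sum (f := fun j => Metric.infDist (p j) (S : Set X))
    (fun j _ => Metric.infDist_nonneg) (Finset.mem_filter.2 ⟨hi, rfl⟩)

theorem streamWeight_mul_sum_infDist_le {h : ℝ} (hh : 0 < h) (p : ℕ → X) {a b n : ℕ}
    (hb : b ≤ n) (S : Finset X) :
    streamWeight h a * ∑ x ∈ (Finset.Ico a b).image p, Metric.infDist x (S : Set X) ≤
      streamCost h p n S := by
  calc _ ≤ streamWeight h a * ∑ i ∈ Finset.Ico a b, Metric.infDist (p i) (S : Set X) :=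
        mul_le_mul_of_nonneg_left (sum_image_infDist_le p _ S) (streamWeight_pos h a).le
    _ ≤ ∑ i ∈ Finset.Ico a b, streamWeight h i * Metric.infDist (p i) (S : Set X) := by
        rw [Finset.mul_sum]
        refine Finset.sum_le_sum fun i hi => ?_
        exact mul_le_mul_of_nonneg_right (streamWeight_mono hh (Finset.mem_Ico.1 hi).1)
          Metric.infDist_nonneg
    _ ≤ _ := by
        refine Finset.sum_le_sum_of_subset_of_nonneg (fun i hi => ?_) fun i _ _ =>
          mul_nonneg (streamWeight_pos h i).le Metric.infDist_nonneg
        have := (Finset.mem_Ico.1 hi).2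
        exact Finset.mem_range.2 (by omega)

theorem streamCost_mono (h : ℝ) (p : ℕ → X) {t n : ℕ} (htn : t ≤ n) (S : Finset X) :
    streamCost h p t S ≤ streamCost h p n S :=
  Finset.sum_le_sum_of_subset_of_nonneg (Finset.range_subset_range.2 htn) fun i _ _ =>
    mul_nonneg (streamWeight_pos h i).le Metric.infDist_nonneg

/-- If there are more than `k` distinct points, no `k` centres have a small cost. -/
theorem BoundedStream.half_le_streamCost {h : ℝ} (hh : 0 < h) {p : ℕ → X} {n : ℕ} {Δ D : ℝ}
    (hp : BoundedStream p n Δ D) {k : ℕ} (hk : k < ((Finset.range n).image p).card)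
    {S : Finset X} (hS : S.Nonempty) (hSk : S.card ≤ k) : 1 / 2 ≤ streamCost h p n S := by
  have h1 := le_sum_infDist (Q := (Finset.range n).image p) hS (ε := 1 / 2) (by norm_num) (by
    intro x hx y hy hxy
    obtain ⟨i, hi, rfl⟩ := Finset.mem_image.1 hx
    obtain ⟨j, hj, rfl⟩ := Finset.mem_image.1 hy
    have := hp.one_le_dist i (Finset.mem_range.1 hi) j (Finset.mem_range.1 hj) hxy
    linarith)
  have h2 := streamWeight_mul_sum_infDist_le hh p (a := 0) (le_refl n) S
  rw [← Finset.range_eq_Ico] at h2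
  have h3 : (1 : ℝ) ≤ (((Finset.range n).image p).card : ℝ) - S.card := by
    rw [le_sub_iff_add_le]
    exact_mod_cast (by omega)
  have h4 := one_le_streamWeight hh 0
  have h5 : 0 ≤ ∑ x ∈ (Finset.range n).image p, Metric.infDist x (S : Set X) :=
    Finset.sum_nonneg fun x _ => Metric.infDist_nonneg
  nlinarith

/-- The points of a complete second sub-phase of a phase that starts at time `T` have a large
cost. -/
theorem BoundedStream.le_two_mul_streamCost {A : Params} (hA : A.Valid) {p : ℕ → X} {n : ℕ}
    {D : ℝ} (hp : BoundedStream p n A.Δ D) {S : Finset X} (hS : S.Nonempty) (hSk : S.card ≤ A.k)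
    {T a b : ℕ} (ha : T + phaseLen A.h A.Δ ≤ a) (hb : b ≤ n)
    (hcard : A.h + A.k ≤ (((Finset.Ico a b).image p).card : ℝ)) :
    A.h * D * streamWeight A.h T ≤ 2 * streamCost A.h p n S := by
  have hh := hA.h_pos
  have hΔ := hA.one_le_Δ
  have hD := hp.nonneg
  -- Nonzero distances are at least `D / Δ`; half of this is the radius. The factor `Δ` lost here is
  -- regained in `h4` from the growth of the weights since `T`.
  have h1 := le_sum_infDist (Q := (Finset.Ico a b).image p) hS (ε := D / (2 * A.Δ))
    (by positivity) (by
      intro x hx y hy hxy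
      obtain ⟨i, hi, rfl⟩ := Finset.mem_image.1 hx
      obtain ⟨j, hj, rfl⟩ := Finset.mem_image.1 hy
      have := hp.le_mul_dist i (by linarith [(Finset.mem_Ico.1 hi).2]) j
        (by linarith [(Finset.mem_Ico.1 hj).2]) hxy
      rw [← mul_div_assoc, div_le_iff₀ (by positivity)]
      linarith)
  have h2 := streamWeight_mul_sum_infDist_le hh p (a := a) hb S
  have h3 : A.h ≤ (((Finset.Ico a b).image p).card : ℝ) - S.card := by
    have : (S.card : ℝ) ≤ A.k := by exact_mod_cast hSk
    linarith
  have h4 : A.Δ * streamWeight A.h T ≤ streamWeight A.h a := by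
    refine le_trans ?_ (streamWeight_mono hh ha)
    rw [streamWeight_add, mul_comm]
    exact mul_le_mul_of_nonneg_left (le_two_rpow_phaseLen hh hΔ) (streamWeight_pos _ _).le
  have h5 : A.h * (D / (2 * A.Δ)) ≤
      ∑ x ∈ (Finset.Ico a b).image p, Metric.infDist x (S : Set X) := by
    refine le_trans ?_ h1
    gcongr
  have hw := streamWeight_pos A.h T
  have h6 : A.Δ * streamWeight A.h T * (A.h * (D / (2 * A.Δ))) ≤ streamCost A.h p n S := by
    refine le_trans ?_ h2
    exact mul_le_mul h4 h5 (by positivity) (streamWeight_pos _ _).le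
  have h7 : A.Δ * streamWeight A.h T * (A.h * (D / (2 * A.Δ))) =
      A.h * D * streamWeight A.h T / 2 := by
    field_simp
  linarith

/-! ### The second sub-phase of a late phase -/

/-- Indicator of a guess above `G`. -/
def exceeds (G : ℝ) (s : State X) : ENNReal :=
  open Classical in if G < s.guess then 1 else 0

theorem exceeds_le_one (G : ℝ) (s : State X) : exceeds G s ≤ 1 := by
  unfold exceeds
  split_ifs <;> simp

theorem exceeds_eq_zero {G : ℝ} {s : State X} (h : s.guess ≤ G) : exceeds G s = 0 :=
  if_neg (not_lt.2 h)

/-- A second sub-phase that is not completed before time `n` keeps the guess. -/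
theorem value_eq_zero_of_verbatim {A : Params} (hA : A.Valid) (KM : OfflineKMedian X A.k A.c)
    {p : ℕ → X} {n : ℕ} {D : ℝ} (hp : BoundedStream p n A.Δ D) {S : Finset X} (hS : S.Nonempty)
    (hSk : S.card ≤ A.k) {G : ℝ} {T : ℕ}
    (hT : 2 * streamCost A.h p n S < A.h * D * streamWeight A.h T) {m t : ℕ} (hn : t + m = n)
    {s : State X} (hv : s.verbatim = true) (hG : s.guess ≤ G) {a : ℕ}
    (ha : T + phaseLen A.h A.Δ ≤ a) (hat : a ≤ t) (hseen : s.seen = (Finset.Ico a t).image p) :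
    value A KM p (exceeds G) m t s = 0 := by
  induction m generalizing t s with
  | zero => exact exceeds_eq_zero hG
  | succ m ih =>
    simp only [value]
    rw [expect_step_of_verbatim A KM (p t) hv]
    have h1 : (storeUpdate s (p t) (streamWeight A.h s.clock)).record.seen =
        (Finset.Ico a (t + 1)).image p := by
      simp only [State.record, storeUpdate, hseen]
      rw [← Finset.image_insert, Nat.Ico_succ_right_eq_insert_Ico hat]
    have h2 : storeCheck A KM (storeUpdate s (p t) (streamWeight A.h s.clock)).record =
        (storeUpdate s (p t) (streamWeight A.h s.clock)).record := by
      unfold storeCheck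
      rw [if_neg]
      intro h3
      rw [h1] at h3
      have := hp.le_two_mul_streamCost hA hS hSk ha (by omega : t + 1 ≤ n) h3
      linarith
    rw [h2]
    exact ih (by omega) hv hG (by omega) h1

/-! ### The first sub-phase of a phase with a large guess -/

/-- One step of a supermartingale estimate. The bound for tails is required only if tails can occur,
since the invariants hold only on the support. -/
theorem coin_expect_le {q : NNReal} (hq : q ≤ 1) {u v : ENNReal} {x y z : ℝ} (hx : 0 ≤ x)
    (hy : 0 ≤ y) (hu : u ≤ ENNReal.ofReal x) (hv : q < 1 → v ≤ ENNReal.ofReal y)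
    (hz : q * x + (1 - q) * y ≤ z) :
    (q : ENNReal) * u + ((1 - q : NNReal) : ENNReal) * v ≤ ENNReal.ofReal z := by
  have h1 : ((1 - q : NNReal) : ENNReal) * v ≤ ENNReal.ofReal ((1 - q) * y) := by
    rcases hq.lt_or_eq with h | h
    · rw [ENNReal.ofReal_mul (by have : (q : ℝ) ≤ 1 := hq
                                 linarith)]
      refine mul_le_mul' (le_of_eq ?_) (hv h)
      rw [← NNReal.coe_one, ← NNReal.coe_sub hq, ENNReal.ofReal_coe_nnreal]
    · simp [h]
  have h2 : (q : ENNReal) * u ≤ ENNReal.ofReal (q * x) := by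
    rw [ENNReal.ofReal_mul q.coe_nonneg]
    exact mul_le_mul' (by rw [ENNReal.ofReal_coe_nnreal]) hu
  have hq' : (q : ℝ) ≤ 1 := hq
  refine (add_le_add h2 h1).trans ?_
  rw [← ENNReal.ofReal_add (mul_nonneg q.coe_nonneg hx) (mul_nonneg (by linarith) hy)]
  exact ENNReal.ofReal_le_ofReal hz

/-- Scales for the clusters of `S`, on the points that a phase starting at time `T` reads in its
first sub-phase. -/
theorem exists_cluster_scale {A : Params} (hA : A.Valid) (p : ℕ → X) (n T : ℕ) {S : Finset X}
    (hS : S.Nonempty) (hSk : S.card ≤ A.k) (hO : 0 < streamCost A.h p n S) :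
    ∃ a : X → ℝ, (∀ s, 0 < a s) ∧
      (∀ i ∈ Finset.Ico T (min (T + phaseLen A.h A.Δ) n),
        Metric.infDist (p i) (S : Set X) ≤ a (nearest S (p i)) * A.W) ∧
      ∑ i ∈ Finset.Ico T (min (T + phaseLen A.h A.Δ) n),
        streamWeight A.h i * a (nearest S (p i)) ≤ 2 * streamCost A.h p n S := by
  set I := Finset.Ico T (min (T + phaseLen A.h A.Δ) n) with hI
  set O := streamCost A.h p n S
  have hk := hA.one_le_k
  have hW := hA.one_le_W
  have hwT := streamWeight_pos A.h T
  let cost : X → ℝ := fun s => ∑ i ∈ I.filter (fun i => nearest S (p i) = s),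
    streamWeight A.h i * Metric.infDist (p i) (S : Set X)
  let wgt : X → ℝ := fun s => ∑ i ∈ I.filter (fun i => nearest S (p i) = s), streamWeight A.h i
  have hnn : ∀ i, 0 ≤ streamWeight A.h i * Metric.infDist (p i) (S : Set X) := fun i =>
    mul_nonneg (streamWeight_pos _ _).le Metric.infDist_nonneg
  have hcost : ∀ s, 0 ≤ cost s := fun s => Finset.sum_nonneg fun i _ => hnn i
  have hwgt : ∀ s, wgt s ≤ A.W * streamWeight A.h T := fun s => by
    calc wgt s ≤ ∑ i ∈ I, streamWeight A.h i :=
          Finset.sum_le_sum_of_subset_of_nonneg (Finset.filter_subset _ _)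
            fun i _ _ => (streamWeight_pos _ _).le
      _ ≤ phaseWeight A.h A.Δ * streamWeight A.h T :=
          sum_Ico_streamWeight_le _ _ (min_le_left _ _)
      _ ≤ _ := mul_le_mul_of_nonneg_right hA.le_W hwT.le
  have hmax : ∀ s, 0 < max (wgt s) (streamWeight A.h T) := fun s => lt_max_of_lt_right hwT
  have hOk : 0 < O / A.k := by positivity
  -- The scale of a cluster is its average cost, with a share `O / k` added to make it positive; the
  -- at most `k` shares add up to at most `O`. The floor `w_T` in the denominator covers empty
  -- clusters. Since the sub-phase has weight at most `W w_T`, no point of the cluster is farther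
  -- than `W` times the scale.
  refine ⟨fun s => (cost s + O / A.k) / max (wgt s) (streamWeight A.h T), fun s => ?_,
    fun i hi => ?_, ?_⟩
  · have := hcost s
    exact div_pos (by linarith) (hmax s)
  · set s := nearest S (p i) with hs
    have h1 : streamWeight A.h i * Metric.infDist (p i) (S : Set X) ≤ cost s :=
      Finset.single_le_sum (f := fun i => streamWeight A.h i * Metric.infDist (p i) (S : Set X))
        (fun j _ => hnn j) (Finset.mem_filter.2 ⟨hi, rfl⟩)
    have h2 : streamWeight A.h T ≤ streamWeight A.h i :=
      streamWeight_mono hA.h_pos (Finset.mem_Ico.1 hi).1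
    have h3 : max (wgt s) (streamWeight A.h T) ≤ A.W * streamWeight A.h T :=
      max_le (hwgt s) (by nlinarith)
    have h4 : (0 : ℝ) ≤ Metric.infDist (p i) (S : Set X) := Metric.infDist_nonneg
    have h5 : streamWeight A.h T * Metric.infDist (p i) (S : Set X) ≤ cost s + O / A.k := by
      nlinarith
    change _ ≤ (cost s + O / A.k) / max (wgt s) (streamWeight A.h T) * A.W
    rw [div_mul_eq_mul_div, le_div_iff₀ (hmax s)]
    calc _ ≤ Metric.infDist (p i) (S : Set X) * (A.W * streamWeight A.h T) := by gcongr
      _ = streamWeight A.h T * Metric.infDist (p i) (S : Set X) * A.W := by ring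
      _ ≤ _ := by gcongr
  · rw [← Finset.sum_fiberwise_of_maps_to (s := I) (t := S) (g := fun i => nearest S (p i))
      (fun i _ => nearest_mem hS _)]
    calc _ ≤ ∑ s ∈ S, (cost s + O / A.k) := by
          refine Finset.sum_le_sum fun s _ => ?_
          have h1 : ∑ i ∈ I.filter (fun i => nearest S (p i) = s), streamWeight A.h i *
              ((cost (nearest S (p i)) + O / A.k) /
                max (wgt (nearest S (p i))) (streamWeight A.h T)) =
              wgt s * ((cost s + O / A.k) / max (wgt s) (streamWeight A.h T)) := by
            rw [Finset.sum_mul]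
            refine Finset.sum_congr rfl fun i hi => ?_
            rw [(Finset.mem_filter.1 hi).2]
          rw [h1, ← mul_div_assoc, div_le_iff₀ (hmax s), mul_comm]
          exact mul_le_mul_of_nonneg_left (le_max_left _ _) (by linarith [hcost s])
      _ = ∑ s ∈ S, cost s + S.card * (O / A.k) := by
          rw [Finset.sum_add_distrib, Finset.sum_const, nsmul_eq_mul]
      _ ≤ O + O := by
          gcongr
          · rw [Finset.sum_fiberwise_of_maps_to (s := I) (t := S) (g := fun i => nearest S (p i))
              (fun i _ => nearest_mem hS _)]
            refine Finset.sum_le_sum_of_subset_of_nonneg (fun i hi => ?_) fun i _ _ => hnn i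
            have := (Finset.mem_Ico.1 hi).2
            exact Finset.mem_range.2 (by omega)
          · rw [← mul_div_assoc, div_le_iff₀ (by positivity), mul_comm]
            have : (S.card : ℝ) ≤ A.k := by exact_mod_cast hSk
            gcongr
      _ = 2 * O := by ring

/-! ### Halving the distances from the centres to the facilities. -/

/-- The number of times that the distance of the centre `s` to the facilities may still be halved
before it falls below the scale `a`. -/
def ringPot (A : Params) (C : Finset X) (a : ℝ) (s : X) : ℝ :=
  min A.logFactor (max 0 (Real.logb 2 (Metric.infDist s (C : Set X) / a)))

theorem ringPot_nonneg {A : Params} (hA : A.Valid) (C : Finset X) (a : ℝ) (s : X) :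
    0 ≤ ringPot A C a s :=
  le_min (by linarith [hA.one_le_logFactor]) (le_max_left _ _)

theorem max_logb_div_le {a r r' : ℝ} (ha : 0 < a) (hr : 0 ≤ r) (hrr' : r ≤ r') :
    max 0 (Real.logb 2 (r / a)) ≤ max 0 (Real.logb 2 (r' / a)) := by
  rcases hr.eq_or_lt with rfl | hr
  · simp
  · refine max_le_max le_rfl (Real.logb_le_logb_of_le (by norm_num) (by positivity) ?_)
    gcongr

theorem ringPot_insert_le {A : Params} {C : Finset X} (hC : C.Nonempty) {a : ℝ} (ha : 0 < a)
    (x s : X) : ringPot A (insert x C) a s ≤ ringPot A C a s := by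
  refine min_le_min le_rfl (max_logb_div_le ha Metric.infDist_nonneg ?_)
  exact Metric.infDist_le_infDist_of_subset (by simp) (by exact_mod_cast hC)

/-- The distance of `s` to the facilities more than halves. As it exceeded `2 a`, its logarithm was
above 1, so truncation at zero does no harm. If the cap was active, the new distance is still at
most `a W`, which puts the new value at most at `log₂ W`, one below the cap. -/
theorem ringPot_insert_add_one_le {A : Params} (hA : A.Valid) {C : Finset X} {a : ℝ}
    (ha : 0 < a) {x s : X} (hx : dist x s ≤ a * A.W)
    (h1 : 2 * a < Metric.infDist s (C : Set X))
    (h2 : 2 * dist x s < Metric.infDist s (C : Set X)) :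
    ringPot A (insert x C) a s + 1 ≤ ringPot A C a s := by
  set r := Metric.infDist s (C : Set X)
  have hW := hA.one_le_W
  have h3 : Metric.infDist s ((insert x C : Finset X) : Set X) ≤ dist x s := by
    rw [dist_comm]
    exact Metric.infDist_le_dist_of_mem (by simp)
  have h4 : max 0 (Real.logb 2 (Metric.infDist s ((insert x C : Finset X) : Set X) / a)) ≤
      Real.logb 2 A.W := by
    refine (max_logb_div_le ha Metric.infDist_nonneg (h3.trans hx)).trans ?_
    rw [mul_div_cancel_left₀ _ ha.ne']
    exact max_le (Real.logb_nonneg (by norm_num) hW) le_rfl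
  have h5 : Real.logb 2 (r / a) = Real.logb 2 (r / 2 / a) + 1 := by
    rw [show r / a = r / 2 / a * 2 by ring, Real.logb_mul (by
      have : 0 < r := by linarith
      positivity) (by norm_num), Real.logb_self_eq_one (by norm_num)]
  have h6 : 0 ≤ Real.logb 2 (r / 2 / a) := by
    refine Real.logb_nonneg (by norm_num) ?_
    rw [le_div_iff₀ ha]
    linarith
  have h7 : max 0 (Real.logb 2 (Metric.infDist s ((insert x C : Finset X) : Set X) / a)) ≤
      Real.logb 2 (r / 2 / a) := by
    refine (max_logb_div_le ha Metric.infDist_nonneg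
      (h3.trans (by linarith : dist x s ≤ r / 2))).trans ?_
    exact max_le h6 le_rfl
  have h8 : ringPot A (insert x C) a s ≤
      max 0 (Real.logb 2 (Metric.infDist s ((insert x C : Finset X) : Set X) / a)) :=
    min_le_right _ _
  refine le_min ?_ (le_max_of_le_right (by linarith))
  unfold Params.logFactor
  linarith

/-- The sum of the two failure rates. -/
def Params.failRate (A : Params) : ℝ := 1 / A.γ + 1 / (A.γ - 2)

/-- Upper bound, in units of `1 / guess`, for the probability that the first sub-phase ends with a
phase change. -/
def critPot (A : Params) (S : Finset X) (a : X → ℝ) (ρ : ℕ → ℝ) (e : ℕ) (s : State X) : ℝ :=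
  s.svc / A.γ + A.facilityCost s.guess * (s.fac.card - A.k : ℕ) / (A.γ - 2) +
    A.failRate * (A.facilityCost s.guess * ∑ x ∈ S, ringPot A s.fac (a x) x) +
    3 * A.failRate * ∑ i ∈ Finset.Ico s.clock e, ρ i

theorem Params.Valid.failRate_nonneg {A : Params} (hA : A.Valid) : 0 ≤ A.failRate := by
  have := hA.le_γ
  unfold Params.failRate
  have : 0 < A.γ - 2 := by linarith
  positivity

theorem critPot_nonneg {A : Params} (hA : A.Valid) (S : Finset X) (a : X → ℝ) {ρ : ℕ → ℝ}
    (hρ : ∀ i, 0 ≤ ρ i) (e : ℕ) {s : State X} (hs : 0 ≤ s.svc) (hg : 1 ≤ s.guess) :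
    0 ≤ critPot A S a ρ e s := by
  have h1 := hA.le_γ
  have h2 := hA.facilityCost_pos (L := s.guess) (by linarith)
  have h3 := hA.failRate_nonneg
  have h4 : 0 < A.γ - 2 := by linarith
  have h5 : 0 ≤ ∑ x ∈ S, ringPot A s.fac (a x) x :=
    Finset.sum_nonneg fun x _ => ringPot_nonneg hA _ _ _
  have h6 : 0 ≤ ∑ i ∈ Finset.Ico s.clock e, ρ i := Finset.sum_nonneg fun i _ => hρ i
  unfold critPot
  positivity

/-- A first sub-phase that ends with a phase change has a large potential. -/
theorem guess_le_critPot {A : Params} (hA : A.Valid) (S : Finset X) (a : X → ℝ) {ρ : ℕ → ℝ}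
    (hρ : ∀ i, 0 ≤ ρ i) (e : ℕ) {s : State X} (hs : 0 ≤ s.svc) (hg : 1 ≤ s.guess)
    (h : A.γ * s.guess < s.svc ∨ (A.γ - 1) * A.k * A.logFactor < (s.fac.card : ℝ)) :
    s.guess ≤ critPot A S a ρ e s := by
  have h1 := hA.le_γ
  have h2 := hA.facilityCost_pos (L := s.guess) (by linarith)
  have h3 := hA.failRate_nonneg
  have h4 : 0 < A.γ - 2 := by linarith
  have h5 : 0 ≤ ∑ x ∈ S, ringPot A s.fac (a x) x :=
    Finset.sum_nonneg fun x _ => ringPot_nonneg hA _ _ _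
  have h6 : 0 ≤ ∑ i ∈ Finset.Ico s.clock e, ρ i := Finset.sum_nonneg fun i _ => hρ i
  have h7 : 0 ≤ A.failRate * (A.facilityCost s.guess * ∑ x ∈ S, ringPot A s.fac (a x) x) := by
    positivity
  have h8 : 0 ≤ 3 * A.failRate * ∑ i ∈ Finset.Ico s.clock e, ρ i := by positivity
  have h9 : 0 ≤ s.svc / A.γ := by positivity
  have h10 : 0 ≤ A.facilityCost s.guess * (s.fac.card - A.k : ℕ) / (A.γ - 2) := by positivity
  unfold critPot
  rcases h with h | h
  · have : s.guess ≤ s.svc / A.γ := by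
      rw [le_div_iff₀ (by linarith)]
      linarith
    linarith
  -- The `k` facilities kept from the previous phase are free. As `k ≤ κ`, more than `(γ - 1) κ`
  -- facilities mean more than `(γ - 2) κ` charged ones, of cost `L / κ` each.
  · have : s.guess ≤ A.facilityCost s.guess * (s.fac.card - A.k : ℕ) / (A.γ - 2) := by
      rw [le_div_iff₀ h4, A.facilityCost_eq, div_mul_eq_mul_div, le_div_iff₀ hA.kap_pos]
      rw [mul_assoc] at h
      change (A.γ - 1) * A.kap < _ at h
      have h11 := hA.k_le_kap
      have h12 : (s.fac.card : ℝ) - A.k ≤ (s.fac.card - A.k : ℕ) := by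
        rw [sub_le_iff_le_add]
        exact_mod_cast (by omega)
      rw [mul_assoc]
      refine mul_le_mul_of_nonneg_left ?_ (by linarith)
      linarith
    linarith

end Algorithm

section Algorithm

variable {X : Type u} [MetricSpace X] [DecidableEq X]

/-- What the `i`-th point contributes to the cost once its ring contains a facility. -/
def ringCharge (h : ℝ) (p : ℕ → X) (S : Finset X) (a : X → ℝ) (i : ℕ) : ℝ :=
  streamWeight h i * (Metric.infDist (p i) (S : Set X) + a (nearest S (p i)))

theorem ringCharge_nonneg (h : ℝ) (p : ℕ → X) (S : Finset X) {a : X → ℝ} (ha : ∀ x, 0 < a x)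
    (i : ℕ) : 0 ≤ ringCharge h p S a i :=
  mul_nonneg (streamWeight_pos _ _).le (add_nonneg Metric.infDist_nonneg (ha _).le)

/-- Either the point is served cheaply, or a facility at the point brings the facilities closer
to its centre. -/
theorem dist_nearest_le_or_ringPot_le {A : Params} (hA : A.Valid) {p : ℕ → X} {S : Finset X}
    (hS : S.Nonempty) {a : X → ℝ} (ha : ∀ x, 0 < a x) {t : ℕ}
    (hat : Metric.infDist (p t) (S : Set X) ≤ a (nearest S (p t)) * A.W)
    {C : Finset X} (hC : C.Nonempty) :
    streamWeight A.h t * dist (p t) (nearest C (p t)) ≤ 3 * ringCharge A.h p S a t ∨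
      ∑ x ∈ S, ringPot A (insert (p t) C) (a x) x + 1 ≤ ∑ x ∈ S, ringPot A C (a x) x := by
  set c := nearest S (p t) with hc
  have hcS : c ∈ S := nearest_mem hS _
  rw [infDist_eq_dist_nearest hS] at hat
  have h0 : dist (p t) (nearest C (p t)) ≤ dist (p t) c + Metric.infDist c (C : Set X) := by
    rw [← infDist_eq_dist_nearest hC, add_comm]
    exact Metric.infDist_le_infDist_add_dist
  by_cases h : 2 * a c < Metric.infDist c (C : Set X) ∧
      2 * dist (p t) c < Metric.infDist c (C : Set X)
  · right
    rw [← Finset.add_sum_erase _ _ hcS, ← Finset.add_sum_erase S (fun x => ringPot A C (a x) x) hcS]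
    have h1 := ringPot_insert_add_one_le hA (ha c) hat h.1 h.2
    have h2 : ∑ x ∈ S.erase c, ringPot A (insert (p t) C) (a x) x ≤
        ∑ x ∈ S.erase c, ringPot A C (a x) x :=
      Finset.sum_le_sum fun x _ => ringPot_insert_le hC (ha x) _ _
    linarith
  · left
    unfold ringCharge
    rw [infDist_eq_dist_nearest hS, ← hc]
    have hac := ha c
    have hd : 0 ≤ dist (p t) c := dist_nonneg
    -- The centre has a facility within twice the larger of `a c` and `dist (p t) c`; the path to it
    -- leads through the centre.
    have h1 : dist (p t) (nearest C (p t)) ≤ 3 * (dist (p t) c + a c) := by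
      rw [not_and_or, not_lt, not_lt] at h
      rcases h with h | h <;> linarith
    calc _ ≤ streamWeight A.h t * (3 * (dist (p t) c + a c)) :=
          mul_le_mul_of_nonneg_left h1 (streamWeight_pos _ _).le
      _ = _ := by ring

/-- Write `d` for the distance of the point to the facilities. For `q = min (w d / f) 1` the
expected service cost `(1 - q) w d` is at most both `w d` and `q f`, and the expected facility cost
`q f` is at most `w d`. A cheap point is paid for by its ring charge. Otherwise heads lowers the
ring potential by at least one, and this releases `failRate * q * f` in expectation, enough for
both. -/
theorem critPot_step_le {A : Params} (hA : A.Valid) {p : ℕ → X} {S : Finset X}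
    (hS : S.Nonempty) {a : X → ℝ} (ha : ∀ x, 0 < a x) {t e : ℕ} (hte : t < e)
    (hat : Metric.infDist (p t) (S : Set X) ≤ a (nearest S (p t)) * A.W)
    {s : State X} (hclock : s.clock = t) (hg : 1 ≤ s.guess) (hC : s.fac.Nonempty) :
    openProb A s (p t) (streamWeight A.h t) *
        critPot A S a (ringCharge A.h p S a) e (oflUpdate s (p t) (streamWeight A.h t) true) +
      (1 - openProb A s (p t) (streamWeight A.h t)) *
        critPot A S a (ringCharge A.h p S a) e (oflUpdate s (p t) (streamWeight A.h t) false) ≤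
      critPot A S a (ringCharge A.h p S a) e s := by
  have hγ := hA.le_γ
  have hγ2 : 0 < A.γ - 2 := by linarith
  have hf := hA.facilityCost_pos (L := s.guess) (by linarith)
  have hw := streamWeight_pos A.h t
  have hprob := openProb_eq (A := A) (s := s) hC (x := p t) (w := streamWeight A.h t)
    (by positivity)
  have hcard : ((insert (p t) s.fac).card - A.k : ℕ) ≤ ((s.fac.card - A.k : ℕ) : ℝ) + 1 := by
    have := Finset.card_insert_le (p t) s.fac
    exact_mod_cast (by omega)
  have hmono : ∑ x ∈ S, ringPot A (insert (p t) s.fac) (a x) x ≤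
      ∑ x ∈ S, ringPot A s.fac (a x) x :=
    Finset.sum_le_sum fun x _ => ringPot_insert_le hC (ha x) _ _
  have hor := dist_nearest_le_or_ringPot_le hA hS ha hat hC
  have hsum := Finset.sum_eq_sum_Ico_succ_bot hte (ringCharge A.h p S a)
  simp only [critPot, oflUpdate, if_true, Bool.false_eq_true, if_false, hclock]
  rw [hsum]
  set f := A.facilityCost s.guess
  set q := (openProb A s (p t) (streamWeight A.h t) : ℝ)
  set wd := streamWeight A.h t * dist (p t) (nearest s.fac (p t))
  set n' := (((insert (p t) s.fac).card - A.k : ℕ) : ℝ)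
  set n := ((s.fac.card - A.k : ℕ) : ℝ)
  set Ψ' := ∑ x ∈ S, ringPot A (insert (p t) s.fac) (a x) x
  set Ψ := ∑ x ∈ S, ringPot A s.fac (a x) x
  set R := ∑ i ∈ Finset.Ico (t + 1) e, ringCharge A.h p S a i
  set ρ := ringCharge A.h p S a t
  have hρ : 0 ≤ ρ := ringCharge_nonneg _ _ _ ha _
  have hwd : 0 ≤ wd := by positivity
  have hq0 : 0 ≤ q := NNReal.coe_nonneg _
  have hq1 : q ≤ 1 := hprob ▸ min_le_right _ _
  have hqf : q * f ≤ wd := by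
    have : q ≤ wd / f := hprob ▸ min_le_left _ _
    rwa [le_div_iff₀ hf] at this
  have hqf' : (1 - q) * wd ≤ q * f := by
    rcases le_total (wd / f) 1 with h | h
    · have h1 : q = wd / f := by rw [hprob, min_eq_left h]
      have h2 : q * f = wd := by rw [h1, div_mul_cancel₀ _ hf.ne']
      rw [h2]
      nlinarith
    · have h1 : q = 1 := by rw [hprob, min_eq_right h]
      rw [h1]
      linarith
  set u := 1 / A.γ
  set v := 1 / (A.γ - 2)
  have hu : 0 ≤ u := by positivity
  have hv : 0 ≤ v := by positivity
  have hrate : A.failRate = u + v := rfl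
  have h1 : f * n' / (A.γ - 2) ≤ (f * n + f) * v := by
    rw [div_eq_mul_one_div]
    refine mul_le_mul_of_nonneg_right ?_ hv
    nlinarith
  have h2 : q * (f * n' / (A.γ - 2)) ≤ q * ((f * n + f) * v) :=
    mul_le_mul_of_nonneg_left h1 hq0
  rw [hrate, div_eq_mul_one_div s.svc, div_eq_mul_one_div (s.svc + wd),
    div_eq_mul_one_div (f * n)]
  change q * (s.svc * u + f * n' / (A.γ - 2) + (u + v) * (f * Ψ') + 3 * (u + v) * R) +
    (1 - q) * ((s.svc + wd) * u + f * n * v + (u + v) * (f * Ψ) + 3 * (u + v) * R) ≤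
    s.svc * u + f * n * v + (u + v) * (f * Ψ) + 3 * (u + v) * (ρ + R)
  have key : (1 - q) * wd * u + q * f * v + (u + v) * (q * f) * (Ψ' - Ψ) ≤
      3 * (u + v) * ρ := by
    have hqf0 : 0 ≤ (u + v) * (q * f) := by positivity
    rcases hor with h | h
    · have h3 : (u + v) * (q * f) * (Ψ' - Ψ) ≤ 0 :=
        mul_nonpos_of_nonneg_of_nonpos hqf0 (by linarith)
      have h4 : (1 - q) * wd * u ≤ wd * u := by
        refine mul_le_mul_of_nonneg_right ?_ hu
        nlinarith
      have h5 : q * f * v ≤ wd * v := mul_le_mul_of_nonneg_right hqf hv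
      have h6 : (u + v) * wd ≤ (u + v) * (3 * ρ) := mul_le_mul_of_nonneg_left h (by linarith)
      linarith
    · have h3 : (u + v) * (q * f) * (Ψ' - Ψ) ≤ (u + v) * (q * f) * (-1) :=
        mul_le_mul_of_nonneg_left (by linarith) hqf0
      have h4 : (1 - q) * wd * u ≤ q * f * u := mul_le_mul_of_nonneg_right hqf' hu
      have h5 : 0 ≤ 3 * (u + v) * ρ := by positivity
      linarith
  linarith

/-- Probability that a phase with a large guess, which starts at time `T`, ends before time `n`. -/
theorem value_le_critPot {A : Params} (hA : A.Valid) (KM : OfflineKMedian X A.k A.c)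
    {p : ℕ → X} {n : ℕ} {D : ℝ} (hp : BoundedStream p n A.Δ D) {S : Finset X} (hS : S.Nonempty)
    (hSk : S.card ≤ A.k) {G : ℝ} {T : ℕ} (hT0 : 0 < T)
    (hT : 2 * streamCost A.h p n S < A.h * D * streamWeight A.h T) {a : X → ℝ}
    (ha : ∀ x, 0 < a x)
    (haW : ∀ i ∈ Finset.Ico T (min (T + phaseLen A.h A.Δ) n),
        Metric.infDist (p i) (S : Set X) ≤ a (nearest S (p i)) * A.W)
    {m t : ℕ} (hn : t + m = n) {s : State X} (hs : Inv A p D t s) (hv : s.verbatim = false)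
    (ht : t = T + s.count) (hG : s.guess ≤ G) :
    value A KM p (exceeds G) m t s ≤ ENNReal.ofReal
      (critPot A S a (ringCharge A.h p S a) (min (T + phaseLen A.h A.Δ) n) s / s.guess) := by
  set e := min (T + phaseLen A.h A.Δ) n
  set ρ := ringCharge A.h p S a
  have hρ : ∀ i, 0 ≤ ρ i := ringCharge_nonneg _ _ _ ha
  induction m generalizing t s with
  | zero => exact (exceeds_eq_zero hG).trans_le zero_le
  | succ m ih =>
    have hg := hs.one_le_guess
    have hg0 : 0 < s.guess := by linarith
    have hlt := lt_phaseLen (hs.first hv).2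
    have hte : t < e := lt_min (by omega) (by omega)
    have hC := hs.fac_nonempty (by omega)
    have main : ∀ heads : Bool,
        (heads = false → openProb A s (p t) (streamWeight A.h s.clock) < 1) →
        value A KM p (exceeds G) m (t + 1)
          (oflCheck A KM (oflUpdate s (p t) (streamWeight A.h s.clock) heads).record) ≤
        ENNReal.ofReal
          (critPot A S a ρ e (oflUpdate s (p t) (streamWeight A.h s.clock) heads) / s.guess) := by
      intro heads hheads
      have hw := oflUpdate_weakInv hA hp (by omega : t < n) hs hheads
      have hinv := oflCheck_inv hA KM hp.nonneg hw.record rfl (hs.first hv).1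
        (Nat.succ_le_succ (Nat.zero_le _))
      unfold oflCheck at hinv ⊢
      split_ifs at hinv ⊢ with h1 h2
      · refine (value_le_one A KM p (exceeds_le_one G) _ _ _).trans ?_
        rw [← ENNReal.ofReal_one]
        refine ENNReal.ofReal_le_ofReal ?_
        rw [le_div_iff₀ hg0, one_mul]
        exact guess_le_critPot hA S a hρ e hw.svc_nonneg hw.one_le_guess h1
      -- Once the second sub-phase is reached, the phase outlasts the stream. It begins at time `t +
      -- 1`, at least `phaseLen` after the start of the phase.
      · refine le_of_eq_of_le (value_eq_zero_of_verbatim hA KM hp hS hSk hT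
          (by omega : t + 1 + m = n) rfl (by exact hG) (a := t + 1) ?_ le_rfl ?_) zero_le
        · have h3 := phaseLen_le (Nat.succ_le_succ (Nat.zero_le s.count)) h2
          omega
        · rw [Finset.Ico_self, Finset.image_empty]
          exact (hs.first hv).1
      · refine ih (by omega) hinv rfl ?_ hG
        change t + 1 = T + (s.count + 1)
        omega
    simp only [value]
    rw [expect_step_of_not_verbatim A KM (p t) hv]
    have hnn : ∀ heads : Bool,
        0 ≤ critPot A S a ρ e (oflUpdate s (p t) (streamWeight A.h s.clock) heads) / s.guess := by
      intro heads
      refine div_nonneg (critPot_nonneg hA S a hρ e ?_ hg) hg0.le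
      have h1 := hs.svc_nonneg
      have h2 : 0 ≤ streamWeight A.h s.clock * dist (p t) (nearest s.fac (p t)) :=
        mul_nonneg (streamWeight_pos _ _).le dist_nonneg
      cases heads <;> simp only [oflUpdate, if_true, Bool.false_eq_true, if_false] <;> linarith
    refine coin_expect_le (openProb_le_one A s _ _) (hnn true) (hnn false)
      (main true (by simp)) (fun h => main false fun _ => h) ?_
    rw [← mul_div_assoc, ← mul_div_assoc, ← add_div]
    refine div_le_div_of_nonneg_right ?_ hg0.le
    rw [hs.clock_eq]
    exact critPot_step_le hA hS ha hte
      (haW t (Finset.mem_Ico.2 ⟨by omega, hte⟩)) hs.clock_eq hg hC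

/-! ### The guess at the end, from a guess of the order of the cost. -/

/-- The factor by which one phase change can raise the guess above the cost of the centres. -/
def Params.jumpFactor (A : Params) : ℝ := 2 * (A.γ + A.moveFactor + 3)

/-- The clustering competes with `S` on the moved points. Cost of `S`, service cost and earlier
moves are all of order `L`, and so is `lam / (c γ)`. -/
theorem phaseChange_guess_le {A : Params} (hA : A.Valid) (KM : OfflineKMedian X A.k A.c)
    {p : ℕ → X} {n : ℕ} {D : ℝ} {S : Finset X} (hS : S.Nonempty)
    (hSk : S.card ≤ A.k) {t : ℕ} (ht : 0 < t) (htn : t ≤ n) {s : State X}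
    (hs : WeakInv A p D t s) {L : ℝ} (hL : streamCost A.h p n S ≤ L) (hg : s.guess ≤ L) :
    (phaseChange A KM s).guess ≤ A.jumpFactor * L := by
  have hγ := hA.le_γ
  have hc := hA.one_le_c
  have hβ := hA.β_le
  have hβ1 := hA.one_lt_β
  have hmv := hA.moveFactor_nonneg
  have hg1 := hs.one_le_guess
  have hL1 : 1 ≤ L := hg1.trans hg
  rw [phaseChange_guess]
  unfold Params.jumpFactor
  refine max_le (by nlinarith) ?_
  rw [div_le_iff₀ (by positivity)]
  have h1 := hs.solve_cost_le hA KM ht hS hSk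
  have h2 := streamCost_mono A.h p htn S
  have h3 := hs.svc_le_weak
  have h4 : streamCost A.h p t S + s.svc + A.moveFactor * s.guess ≤
      (A.γ + A.moveFactor + 3) * L := by nlinarith
  have h5 : 0 ≤ (A.γ + A.moveFactor + 3) * L := by positivity
  calc _ ≤ 2 * A.c * ((A.γ + A.moveFactor + 3) * L) := h1.trans (by gcongr)
    _ ≤ 2 * A.c * ((A.γ + A.moveFactor + 3) * L) * A.γ :=
        le_mul_of_one_le_right (by positivity) (by linarith)
    _ = _ := by ring

/-- A step either keeps the guess or starts a new phase. -/
theorem step_guess_or {A : Params} (hA : A.Valid) (KM : OfflineKMedian X A.k A.c) {p : ℕ → X}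
    {n : ℕ} {D : ℝ} (hp : BoundedStream p n A.Δ D) {t : ℕ} (htn : t < n) {s s' : State X}
    (hs : Inv A p D t s) (hs' : s' ∈ (step A KM (p t) s).support) :
    s'.guess = s.guess ∨ ∃ s₁, WeakInv A p D (t + 1) s₁ ∧ s₁.guess = s.guess ∧
      A.k ≤ s₁.fac.card ∧ s' = phaseChange A KM s₁ := by
  rcases mem_support_step A KM hs' with ⟨hv, rfl⟩ | ⟨hv, heads, hheads, rfl⟩
  · have hw := (storeUpdate_weakInv hp.nonneg hs).record
    unfold storeCheck
    split_ifs with h1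
    · refine Or.inr ⟨_, hw, rfl, ?_, rfl⟩
      have h2 := Finset.card_le_card hw.seen_subset
      have h3 : (A.k : ℝ) ≤
          ((storeUpdate s (p t) (streamWeight A.h s.clock)).record.seen.card : ℝ) := by
        linarith [hA.h_pos]
      exact (by exact_mod_cast h3 : A.k ≤ _).trans h2
    · exact Or.inl rfl
  · have hw := (oflUpdate_weakInv hA hp htn hs hheads).record
    unfold oflCheck
    split_ifs with h1 h2
    · exact Or.inr ⟨_, hw, rfl, hw.le_card_of_overflow hA h1, rfl⟩
    · exact Or.inl rfl
    · exact Or.inl rfl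

/-- After a time from which on second sub-phases of new phases are too expensive, a guess of order
of the cost remains so with probability at least one half. -/
theorem value_le_half {A : Params} (hA : A.Valid) (KM : OfflineKMedian X A.k A.c)
    {p : ℕ → X} {n : ℕ} {D : ℝ} (hp : BoundedStream p n A.Δ D) {S : Finset X} (hS : S.Nonempty)
    (hSk : S.card ≤ A.k) (hO : 0 < streamCost A.h p n S) {T₀ : ℕ}
    (hT₀ : ∀ T, T₀ < T → T ≤ n → 2 * streamCost A.h p n S < A.h * D * streamWeight A.h T)
    {m t : ℕ} (hn : t + m = n) (ht : T₀ ≤ t) {s : State X} (hs : Inv A p D t s)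
    (hg : s.guess ≤ 16 * streamCost A.h p n S) :
    value A KM p (exceeds (A.jumpFactor * (16 * streamCost A.h p n S))) m t s ≤
      ENNReal.ofReal (1 / 2) := by
  set O := streamCost A.h p n S
  have hγ := hA.le_γ
  have hmv := hA.moveFactor_nonneg
  have hjump : 1 ≤ A.jumpFactor := by
    unfold Params.jumpFactor
    linarith
  induction m generalizing t s with
  | zero =>
    have hG : s.guess ≤ A.jumpFactor * (16 * O) :=
      hg.trans (le_mul_of_one_le_left (by positivity) hjump)
    exact (exceeds_eq_zero hG).trans_le zero_le
  | succ m ih =>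
    simp only [value]
    refine (expect_mono (g₂ := fun _ => ENNReal.ofReal (1 / 2)) fun s' hs' => ?_).trans
      (expect_const _ _).le
    have hinv := step_inv hA KM hp (by omega) hs hs'
    -- Only the first guess above `16 * O` matters. It starts a new phase, and it suffices that this
    -- phase lasts until the end of the stream.
    by_cases hg' : s'.guess ≤ 16 * O
    · exact ih (by omega) (by omega) hinv hg'
    · rcases step_guess_or hA KM hp (by omega) hs hs' with h | ⟨s₁, hw, hgs, hk, rfl⟩
      · exact absurd (h ▸ hg) hg'
      · have hT := hT₀ (t + 1) (by omega) (by omega)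
        obtain ⟨a, ha, haW, hasum⟩ := exists_cluster_scale hA p n (t + 1) hS hSk hO
        have hG := phaseChange_guess_le hA KM hS hSk (Nat.succ_pos t) (by omega : t + 1 ≤ n) hw
          (by linarith : O ≤ 16 * O) (hgs ▸ hg)
        refine (value_le_critPot hA KM hp hS hSk (Nat.succ_pos t) hT ha haW (by omega) hinv rfl
          rfl hG).trans (ENNReal.ofReal_le_ofReal ?_)
        have hg1 := hinv.one_le_guess
        have hg0 : 0 < (phaseChange A KM s₁).guess := by linarith
        rw [not_le] at hg'
        rw [div_le_iff₀ hg0]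
        set L := (phaseChange A KM s₁).guess
        set e := min (t + 1 + phaseLen A.h A.Δ) n
        have hcard : (phaseChange A KM s₁).fac.card - A.k = 0 := by
          rw [phaseChange_fac, KM.solve_card, min_eq_left hk, Nat.sub_self]
        have hsvc : (phaseChange A KM s₁).svc = 0 := rfl
        have hclock : (phaseChange A KM s₁).clock = t + 1 := hw.clock_eq
        -- The facility cost is chosen for this: at most `k` centres with `1 + log₂ W` halvings each
        -- are worth at most `L`.
        have hring : A.facilityCost L * ∑ x ∈ S, ringPot A (phaseChange A KM s₁).fac (a x) x ≤
            L := by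
          have h1 : ∑ x ∈ S, ringPot A (phaseChange A KM s₁).fac (a x) x ≤ A.kap := by
            refine (Finset.sum_le_card_nsmul S _ A.logFactor fun x _ => min_le_left _ _).trans ?_
            rw [nsmul_eq_mul]
            have : (S.card : ℝ) ≤ A.k := by exact_mod_cast hSk
            exact mul_le_mul_of_nonneg_right this (by linarith [hA.one_le_logFactor])
          rw [A.facilityCost_eq, div_mul_eq_mul_div, div_le_iff₀ hA.kap_pos]
          exact mul_le_mul_of_nonneg_left h1 hg0.le
        have hrem : ∑ i ∈ Finset.Ico (t + 1) e, ringCharge A.h p S a i ≤ 3 * O := by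
          unfold ringCharge
          simp only [mul_add, Finset.sum_add_distrib]
          have h1 : ∑ i ∈ Finset.Ico (t + 1) e,
              streamWeight A.h i * Metric.infDist (p i) (S : Set X) ≤ O := by
            refine Finset.sum_le_sum_of_subset_of_nonneg (fun i hi => ?_) fun i _ _ =>
              mul_nonneg (streamWeight_pos _ _).le Metric.infDist_nonneg
            have := (Finset.mem_Ico.1 hi).2
            exact Finset.mem_range.2 (by omega)
          linarith
        -- For `γ ≥ 9` the rate is at most `1/9 + 1/7`. The initial potential is then at most
        -- `(16/63) (L + 9 O)`, and `16 O < L` brings it to at most `(25/63) L`, below `L / 2`.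
        have hrate : A.failRate ≤ 16 / 63 := by
          unfold Params.failRate
          have h1 : 1 / A.γ ≤ 1 / 9 := one_div_le_one_div_of_le (by norm_num) hγ
          have h2 : 1 / (A.γ - 2) ≤ 1 / 7 :=
            one_div_le_one_div_of_le (by norm_num) (by linarith)
          linarith
        have hrate0 := hA.failRate_nonneg
        unfold critPot
        rw [hcard, hsvc, hclock, Nat.cast_zero, mul_zero, zero_div, zero_div, zero_add, zero_add]
        have h1 := mul_le_mul_of_nonneg_left hring hrate0
        have h2 := mul_le_mul_of_nonneg_left hrem (by linarith : 0 ≤ 3 * A.failRate)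
        have h3 : A.failRate * (L + 9 * O) ≤ 16 / 63 * (L + 9 * O) :=
          mul_le_mul_of_nonneg_right hrate (by linarith)
        change A.failRate * (A.facilityCost L *
          ∑ x ∈ S, ringPot A (phaseChange A KM s₁).fac (a x) x) + _ ≤ _
        linarith

end Algorithm

/-! ### The guess in the long run -/

/-- Least number of time units that a phase takes unless its first sub-phase is cut short. -/
def Params.period (A : Params) : ℝ := phaseLen A.h A.Δ + A.h

/-- Upper bound for the total cost of the points read before time `t`, discounted at the rate of
doubling once per period. -/
def costScale (A : Params) (D : ℝ) (t : ℕ) : ℝ :=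
  A.h * D * streamWeight A.h t * (2 : ℝ) ^ (-(t : ℝ) / A.period)

section Scale

variable {A : Params}

theorem Params.Valid.period_pos (hA : A.Valid) : 0 < A.period :=
  add_pos_of_nonneg_of_pos (Nat.cast_nonneg _) hA.h_pos

theorem costScale_nonneg (hA : A.Valid) {D : ℝ} (hD : 0 ≤ D) (t : ℕ) : 0 ≤ costScale A D t := by
  have := hA.h_pos
  have := streamWeight_pos A.h t
  unfold costScale
  positivity

/-- Per step the weight gains `1 / h` in the exponent of 2 and the discount takes `1 / period`. The
difference is `phaseLen / (h * period)`, and this net growth pays for the random openings. -/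
theorem costScale_add_le (hA : A.Valid) {D : ℝ} (hD : 0 ≤ D) (t : ℕ) :
    costScale A D t + costScale A D t * (Real.log 2 * (phaseLen A.h A.Δ / (A.h * A.period))) ≤
      costScale A D (t + 1) := by
  have hh := hA.h_pos
  have hN := hA.period_pos
  have h1 : costScale A D (t + 1) =
      costScale A D t * (2 : ℝ) ^ ((phaseLen A.h A.Δ : ℝ) / (A.h * A.period)) := by
    unfold costScale
    rw [streamWeight_succ]
    have h2 : (2 : ℝ) ^ (1 / A.h) * (2 : ℝ) ^ (-((t + 1 : ℕ) : ℝ) / A.period) =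
        (2 : ℝ) ^ (-(t : ℝ) / A.period) *
          (2 : ℝ) ^ ((phaseLen A.h A.Δ : ℝ) / (A.h * A.period)) := by
      rw [← Real.rpow_add (by norm_num), ← Real.rpow_add (by norm_num)]
      congr 1
      have h3 : (phaseLen A.h A.Δ : ℝ) = A.period - A.h := by
        unfold Params.period
        ring
      rw [h3]
      push_cast
      field_simp
      ring
    calc _ = A.h * D * streamWeight A.h t *
          ((2 : ℝ) ^ (1 / A.h) * (2 : ℝ) ^ (-((t + 1 : ℕ) : ℝ) / A.period)) := by ring
      _ = _ := by rw [h2]; ring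
  rw [h1]
  have h2 := log_two_mul_le ((phaseLen A.h A.Δ : ℝ) / (A.h * A.period))
  have h3 := mul_le_mul_of_nonneg_left h2 (costScale_nonneg hA hD t)
  linarith

theorem costScale_le_succ (hA : A.Valid) {D : ℝ} (hD : 0 ≤ D) (t : ℕ) :
    costScale A D t ≤ costScale A D (t + 1) := by
  have h1 := costScale_add_le hA hD t
  have h2 := costScale_nonneg hA hD t
  have h3 : 0 ≤ Real.log 2 * (phaseLen A.h A.Δ / (A.h * A.period)) := by
    have := hA.h_pos
    have := hA.period_pos
    have := Real.log_nonneg (by norm_num : (1 : ℝ) ≤ 2)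
    positivity
  nlinarith [mul_nonneg h2 h3]

theorem costScale_mono (hA : A.Valid) {D : ℝ} (hD : 0 ≤ D) : Monotone (costScale A D) :=
  monotone_nat_of_le_succ (costScale_le_succ hA hD)

end Scale

/-! ### Credit for opened facilities -/

/-- Credit for `n` facilities opened among the first `j` points of a phase. It is at least one if
`n` is so large that the phase ends. -/
def credit (A : Params) (n j : ℕ) : ℝ :=
  if (phaseLen A.h A.Δ : ℝ) < A.h then
    n * (n - 1) / ((A.γ - 2) * A.kap * ((A.γ - 2) * A.kap - 1)) +
      n * (phaseLen A.h A.Δ - j) / (21 * A.kap * A.h)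
  else n / ((A.γ - 2) * A.kap)

/-- Expected growth of the credit, per unit of opening probability. -/
def creditRate (A : Params) : ℝ :=
  if (phaseLen A.h A.Δ : ℝ) < A.h then phaseLen A.h A.Δ / (21 * A.kap * A.h)
  else 1 / (7 * A.kap)

section Credit

variable {A : Params}

theorem credit_zero (A : Params) (j : ℕ) : credit A 0 j = 0 := by
  unfold credit
  split_ifs <;> simp

theorem credit_mono (hA : A.Valid) {n n' j : ℕ} (hn : n ≤ n') (hj : j ≤ phaseLen A.h A.Δ) :
    credit A n j ≤ credit A n' j := by
  have hκ := hA.one_le_kap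
  have hγ := hA.le_γ
  have hh := hA.h_pos
  have hm : 7 ≤ (A.γ - 2) * A.kap := by nlinarith
  have hn' : (n : ℝ) ≤ n' := by exact_mod_cast hn
  have hj' : (j : ℝ) ≤ phaseLen A.h A.Δ := by exact_mod_cast hj
  unfold credit
  split_ifs
  · refine add_le_add ?_ ?_
    · refine div_le_div_of_nonneg_right ?_ (by nlinarith)
      rcases Nat.eq_zero_or_pos n with rfl | h0
      · rcases Nat.eq_zero_or_pos n' with rfl | h0'
        · simp
        · have : (1 : ℝ) ≤ n' := by exact_mod_cast h0'
          simp only [Nat.cast_zero, zero_mul]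
          nlinarith
      · have : (1 : ℝ) ≤ n := by exact_mod_cast h0
        nlinarith
    · refine div_le_div_of_nonneg_right ?_ (by positivity)
      exact mul_le_mul_of_nonneg_right hn' (by linarith)
  · refine div_le_div_of_nonneg_right hn' (by linarith)

theorem credit_nonneg (hA : A.Valid) {n j : ℕ} (hj : j ≤ phaseLen A.h A.Δ) :
    0 ≤ credit A n j := by
  rw [← credit_zero A j]
  exact credit_mono hA (Nat.zero_le n) hj

theorem one_le_credit (hA : A.Valid) {n j : ℕ} (hj : j ≤ phaseLen A.h A.Δ)
    (hn : (A.γ - 2) * A.kap ≤ n) : 1 ≤ credit A n j := by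
  have hκ := hA.one_le_kap
  have hγ := hA.le_γ
  have hh := hA.h_pos
  have hm : 7 ≤ (A.γ - 2) * A.kap := by nlinarith
  have hj' : (j : ℝ) ≤ phaseLen A.h A.Δ := by exact_mod_cast hj
  unfold credit
  split_ifs
  · have h1 : 1 ≤ (n : ℝ) * (n - 1) / ((A.γ - 2) * A.kap * ((A.γ - 2) * A.kap - 1)) := by
      rw [one_le_div (by nlinarith)]
      nlinarith
    have h2 : 0 ≤ (n : ℝ) * (phaseLen A.h A.Δ - j) / (21 * A.kap * A.h) :=
      div_nonneg (mul_nonneg (Nat.cast_nonneg _) (by linarith)) (by positivity)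
    linarith
  · rwa [one_le_div (by linarith)]

/-- Linear credit suffices when `phaseLen` is at least `h`. For shorter sub-phases `costScale` grows
too slowly for it; but then a sub-phase opens on average fewer than `κ` charged facilities if `q ≤ κ
/ h`, and the quadratic credit, a second-moment bound, gains a factor of order `phaseLen / h`. Its
increment `2 n` at an opening is prepaid by the term `n (phaseLen - j)`, which decreases with every
point. -/
theorem credit_step_le (hA : A.Valid) {n n' j : ℕ} (hn : n' ≤ n + 1)
    (hj : j + 1 ≤ phaseLen A.h A.Δ) {q : ℝ} (hq0 : 0 ≤ q)
    (hq : q ≤ A.kap / A.h) :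
    q * credit A n' (j + 1) + (1 - q) * credit A n (j + 1) - credit A n j ≤
      q * creditRate A := by
  have hκ := hA.one_le_kap
  have hγ := hA.le_γ
  have hh := hA.h_pos
  have h1 := mul_le_mul_of_nonneg_left (credit_mono hA hn hj) hq0
  suffices h : q * credit A (n + 1) (j + 1) + (1 - q) * credit A n (j + 1) - credit A n j ≤
      q * creditRate A by linarith
  have hm : 7 * A.kap ≤ (A.γ - 2) * A.kap := by nlinarith
  unfold credit creditRate
  split_ifs with hM
  · set m := (A.γ - 2) * A.kap
    set M := (phaseLen A.h A.Δ : ℝ)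
    set κ := A.kap
    -- Since `m ≥ 7 κ` and `κ ≥ 1`, also `m - 1 ≥ 6 κ`. This is the origin of the constant 21 in the
    -- credit.
    have hm2 : 42 * κ ^ 2 ≤ m * (m - 1) := by nlinarith
    have hm0 : 0 < m * (m - 1) := by nlinarith
    have h2 : q * (2 * n / (m * (m - 1))) ≤ n / (21 * κ * A.h) := by
      have h3 : 2 * (n : ℝ) / (m * (m - 1)) ≤ 2 * n / (42 * κ ^ 2) := by
        gcongr
      calc q * (2 * n / (m * (m - 1))) ≤ κ / A.h * (2 * n / (42 * κ ^ 2)) := by gcongr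
        _ = n / (21 * κ * A.h) := by
          field_simp
          ring
    have h4 : q * (((n + 1 : ℕ) : ℝ) * ((n + 1 : ℕ) - 1) / (m * (m - 1)) +
          ((n + 1 : ℕ) : ℝ) * (M - (j + 1 : ℕ)) / (21 * κ * A.h)) +
        (1 - q) * ((n : ℝ) * (n - 1) / (m * (m - 1)) +
          (n : ℝ) * (M - (j + 1 : ℕ)) / (21 * κ * A.h)) -
        ((n : ℝ) * (n - 1) / (m * (m - 1)) + (n : ℝ) * (M - j) / (21 * κ * A.h)) =
        q * (2 * n / (m * (m - 1))) - n / (21 * κ * A.h) +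
          q * (M / (21 * κ * A.h)) - q * ((j + 1) / (21 * κ * A.h)) := by
      push_cast
      field_simp
      ring
    rw [h4]
    have h5 : 0 ≤ q * (((j : ℝ) + 1) / (21 * κ * A.h)) := by positivity
    linarith
  · have h2 : 1 / ((A.γ - 2) * A.kap) ≤ 1 / (7 * A.kap) :=
      one_div_le_one_div_of_le (by positivity) hm
    have h3 : q * (((n + 1 : ℕ) : ℝ) / ((A.γ - 2) * A.kap)) +
        (1 - q) * ((n : ℝ) / ((A.γ - 2) * A.kap)) - (n : ℝ) / ((A.γ - 2) * A.kap) =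
        q * (1 / ((A.γ - 2) * A.kap)) := by
      push_cast
      ring
    rw [h3]
    exact mul_le_mul_of_nonneg_left h2 hq0

theorem creditRate_nonneg (hA : A.Valid) : 0 ≤ creditRate A := by
  have hκ := hA.one_le_kap
  have hh := hA.h_pos
  unfold creditRate
  split_ifs <;> positivity

/-- If `phaseLen < h`, then `period < 2 h` and `2/21 ≤ (log 2) / 2` suffices; otherwise `phaseLen`
is at least half of `period` and `2/7 ≤ (log 2) / 2` suffices. -/
theorem two_mul_creditRate_le (hA : A.Valid) :
    2 * (A.kap / A.h * creditRate A) ≤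
      Real.log 2 * (phaseLen A.h A.Δ / (A.h * A.period)) := by
  have hκ := hA.one_le_kap
  have hh := hA.h_pos
  have hlog := Real.log_two_gt_d9
  have hN := hA.period_pos
  have hM : (1 : ℝ) ≤ phaseLen A.h A.Δ := by exact_mod_cast one_le_phaseLen A.h A.Δ
  have hper : A.period = phaseLen A.h A.Δ + A.h := rfl
  unfold creditRate
  split_ifs with h
  · have h1 : 2 * (A.kap / A.h * (phaseLen A.h A.Δ / (21 * A.kap * A.h))) =
        phaseLen A.h A.Δ / A.h * (2 / 21 / A.h) := by
      field_simp
    have h2 : Real.log 2 * (phaseLen A.h A.Δ / (A.h * A.period)) =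
        phaseLen A.h A.Δ / A.h * (Real.log 2 / A.period) := by
      field_simp
    rw [h1, h2]
    refine mul_le_mul_of_nonneg_left ?_ (by positivity)
    rw [div_le_div_iff₀ hh hN]
    nlinarith
  · have h1 : 2 * (A.kap / A.h * (1 / (7 * A.kap))) = 1 / A.h * (2 / 7) := by
      field_simp
    have h2 : Real.log 2 * (phaseLen A.h A.Δ / (A.h * A.period)) =
        1 / A.h * (Real.log 2 * phaseLen A.h A.Δ / A.period) := by
      field_simp
    rw [h1, h2]
    refine mul_le_mul_of_nonneg_left ?_ (by positivity)
    rw [le_div_iff₀ hN]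
    nlinarith

end Credit

/-! ### Truncated excess with credit. -/

/-- Excess of `b` over `y`, with credit `c` towards the excess of `β b`. -/
def excess (β b y c : ℝ) : ℝ := max 0 (b - y) + c * min ((β - 1) * b) (max 0 (β * b - y))

section Excess

variable {β b y c : ℝ}

theorem excess_weight_nonneg (hβ : 1 ≤ β) (hb : 0 ≤ b) :
    0 ≤ min ((β - 1) * b) (max 0 (β * b - y)) :=
  le_min (mul_nonneg (by linarith) hb) (le_max_left _ _)

theorem max_le_excess (hβ : 1 ≤ β) (hb : 0 ≤ b) (hc : 0 ≤ c) : max 0 (b - y) ≤ excess β b y c :=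
  le_add_of_nonneg_right (mul_nonneg hc (excess_weight_nonneg hβ hb))

theorem excess_nonneg (hβ : 1 ≤ β) (hb : 0 ≤ b) (hc : 0 ≤ c) : 0 ≤ excess β b y c :=
  (le_max_left _ _).trans (max_le_excess hβ hb hc)

theorem excess_anti {y' : ℝ} (hc : 0 ≤ c) (hy : y ≤ y') : excess β b y' c ≤ excess β b y c := by
  unfold excess
  gcongr

/-- The weight of the credit is exactly the increase of the truncated excess when `b` is replaced by
`β b`; full credit therefore pays for such a jump. -/
theorem max_mul_le_excess (hβ : 1 ≤ β) (hb : 0 ≤ b) (hc : 1 ≤ c) :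
    max 0 (β * b - y) ≤ excess β b y c := by
  have h0 := excess_weight_nonneg (y := y) hβ hb
  have h1 : max 0 (β * b - y) ≤ max 0 (b - y) + min ((β - 1) * b) (max 0 (β * b - y)) := by
    rcases le_total b y with h | h
    · rw [max_eq_left (by linarith : b - y ≤ 0), zero_add]
      exact le_min (max_le (mul_nonneg (by linarith) hb) (by linarith)) le_rfl
    · have h2 : 0 ≤ (β - 1) * b := mul_nonneg (by linarith) hb
      rw [max_eq_right (by linarith : 0 ≤ b - y), max_eq_right (by linarith : 0 ≤ β * b - y),
        min_eq_left (by linarith)]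
      linarith
  unfold excess
  nlinarith

end Excess

/-! ### The long-run potential and the guess up to the critical time. -/

section Algorithm

variable {X : Type u} [MetricSpace X] [DecidableEq X]

/-- The guess, discounted to the start of the phase (or earlier). -/
def discountedGuess (A : Params) (s : State X) : ℝ :=
  s.guess * (2 : ℝ) ^ (-((s.clock : ℝ) - s.count - s.seen.card) / A.period)

/-- Potential that bounds the discounted guess from above, up to a multiple of the scale of the
costs. -/
def longRunPot (A : Params) (D : ℝ) (s : State X) : ℝ :=
  excess A.β (discountedGuess A s) (4 * costScale A D s.clock)
    (if s.verbatim then 0 else credit A (s.fac.card - A.k) s.count)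

theorem discountedGuess_nonneg {A : Params} {s : State X} (hs : 1 ≤ s.guess) :
    0 ≤ discountedGuess A s := by
  unfold discountedGuess
  positivity

/-- The discounted guess after a phase change, compared with the discounted guess before. -/
theorem longRunPot_phaseChange_le {A : Params} (hA : A.Valid) (KM : OfflineKMedian X A.k A.c)
    {p : ℕ → X} {n : ℕ} {D : ℝ} (hp : BoundedStream p n A.Δ D) {t : ℕ} (ht : 0 < t) (htn : t ≤ n)
    {s : State X} (hs : WeakInv A p D t s) (hk : A.k ≤ s.fac.card) :
    longRunPot A D (phaseChange A KM s) ≤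
      max 0 (A.β * s.guess * (2 : ℝ) ^ (-(t : ℝ) / A.period) - 4 * costScale A D t) := by
  have hγ := hA.le_γ
  have hc := hA.one_le_c
  have hcard : (phaseChange A KM s).fac.card - A.k = 0 := by
    rw [phaseChange_fac, KM.solve_card, min_eq_left hk, Nat.sub_self]
  have hclock : (phaseChange A KM s).clock = t := hs.clock_eq
  have hpow : (0 : ℝ) < (2 : ℝ) ^ (-(t : ℝ) / A.period) := by positivity
  have hscale := costScale_nonneg hA hp.nonneg t
  have hdisc : discountedGuess A (phaseChange A KM s) =
      (phaseChange A KM s).guess * (2 : ℝ) ^ (-(t : ℝ) / A.period) := by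
    unfold discountedGuess
    rw [hclock]
    simp [phaseChange]
  unfold longRunPot excess
  rw [hcard, hclock, credit_zero, ite_self, zero_mul, add_zero, hdisc]
  refine max_le (le_max_left _ _) ?_
  rw [phaseChange_guess, max_mul_of_nonneg _ _ hpow.le, sub_le_iff_le_add]
  set y := A.β * s.guess * (2 : ℝ) ^ (-(t : ℝ) / A.period)
  have hy₁ := le_max_left 0 (y - 4 * costScale A D t)
  have hy₂ := le_max_right 0 (y - 4 * costScale A D t)
  refine max_le (by linarith) ?_
  have h1 := hs.solve_cost_le_sum hA KM hp ht htn
  have h2 := mul_le_mul_of_nonneg_left (sum_streamWeight_le hA.h_pos t) hp.nonneg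
  -- With a single centre all points cost at most `D` times the total weight, hence at most `2 h D
  -- w_t`. So this candidate for the new guess stays below the threshold `4 * costScale`.
  have h3 : medianCost s.fac s.wt (KM.solve s.fac s.wt) / (A.c * A.γ) ≤
      A.h * D * streamWeight A.h t := by
    rw [div_le_iff₀ (by positivity)]
    have h4 : 0 ≤ A.h * D * streamWeight A.h t :=
      mul_nonneg (mul_nonneg hA.h_pos.le hp.nonneg) (streamWeight_pos _ _).le
    calc _ ≤ A.c * (2 * (A.h * D * streamWeight A.h t)) := h1.trans (by
          refine mul_le_mul_of_nonneg_left ?_ (by linarith)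
          linarith)
      _ ≤ A.c * (A.γ * (A.h * D * streamWeight A.h t)) := by
          gcongr
          linarith
      _ = _ := by ring
  have h5 : medianCost s.fac s.wt (KM.solve s.fac s.wt) / (A.c * A.γ) *
      (2 : ℝ) ^ (-(t : ℝ) / A.period) ≤ costScale A D t := by
    unfold costScale
    gcongr
  linarith

/-- Repeated points shift the reference time `clock - count - seen.card` forward, which only lowers
the discounted guess. When the sub-phase is completed, at least one period has passed since the
reference time, and the discount by one half offsets `β ≤ 2`. -/
theorem longRunPot_verbatim_le {A : Params} (hA : A.Valid) (KM : OfflineKMedian X A.k A.c)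
    {p : ℕ → X} {n : ℕ} {D : ℝ} (hp : BoundedStream p n A.Δ D) {t : ℕ} (htn : t < n)
    {s : State X} (hs : Inv A p D t s) (hv : s.verbatim = true) :
    longRunPot A D (storeCheck A KM (storeUpdate s (p t) (streamWeight A.h s.clock)).record) ≤
      longRunPot A D s := by
  have hw := (storeUpdate_weakInv hp.nonneg hs).record
  have hN := hA.period_pos
  have hscale := costScale_le_succ hA hp.nonneg t
  have hg := hs.one_le_guess
  have hseen : ((insert (p t) s.seen).card : ℝ) ≤ s.seen.card + 1 := by
    exact_mod_cast Finset.card_insert_le (p t) s.seen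
  have hpot : longRunPot A D s = max 0 (discountedGuess A s - 4 * costScale A D t) := by
    unfold longRunPot excess
    rw [hs.clock_eq, if_pos hv, zero_mul, add_zero]
  unfold storeCheck
  split_ifs with h1
  · have hk : A.k ≤ (storeUpdate s (p t) (streamWeight A.h s.clock)).record.fac.card := by
      have h2 := Finset.card_le_card hw.seen_subset
      have h3 : (A.k : ℝ) ≤
          ((storeUpdate s (p t) (streamWeight A.h s.clock)).record.seen.card : ℝ) := by
        linarith [hA.h_pos]
      exact (by exact_mod_cast h3 : A.k ≤ _).trans h2
    refine (longRunPot_phaseChange_le hA KM hp (Nat.succ_pos t) htn hw hk).trans ?_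
    rw [hpot]
    change max 0 (A.β * s.guess * _ - _) ≤ _
    refine max_le_max le_rfl (sub_le_sub ?_ (by linarith))
    unfold discountedGuess
    rw [hs.clock_eq]
    have h2 : ((t + 1 : ℕ) : ℝ) ≥ A.period + ((t : ℝ) - s.count - s.seen.card) := by
      have h3 : (phaseLen A.h A.Δ : ℝ) ≤ s.count := by
        exact_mod_cast phaseLen_le (hs.second hv).1 (hs.second hv).2
      have h4 : A.h + A.k ≤ ((insert (p t) s.seen).card : ℝ) := h1
      have h5 : (0 : ℝ) ≤ A.k := Nat.cast_nonneg _
      unfold Params.period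
      push_cast
      linarith
    have h3 : A.β * (2 : ℝ) ^ (-((t + 1 : ℕ) : ℝ) / A.period) ≤
        (2 : ℝ) ^ (-((t : ℝ) - s.count - s.seen.card) / A.period) := by
      have h4 : (2 : ℝ) ^ (-((t : ℝ) - s.count - s.seen.card) / A.period) ≥
          (2 : ℝ) ^ (1 + -((t + 1 : ℕ) : ℝ) / A.period) := by
        refine Real.rpow_le_rpow_of_exponent_le (by norm_num) ?_
        rw [← sub_nonneg]
        have h5 : -((t : ℝ) - s.count - s.seen.card) / A.period -
            (1 + -((t + 1 : ℕ) : ℝ) / A.period) =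
            (((t + 1 : ℕ) : ℝ) - (A.period + ((t : ℝ) - s.count - s.seen.card))) / A.period := by
          field_simp
          ring
        rw [h5]
        exact div_nonneg (by linarith) hN.le
      rw [Real.rpow_add (by norm_num), Real.rpow_one] at h4
      refine le_trans ?_ h4
      exact mul_le_mul_of_nonneg_right hA.β_le (by positivity)
    calc A.β * s.guess * (2 : ℝ) ^ (-((t + 1 : ℕ) : ℝ) / A.period) =
        s.guess * (A.β * (2 : ℝ) ^ (-((t + 1 : ℕ) : ℝ) / A.period)) := by ring
      _ ≤ _ := mul_le_mul_of_nonneg_left h3 (by linarith)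
  · rw [hpot]
    unfold longRunPot excess
    rw [hw.clock_eq, if_pos (show (storeUpdate s (p t) (streamWeight A.h s.clock)).record.verbatim
      = true from hv), zero_mul, add_zero]
    refine max_le_max le_rfl (sub_le_sub ?_ (by linarith))
    unfold discountedGuess
    rw [hw.clock_eq, hs.clock_eq]
    refine mul_le_mul_of_nonneg_left ?_ (by linarith : 0 ≤ s.guess)
    refine Real.rpow_le_rpow_of_exponent_le (by norm_num) ?_
    refine div_le_div_of_nonneg_right ?_ hN.le
    change -(((t + 1 : ℕ) : ℝ) - s.count - ((insert (p t) s.seen).card : ℝ)) ≤ _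
    push_cast
    linarith

/-- The potential after a point of the first sub-phase, in terms of the credit. -/
theorem longRunPot_oflCheck_le {A : Params} (hA : A.Valid) (KM : OfflineKMedian X A.k A.c)
    {p : ℕ → X} {n : ℕ} {D : ℝ} (hp : BoundedStream p n A.Δ D) {t : ℕ} (htn : t < n)
    {s : State X} (hs : Inv A p D t s) (hv : s.verbatim = false) {heads : Bool}
    (hheads : heads = false → openProb A s (p t) (streamWeight A.h s.clock) < 1) :
    longRunPot A D
        (oflCheck A KM (oflUpdate s (p t) (streamWeight A.h s.clock) heads).record) ≤
      excess A.β (discountedGuess A s) (4 * costScale A D t)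
        (credit A ((oflUpdate s (p t) (streamWeight A.h s.clock) heads).fac.card - A.k)
          (s.count + 1)) := by
  have hw := (oflUpdate_weakInv hA hp htn hs hheads).record
  set s₁ := (oflUpdate s (p t) (streamWeight A.h s.clock) heads) with hs₁
  have hN := hA.period_pos
  have hβ := hA.one_lt_β
  have hγ := hA.le_γ
  have hg := hs.one_le_guess
  have hscale := costScale_le_succ hA hp.nonneg t
  have hj : s.count + 1 ≤ phaseLen A.h A.Δ := lt_phaseLen (hs.first hv).2
  have hcr := credit_nonneg hA (n := s₁.fac.card - A.k) hj
  have hb := discountedGuess_nonneg (A := A) hg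
  have hdisc : discountedGuess A s₁.record = discountedGuess A s := by
    unfold discountedGuess
    rw [hw.clock_eq, hs.clock_eq]
    change s.guess * (2 : ℝ) ^ (-(((t + 1 : ℕ) : ℝ) - (s.count + 1 : ℕ) - s.seen.card) / A.period)
      = _
    push_cast
    ring_nf
  unfold oflCheck
  split_ifs with h1 h2
  · refine (longRunPot_phaseChange_le hA KM hp (Nat.succ_pos t) htn hw
      (hw.le_card_of_overflow hA h1)).trans ?_
    change max 0 (A.β * s.guess * (2 : ℝ) ^ (-((t + 1 : ℕ) : ℝ) / A.period) - _) ≤ _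
    rcases h1 with h1 | h1
    -- Service overflow: the service cost is at most `2 h D w`, so the old guess is small enough for
    -- `β L` to lie below the threshold.
    · have h2 : A.γ * s.guess < 2 * (A.h * D * streamWeight A.h (t + 1)) := by
        refine lt_of_lt_of_le h1 (hw.svc_le_sum.trans ?_)
        have := mul_le_mul_of_nonneg_left (sum_streamWeight_le hA.h_pos (t + 1)) hp.nonneg
        linarith
      have h3 : A.β * s.guess ≤ 4 * (A.h * D * streamWeight A.h (t + 1)) := by
        have := hA.β_le
        nlinarith
      have h4 : A.β * s.guess * (2 : ℝ) ^ (-((t + 1 : ℕ) : ℝ) / A.period) ≤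
          4 * costScale A D (t + 1) := by
        unfold costScale
        rw [← mul_assoc 4]
        exact mul_le_mul_of_nonneg_right h3 (by positivity)
      rw [max_eq_left (by linarith)]
      exact excess_nonneg hβ.le hb hcr
    -- Facility overflow: the charged facilities have completed the credit, which pays for the
    -- factor `β`; no discount is needed.
    · have hc1 : 1 ≤ credit A (s₁.fac.card - A.k) (s.count + 1) := by
        refine one_le_credit hA hj ?_
        rw [mul_assoc] at h1
        change (A.γ - 1) * A.kap < (s₁.fac.card : ℝ) at h1
        have h2 := hA.k_le_kap
        have h3 : (s₁.fac.card : ℝ) - A.k ≤ (s₁.fac.card - A.k : ℕ) := by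
          rw [sub_le_iff_le_add]
          exact_mod_cast (by omega)
        linarith
      refine le_trans ?_ (max_mul_le_excess hβ.le hb hc1)
      refine max_le_max le_rfl (sub_le_sub ?_ (by linarith))
      unfold discountedGuess
      rw [mul_assoc]
      refine mul_le_mul_of_nonneg_left ?_ (by linarith)
      refine mul_le_mul_of_nonneg_left ?_ (by linarith)
      refine Real.rpow_le_rpow_of_exponent_le (by norm_num) ?_
      refine div_le_div_of_nonneg_right ?_ hN.le
      rw [hs.clock_eq]
      have h2 : (0 : ℝ) ≤ s.count := Nat.cast_nonneg _
      have h3 : (0 : ℝ) ≤ s.seen.card := Nat.cast_nonneg _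
      push_cast
      linarith
  · have h3 : longRunPot A D { s₁.record with verbatim := true } =
        max 0 (discountedGuess A s₁.record - 4 * costScale A D s₁.record.clock) := by
      unfold longRunPot excess
      simp only [if_true, zero_mul, add_zero]
      rfl
    rw [h3, hdisc, hw.clock_eq]
    exact (max_le_max le_rfl (by linarith)).trans (max_le_excess hβ.le hb hcr)
  · have h3 : longRunPot A D s₁.record = excess A.β (discountedGuess A s)
        (4 * costScale A D (t + 1)) (credit A (s₁.fac.card - A.k) (s.count + 1)) := by
      rw [← hdisc]
      unfold longRunPot
      rw [hw.clock_eq, if_neg (by simp [hs₁, State.record, oflUpdate])]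
      rfl
    rw [h3]
    exact excess_anti hcr (by linarith)

/-- The expected growth of the potential in the first sub-phase. -/
theorem excess_step_le {A : Params} (hA : A.Valid)
    {p : ℕ → X} {n : ℕ} {D : ℝ} (hp : BoundedStream p n A.Δ D) {t : ℕ} (htn : t < n)
    {s : State X} (hs : Inv A p D t s) (hv : s.verbatim = false) {q : ℝ}
    (hq : q = openProb A s (p t) (streamWeight A.h s.clock)) :
    q * excess A.β (discountedGuess A s) (4 * costScale A D t)
        (credit A ((insert (p t) s.fac).card - A.k) (s.count + 1)) +
      (1 - q) * excess A.β (discountedGuess A s) (4 * costScale A D t)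
        (credit A (s.fac.card - A.k) (s.count + 1)) ≤
      longRunPot A D s + (costScale A D (t + 1) - costScale A D t) := by
  have hN := hA.period_pos
  have hβ := hA.one_lt_β
  have hβ2 := hA.β_le
  have hκ := hA.one_le_kap
  have hh := hA.h_pos
  have hg := hs.one_le_guess
  have hscale := costScale_le_succ hA hp.nonneg t
  have hscale' := costScale_add_le hA hp.nonneg t
  have hscale0 := costScale_nonneg hA hp.nonneg t
  have hj : s.count + 1 ≤ phaseLen A.h A.Δ := lt_phaseLen (hs.first hv).2
  have hb := discountedGuess_nonneg (A := A) hg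
  have hq0 : 0 ≤ q := hq ▸ NNReal.coe_nonneg _
  have hpot : longRunPot A D s = excess A.β (discountedGuess A s) (4 * costScale A D t)
      (credit A (s.fac.card - A.k) s.count) := by
    unfold longRunPot
    rw [hs.clock_eq, if_neg (by simp [hv])]
  rw [hpot]
  unfold excess
  set b := discountedGuess A s with hbdef
  set ψ := costScale A D t with hψ
  set g := min ((A.β - 1) * b) (max 0 (A.β * b - 4 * ψ)) with hgdef
  have hg0 : 0 ≤ g := excess_weight_nonneg hβ.le hb
  set c₁ := credit A ((insert (p t) s.fac).card - A.k) (s.count + 1)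
  set c₀ := credit A (s.fac.card - A.k) (s.count + 1)
  set c := credit A (s.fac.card - A.k) s.count
  suffices h : g * (q * c₁ + (1 - q) * c₀ - c) ≤ costScale A D (t + 1) - ψ by linarith
  -- The first point opens with certainty, but up to `k` facilities carry no credit.
  rcases s.fac.eq_empty_or_nonempty with hC | hC
  · have h1 : c₁ = 0 := by
      simp only [c₁, hC]
      have : (insert (p t) (∅ : Finset X)).card - A.k = 0 := by
        have := hA.k_pos
        simp only [insert_empty_eq, Finset.card_singleton]
        omega
      rw [this, credit_zero]
    have h2 : c₀ = 0 := by simp only [c₀, hC, Finset.card_empty, Nat.zero_sub, credit_zero]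
    have h3 : c = 0 := by simp only [c, hC, Finset.card_empty, Nat.zero_sub, credit_zero]
    rw [h1, h2, h3]
    linarith
  rcases hg0.eq_or_lt with hg0' | hg0'
  · rw [← hg0', zero_mul]
    linarith
  set Z := A.h * D * streamWeight A.h t
  have hZ0 : 0 ≤ Z := mul_nonneg (mul_nonneg hh.le hp.nonneg) (streamWeight_pos _ _).le
  set E := (2 : ℝ) ^ (-((t : ℝ) - s.count - s.seen.card) / A.period)
  have hE : 0 < E := by positivity
  have hbE : b = s.guess * E := by
    simp only [hbdef, discountedGuess, hs.clock_eq]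
    rfl
  -- The phase began at most one period ago, so `E` is at most twice the discount at time `t`.
  have hZE : Z * E ≤ 2 * ψ := by
    have h1 : E ≤ 2 * (2 : ℝ) ^ (-(t : ℝ) / A.period) := by
      have h2 : E ≤ (2 : ℝ) ^ (1 + -(t : ℝ) / A.period) := by
        refine Real.rpow_le_rpow_of_exponent_le (by norm_num) ?_
        rw [(hs.first hv).1, Finset.card_empty, Nat.cast_zero, sub_zero, div_le_iff₀ hN, add_mul,
          div_mul_cancel₀ _ hN.ne']
        have h3 : (s.count : ℝ) ≤ phaseLen A.h A.Δ := by exact_mod_cast (by omega)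
        unfold Params.period
        linarith
      rwa [Real.rpow_add (by norm_num), Real.rpow_one] at h2
    calc Z * E ≤ Z * (2 * (2 : ℝ) ^ (-(t : ℝ) / A.period)) := by gcongr
      _ = 2 * ψ := by
        simp only [hψ, costScale, Z]
        ring
  -- Credit has positive weight only if `β b > 4 ψ`. With `β ≤ 2` this gives `b > 2 ψ ≥ Z E`, so the
  -- guess is at least `Z`, which makes the opening probability at most `κ / h`.
  have hZg : Z ≤ s.guess := by
    have h1 : 0 < A.β * b - 4 * ψ := by
      by_contra hcon
      rw [hgdef, max_eq_left (not_lt.1 hcon)] at hg0'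
      exact absurd (hg0'.trans_le (min_le_right _ _)) (lt_irrefl _)
    have h2 : Z * E ≤ s.guess * E := by
      rw [← hbE]
      nlinarith
    exact le_of_mul_le_mul_right h2 hE
  have hqZ : q ≤ A.kap / A.h * (Z / s.guess) := by
    have h1 : 0 ≤ streamWeight A.h s.clock * dist (p t) (nearest s.fac (p t)) /
        A.facilityCost s.guess :=
      div_nonneg (mul_nonneg (streamWeight_pos _ _).le dist_nonneg)
        (hA.facilityCost_pos (by linarith)).le
    have h2 := openProb_le (A := A) hC h1
    rw [← hq, hs.clock_eq] at h2
    obtain ⟨i, hi, hi'⟩ := hs.fac_eq_or (nearest_mem hC (p t))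
    have h3 : dist (p t) (nearest s.fac (p t)) ≤ D := by
      rw [← hi']
      exact hp.dist_le t htn i (by omega)
    calc q ≤ streamWeight A.h t * dist (p t) (nearest s.fac (p t)) / A.facilityCost s.guess := h2
      _ ≤ streamWeight A.h t * D / A.facilityCost s.guess := by
          have := (streamWeight_pos A.h t).le
          have := (hA.facilityCost_pos (L := s.guess) (by linarith)).le
          gcongr
      _ = A.kap / A.h * (Z / s.guess) := by
          rw [A.facilityCost_eq]
          simp only [Z]
          field_simp
  have hq1 : q ≤ A.kap / A.h := by
    refine hqZ.trans (mul_le_of_le_one_right (by positivity) ?_)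
    rw [div_le_one (by linarith)]
    exact hZg
  have hstep := credit_step_le hA (n := s.fac.card - A.k) (n' := (insert (p t) s.fac).card - A.k)
    (by have := Finset.card_insert_le (p t) s.fac
        omega) hj hq0 hq1
  have hgb : g ≤ b := (min_le_left _ _).trans (by nlinarith)
  have hcr := creditRate_nonneg hA
  have hrate := two_mul_creditRate_le hA
  have hgq : g * q ≤ A.kap / A.h * (2 * ψ) := by
    calc g * q ≤ b * (A.kap / A.h * (Z / s.guess)) := by gcongr
      _ = A.kap / A.h * (Z * E) := by
          rw [hbE]
          have : s.guess ≠ 0 := by linarith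
          field_simp
      _ ≤ _ := by gcongr
  calc g * (q * c₁ + (1 - q) * c₀ - c) ≤ g * (q * creditRate A) :=
        mul_le_mul_of_nonneg_left hstep hg0
    _ = g * q * creditRate A := by ring
    _ ≤ A.kap / A.h * (2 * ψ) * creditRate A := mul_le_mul_of_nonneg_right hgq hcr
    _ = ψ * (2 * (A.kap / A.h * creditRate A)) := by ring
    _ ≤ ψ * (Real.log 2 * (phaseLen A.h A.Δ / (A.h * A.period))) :=
        mul_le_mul_of_nonneg_left hrate hscale0
    _ ≤ _ := by linarith

theorem longRunPot_nonneg {A : Params} (hA : A.Valid) {p : ℕ → X} {D : ℝ} {t : ℕ} {s : State X}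
    (hs : Inv A p D t s) : 0 ≤ longRunPot A D s := by
  refine excess_nonneg hA.one_lt_β.le (discountedGuess_nonneg hs.one_le_guess) ?_
  split_ifs with hv
  · exact le_rfl
  · exact credit_nonneg hA (lt_phaseLen (hs.first (by simpa using hv)).2).le

/-- Up to a time `T` at which the total cost of all points is at most of the order of the cost of
`S`, the guess does not exceed this order, with probability at least three quarters. -/
theorem value_le_longRunPot {A : Params} (hA : A.Valid) (KM : OfflineKMedian X A.k A.c)
    {p : ℕ → X} {n : ℕ} {D : ℝ} (hD : 0 < D) (hp : BoundedStream p n A.Δ D) {S : Finset X}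
    (hS : S.Nonempty) (hSk : S.card ≤ A.k) (hO : 0 < streamCost A.h p n S) {T : ℕ} (hTn : T ≤ n)
    (hT : A.h * D * streamWeight A.h T ≤ 2 * streamCost A.h p n S)
    (hT' : ∀ T', T < T' → T' ≤ n → 2 * streamCost A.h p n S < A.h * D * streamWeight A.h T')
    {j t : ℕ} (hj : t + j = T) {s : State X} (hs : Inv A p D t s) :
    value A KM p (exceeds (A.jumpFactor * (16 * streamCost A.h p n S))) (n - t) t s ≤
      ENNReal.ofReal (1 / 2 + (longRunPot A D s + (costScale A D T - costScale A D t)) /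
        (4 * costScale A D T)) := by
  have hh := hA.h_pos
  have hscale : 0 < costScale A D T := by
    have := streamWeight_pos A.h T
    unfold costScale
    positivity
  induction j generalizing t s with
  | zero =>
    rw [add_zero] at hj
    subst hj
    rw [sub_self, add_zero]
    have hnn := longRunPot_nonneg hA hs
    by_cases hg : s.guess ≤ 16 * streamCost A.h p n S
    · refine (value_le_half hA KM hp hS hSk hO hT' (by omega) le_rfl hs hg).trans ?_
      refine ENNReal.ofReal_le_ofReal ?_
      have : 0 ≤ longRunPot A D s / (4 * costScale A D t) := by positivity
      linarith
    · refine (value_le_one A KM p (exceeds_le_one _) _ _ _).trans ?_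
      rw [← ENNReal.ofReal_one]
      refine ENNReal.ofReal_le_ofReal ?_
      rw [not_le] at hg
      have h1 : s.guess * (2 : ℝ) ^ (-(t : ℝ) / A.period) ≤ discountedGuess A s := by
        unfold discountedGuess
        refine mul_le_mul_of_nonneg_left ?_ (by linarith [hs.one_le_guess])
        refine Real.rpow_le_rpow_of_exponent_le (by norm_num) ?_
        refine div_le_div_of_nonneg_right ?_ hA.period_pos.le
        rw [hs.clock_eq]
        have h2 : (0 : ℝ) ≤ s.count := Nat.cast_nonneg _
        have h3 : (0 : ℝ) ≤ s.seen.card := Nat.cast_nonneg _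
        linarith
      -- By the choice of `T`, a guess above `16 O` is above `8 h D w_T`. The excess over `4 *
      -- costScale` is then at least `4 * costScale`, the denominator in Markov's inequality.
      have h2 : 8 * costScale A D t ≤ s.guess * (2 : ℝ) ^ (-(t : ℝ) / A.period) := by
        unfold costScale
        rw [← mul_assoc 8]
        refine mul_le_mul_of_nonneg_right ?_ (by positivity)
        linarith
      have h3 : discountedGuess A s - 4 * costScale A D t ≤ longRunPot A D s := by
        unfold longRunPot
        rw [hs.clock_eq]
        refine (le_max_right 0 _).trans (max_le_excess hA.one_lt_β.le
          (discountedGuess_nonneg hs.one_le_guess) ?_)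
        split_ifs with hv
        · exact le_rfl
        · exact credit_nonneg hA (lt_phaseLen (hs.first (by simpa using hv)).2).le
      have h4 : 1 ≤ longRunPot A D s / (4 * costScale A D t) := by
        rw [one_le_div (by positivity)]
        linarith
      linarith
  | succ j ih =>
    have hmono : costScale A D (t + 1) ≤ costScale A D T :=
      costScale_mono hA hp.nonneg (by omega)
    rw [show n - t = (n - (t + 1)) + 1 by omega]
    simp only [value]
    cases hv : s.verbatim with
    | true =>
      have h1 := longRunPot_verbatim_le hA KM hp (by omega) hs hv
      have h2 := costScale_le_succ hA hp.nonneg t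
      have hmem : storeCheck A KM (storeUpdate s (p t) (streamWeight A.h s.clock)).record ∈
          (step A KM (p t) s).support := by
        rw [step_of_verbatim A KM (p t) hv, PMF.support_pure]
        rfl
      rw [expect_step_of_verbatim A KM (p t) hv]
      refine (ih (by omega) (step_inv hA KM hp (by omega) hs hmem)).trans
        (ENNReal.ofReal_le_ofReal ?_)
      gcongr
    | false =>
      have hseen := (hs.first hv).1
      have hjl : s.count + 1 ≤ phaseLen A.h A.Δ := lt_phaseLen (hs.first hv).2
      rw [expect_step_of_not_verbatim A KM (p t) hv]
      have hnn : ∀ m : ℕ, 0 ≤ 1 / 2 + (excess A.β (discountedGuess A s) (4 * costScale A D t)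
          (credit A m (s.count + 1)) + (costScale A D T - costScale A D (t + 1))) /
          (4 * costScale A D T) := by
        intro m
        have h1 := excess_nonneg (y := 4 * costScale A D t) hA.one_lt_β.le
          (discountedGuess_nonneg (A := A) hs.one_le_guess) (credit_nonneg hA (n := m) hjl)
        have h2 : 0 ≤ costScale A D T - costScale A D (t + 1) := by linarith
        positivity
      have main : ∀ heads : Bool,
          (heads = false → openProb A s (p t) (streamWeight A.h s.clock) < 1) →
          value A KM p (exceeds (A.jumpFactor * (16 * streamCost A.h p n S))) (n - (t + 1)) (t + 1)
            (oflCheck A KM (oflUpdate s (p t) (streamWeight A.h s.clock) heads).record) ≤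
          ENNReal.ofReal (1 / 2 + (excess A.β (discountedGuess A s) (4 * costScale A D t)
            (credit A ((oflUpdate s (p t) (streamWeight A.h s.clock) heads).fac.card - A.k)
              (s.count + 1)) + (costScale A D T - costScale A D (t + 1))) /
            (4 * costScale A D T)) := by
        intro heads hheads
        have hinv := oflCheck_inv hA KM hp.nonneg
          (oflUpdate_weakInv hA hp (by omega : t < n) hs hheads).record rfl hseen
          (Nat.succ_le_succ (Nat.zero_le _))
        refine (ih (by omega) hinv).trans (ENNReal.ofReal_le_ofReal ?_)
        have := longRunPot_oflCheck_le hA KM hp (by omega : t < n) hs hv hheads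
        gcongr
      refine coin_expect_le (openProb_le_one A s _ _) (hnn _) (hnn _)
        (main true (by simp)) (fun h => main false fun _ => h) ?_
      have hstep := excess_step_le hA hp (by omega : t < n) hs hv rfl
      simp only [oflUpdate, if_true, Bool.false_eq_true, if_false]
      set q := (openProb A s (p t) (streamWeight A.h s.clock) : ℝ)
      set x₁ := excess A.β (discountedGuess A s) (4 * costScale A D t)
        (credit A ((insert (p t) s.fac).card - A.k) (s.count + 1))
      set x₀ := excess A.β (discountedGuess A s) (4 * costScale A D t)
        (credit A (s.fac.card - A.k) (s.count + 1))
      calc _ = 1 / 2 + (q * x₁ + (1 - q) * x₀ + (costScale A D T - costScale A D (t + 1))) /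
            (4 * costScale A D T) := by ring
        _ ≤ _ := by
          refine add_le_add le_rfl (div_le_div_of_nonneg_right ?_ (by positivity))
          linarith

/-- The probability that the guess of one instance becomes too large. -/
theorem value_init_le {A : Params} (hA : A.Valid) (KM : OfflineKMedian X A.k A.c)
    {p : ℕ → X} {n : ℕ} {D : ℝ} (hD : 1 ≤ D) (hp : BoundedStream p n A.Δ D) {S : Finset X}
    (hS : S.Nonempty) (hSk : S.card ≤ A.k) (hO : 1 / 2 ≤ streamCost A.h p n S) :
    value A KM p (exceeds (A.jumpFactor * (16 * streamCost A.h p n S))) n 0 (State.init X) ≤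
      ENNReal.ofReal (3 / 4) := by
  set O := streamCost A.h p n S with hOdef
  have hh := hA.h_pos
  have hinv := init_inv hA p D
  -- If there is no such time, all phases are late ones, and the analysis after `T` applies from the
  -- start because the initial guess 1 is at most `16 * O`.
  by_cases hex : ∃ T ≤ n, A.h * D * streamWeight A.h T ≤ 2 * O
  · obtain ⟨T, ⟨hTn, hT⟩, hmax⟩ : ∃ T, (T ≤ n ∧ A.h * D * streamWeight A.h T ≤ 2 * O) ∧
        ∀ T', T < T' → T' ≤ n → 2 * O < A.h * D * streamWeight A.h T' := by
      classical
      obtain ⟨T₀, hT₀n, hT₀⟩ := hex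
      refine ⟨Nat.findGreatest (fun T => A.h * D * streamWeight A.h T ≤ 2 * O) n,
        ⟨Nat.findGreatest_le _, Nat.findGreatest_spec
          (P := fun T => A.h * D * streamWeight A.h T ≤ 2 * O) hT₀n hT₀⟩, fun T' h1 h2 => ?_⟩
      exact not_le.1 (Nat.findGreatest_is_greatest h1 h2)
    have h1 := value_le_longRunPot hA KM (by linarith) hp hS hSk (by linarith) hTn hT hmax
      (t := 0) (zero_add T) hinv
    rw [Nat.sub_zero] at h1
    refine h1.trans (ENNReal.ofReal_le_ofReal ?_)
    have hscale : 0 < costScale A D T := by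
      have := streamWeight_pos A.h T
      unfold costScale
      positivity
    have hscale0 := costScale_nonneg hA hp.nonneg 0
    have hpot : longRunPot A D (State.init X) = 0 := by
      have h2 : discountedGuess A (State.init X) = 1 := by simp [discountedGuess, State.init]
      -- By the tangent bound `h * 2 ^ (1 / h) ≥ log 2`, and `D ≥ 1`; so the initial guess has no
      -- excess.
      have h3 : 1 ≤ 4 * costScale A D 0 := by
        have h4 : Real.log 2 ≤ A.h * streamWeight A.h 0 := by
          have h5 := log_two_mul_le (1 / A.h)
          have h6 : streamWeight A.h 0 = (2 : ℝ) ^ (1 / A.h) := by simp [streamWeight]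
          rw [h6]
          have h7 := mul_le_mul_of_nonneg_left h5 hh.le
          have h8 : A.h * (Real.log 2 * (1 / A.h)) = Real.log 2 := by field_simp
          linarith
        have h5 := Real.log_two_gt_d9
        have h6 : costScale A D 0 = A.h * streamWeight A.h 0 * D := by
          simp [costScale]
          ring
        rw [h6]
        nlinarith
      have h4 : (State.init X).fac.card - A.k = 0 := by simp [State.init]
      unfold longRunPot excess
      rw [h2, h4, credit_zero, ite_self, zero_mul, add_zero]
      exact max_eq_left (sub_nonpos.2 h3)
    rw [hpot]
    have h2 : (0 + (costScale A D T - costScale A D 0)) / (4 * costScale A D T) ≤ 1 / 4 := by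
      rw [div_le_iff₀ (by positivity)]
      linarith
    linarith
  · push Not at hex
    refine (value_le_half hA KM hp hS hSk (by linarith) (T₀ := 0)
      (fun T _ hT => hex T hT) (zero_add n) le_rfl hinv ?_).trans
      (ENNReal.ofReal_le_ofReal (by norm_num))
    change (1 : ℝ) ≤ _
    linarith

end Algorithm

section Algorithm

variable {X : Type u} [MetricSpace X] [DecidableEq X]

/-! ### The output -/

theorem WeakInv.solve_card {A : Params} (KM : OfflineKMedian X A.k A.c) {p : ℕ → X} {D : ℝ}
    {t : ℕ} {s : State X} (hs : WeakInv A p D t s) :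
    (KM.solve s.fac s.wt).card = min A.k ((Finset.range t).image p).card := by
  rw [KM.solve_card]
  rcases hs.all_or with ⟨h, _, _⟩ | h
  · rw [h]
  · rw [min_eq_left h, min_eq_left (h.trans (Finset.card_le_card hs.fac_subset))]

theorem streamCost_image_eq_zero (h : ℝ) (p : ℕ → X) (n : ℕ) :
    streamCost h p n ((Finset.range n).image p) = 0 := by
  refine Finset.sum_eq_zero fun i hi => ?_
  rw [Metric.infDist_zero_of_mem (Finset.mem_coe.2 (Finset.mem_image_of_mem p hi)), mul_zero]

/-- Cost of the output of an instance in terms of its guess. -/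
theorem Inv.streamCost_solve_le {A : Params} (hA : A.Valid) (KM : OfflineKMedian X A.k A.c)
    {p : ℕ → X} {n : ℕ} {D : ℝ} (hn : 0 < n) {s : State X} (hs : Inv A p D n s) {S : Finset X}
    (hS : S.Nonempty) (hSk : S.card ≤ A.k) :
    streamCost A.h p n (KM.solve s.fac s.wt) ≤
      (1 + 2 * A.c) * (A.γ + A.moveFactor) * s.guess + 2 * A.c * streamCost A.h p n S := by
  have h1 := hs.solve_cost_le hA KM hn hS hSk
  obtain ⟨g, hg, hgf, hmv⟩ := hs.assign
  have h2 := hg.streamCost_le hgf p (KM.solve s.fac s.wt)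
  have h3 := hs.svc_le
  have hc := hA.one_le_c
  have h4 : (1 + 2 * A.c) * (s.svc + A.moveFactor * s.guess) ≤
      (1 + 2 * A.c) * (A.γ * s.guess + A.moveFactor * s.guess) := by gcongr
  linarith

theorem output_of_argmin {k : ℕ} {c : ℝ} (KM : OfflineKMedian X k c) {l : List (State X)}
    {s : State X} (hs : l.argmin State.guess = some s) :
    output KM l = KM.solve s.fac s.wt := by
  unfold output
  rw [hs]

/-- The approximation factor. -/
def Params.approxFactor (A : Params) : ℝ :=
  2 * ((1 + 2 * A.c) * (A.γ + A.moveFactor) * (A.jumpFactor * 16) + 2 * A.c)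

theorem three_quarters_pow_le {δ : ℝ} (hδ : 0 < δ) {r : ℕ}
    (hr : 1 / Real.log (4 / 3) * Real.log (1 / δ) ≤ r) : (3 / 4 : ℝ) ^ r ≤ δ := by
  have hlog : 0 < Real.log (4 / 3) := Real.log_pos (by norm_num)
  rw [← Real.log_le_log_iff (by positivity) hδ, Real.log_pow,
    show (3 / 4 : ℝ) = (4 / 3)⁻¹ by norm_num, Real.log_inv]
  rw [one_div, one_div, Real.log_inv, inv_mul_le_iff₀ hlog] at hr
  linarith

/-- A single instance with a guess of at most `G` suffices, since the one used has the smallest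
guess. The product of the indicators `exceeds G` is the event that all instances fail. -/
theorem output_prob_ge {A : Params} (hA : A.Valid) (KM : OfflineKMedian X A.k A.c)
    {p : ℕ → X} {n : ℕ} (hn : 0 < n) (hasp : AspectRatioLE p n A.Δ) {δ : ℝ} (hδ : 0 < δ)
    (hδ' : δ < 1) {r : ℕ} (hr : 1 / Real.log (4 / 3) * Real.log (1 / δ) ≤ r) :
    ENNReal.ofReal (1 - δ) ≤ (run A KM p r n).toOuterMeasure
      {l | (output KM l).Nonempty ∧
        (output KM l).card = min A.k ((Finset.range n).image p).card ∧
        streamCost A.h p n (output KM l) ≤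
          A.approxFactor * medianOpt A.k Set.univ (streamCost A.h p n)} := by
  obtain ⟨D, hp⟩ := hasp.exists_boundedStream hn
  have hc := hA.one_le_c
  have hγ := hA.le_γ
  have hmv := hA.moveFactor_nonneg
  have hjump : 0 ≤ A.jumpFactor := by
    unfold Params.jumpFactor
    positivity
  have hr0 : 0 < r := by
    have h1 : 0 < 1 / Real.log (4 / 3) * Real.log (1 / δ) :=
      mul_pos (one_div_pos.2 (Real.log_pos (by norm_num)))
        (Real.log_pos (by rw [lt_div_iff₀ hδ]; linarith))
    exact_mod_cast h1.trans_le hr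
  have himg : 0 < ((Finset.range n).image p).card :=
    Finset.card_pos.2 ⟨p 0, Finset.mem_image_of_mem p (Finset.mem_range.2 hn)⟩
  have hrun : ∀ l ∈ (run A KM p r n).support, ∃ s, l.argmin State.guess = some s ∧
      Inv A p D n s ∧ output KM l = KM.solve s.fac s.wt ∧ (output KM l).Nonempty ∧
      (output KM l).card = min A.k ((Finset.range n).image p).card := by
    intro l hl
    obtain ⟨hlen, hall⟩ := mem_support_run A KM p r n (Q := Inv A p D) (init_inv hA p D)
      (fun t ht s hs s' hs' => step_inv hA KM hp ht hs hs') hl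
    cases hs : l.argmin State.guess with
    | none =>
      rw [List.argmin_eq_none] at hs
      subst hs
      simp only [List.length_nil] at hlen
      omega
    | some s =>
      have hinv := hall s (List.argmin_mem hs)
      have hcard := hinv.solve_card KM
      have hout := output_of_argmin KM hs
      refine ⟨s, rfl, hinv, hout, ?_, hout ▸ hcard⟩
      rw [hout, ← Finset.card_pos, hcard]
      exact lt_min hA.k_pos himg
  have hsub : ENNReal.ofReal (1 - δ) = 1 - ENNReal.ofReal δ := by
    rw [ENNReal.ofReal_sub _ hδ.le, ENNReal.ofReal_one]
  rw [hsub]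
  -- With at most `k` distinct points the output consists of all of them and costs nothing, in every
  -- outcome.
  by_cases hk : ((Finset.range n).image p).card ≤ A.k
  · refine one_sub_le_toOuterMeasure _ _ (g := fun _ => 0) (fun l hl hnot => ?_)
      ((expect_const _ _).trans_le zero_le)
    refine absurd ?_ hnot
    obtain ⟨s, hs, hinv, hout, hne, hcard⟩ := hrun l hl
    refine ⟨hne, hcard, ?_⟩
    have h1 : output KM l = (Finset.range n).image p := by
      refine Finset.eq_of_subset_of_card_le ?_ (by rw [hcard, min_eq_right hk])
      rw [hout]
      exact (KM.solve_subset _ _).trans hinv.fac_subset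
    rw [h1, streamCost_image_eq_zero]
    refine mul_nonneg (by unfold Params.approxFactor; positivity) (Real.sInf_nonneg ?_)
    rintro _ ⟨K, _, rfl⟩
    exact streamCost_nonneg _ _ _ _
  · rw [not_le] at hk
    have hD : 1 ≤ D := by
      obtain ⟨x, hx, y, hy, hxy⟩ := Finset.one_lt_card.1 (lt_of_le_of_lt hA.k_pos hk)
      obtain ⟨i, hi, rfl⟩ := Finset.mem_image.1 hx
      obtain ⟨j, hj, rfl⟩ := Finset.mem_image.1 hy
      exact (hp.one_le_dist i (Finset.mem_range.1 hi) j (Finset.mem_range.1 hj) hxy).trans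
        (hp.dist_le i (Finset.mem_range.1 hi) j (Finset.mem_range.1 hj))
    -- The infimum need not be attained, but it is at least 1/2, hence positive, so some `S` comes
    -- within a factor of two.
    obtain ⟨S, hS, hSk, hSopt⟩ : ∃ S : Finset X, S.Nonempty ∧ S.card ≤ A.k ∧
        streamCost A.h p n S ≤ 2 * medianOpt A.k Set.univ (streamCost A.h p n) := by
      have hne : (streamCost A.h p n '' {K : Finset X | K.Nonempty ∧ K.card ≤ A.k ∧
          (K : Set X) ⊆ Set.univ}).Nonempty :=
        ⟨_, {p 0}, ⟨Finset.singleton_nonempty _,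
          by rw [Finset.card_singleton]; exact hA.k_pos, Set.subset_univ _⟩, rfl⟩
      have hlow : 1 / 2 ≤ medianOpt A.k Set.univ (streamCost A.h p n) := by
        refine le_csInf hne ?_
        rintro _ ⟨K, ⟨h1, h2, _⟩, rfl⟩
        exact hp.half_le_streamCost hA.h_pos hk h1 h2
      obtain ⟨_, ⟨K, ⟨h1, h2, _⟩, rfl⟩, h3⟩ := exists_lt_of_csInf_lt hne
        (show sInf _ < 2 * medianOpt A.k Set.univ (streamCost A.h p n) by
          change medianOpt A.k Set.univ (streamCost A.h p n) < _
          linarith)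
      exact ⟨K, h1, h2, h3.le⟩
    have hO := hp.half_le_streamCost hA.h_pos hk hS hSk
    set O := streamCost A.h p n S
    set G := A.jumpFactor * (16 * O) with hG
    refine one_sub_le_toOuterMeasure _ _ (g := fun l => (l.map (exceeds G)).prod)
      (fun l hl hnot => ?_) ?_
    · refine le_of_eq (List.prod_eq_one fun y hy => ?_).symm
      obtain ⟨s', hs', rfl⟩ := List.mem_map.1 hy
      refine if_pos ?_
      by_contra hle
      rw [not_lt] at hle
      refine hnot ?_
      obtain ⟨s, hs, hinv, hout, hne, hcard⟩ := hrun l hl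
      refine ⟨hne, hcard, ?_⟩
      have h1 : s.guess ≤ G := (List.le_of_mem_argmin hs' hs).trans hle
      have h2 := hinv.streamCost_solve_le hA KM hn hS hSk
      rw [hout]
      have h3 : (1 + 2 * A.c) * (A.γ + A.moveFactor) * s.guess ≤
          (1 + 2 * A.c) * (A.γ + A.moveFactor) * G := by gcongr
      have h4 : 0 ≤ (1 + 2 * A.c) * (A.γ + A.moveFactor) * (A.jumpFactor * 16) + 2 * A.c := by
        positivity
      calc _ ≤ (1 + 2 * A.c) * (A.γ + A.moveFactor) * G + 2 * A.c * O := by linarith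
        _ = ((1 + 2 * A.c) * (A.γ + A.moveFactor) * (A.jumpFactor * 16) + 2 * A.c) * O := by
            rw [hG]
            ring
        _ ≤ ((1 + 2 * A.c) * (A.γ + A.moveFactor) * (A.jumpFactor * 16) + 2 * A.c) *
            (2 * medianOpt A.k Set.univ (streamCost A.h p n)) :=
            mul_le_mul_of_nonneg_left hSopt h4
        _ = _ := by
            unfold Params.approxFactor
            ring
    · rw [expect_run]
      have h1 := value_init_le hA KM hD hp hS hSk hO
      calc _ ≤ (ENNReal.ofReal (3 / 4)) ^ r := pow_le_pow_left' h1 r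
        _ = ENNReal.ofReal ((3 / 4) ^ r) := (ENNReal.ofReal_pow (by norm_num) r).symm
        _ ≤ _ := ENNReal.ofReal_le_ofReal (three_quarters_pow_le hδ hr)

end Algorithm

end ExpDecay

end

open ExpDecay in
theorem theorem3 (β γ c : ℝ) (hβ₁ : 1 < β) (hβ₂ : β ≤ 2) (hγ : 9 ≤ γ) (hc : 1 ≤ c) :
    ∃ K a : ℝ, 0 < K ∧ 0 < a ∧ ∀ ω : ℝ, 0 < ω → ∃ R : ℝ, 0 < R ∧
      ∀ (X : Type u) [MetricSpace X] [DecidableEq X] (k : ℕ) (h Δ W : ℝ)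
        (KM : OfflineKMedian X k c) (p : ℕ → X) (n : ℕ),
        0 < k → 0 < h → 1 ≤ Δ → phaseWeight h Δ ≤ W → W ≤ ω * (h * Δ) →
        0 < n → AspectRatioLE p n Δ →
        -- approximation with probability at least `1 - δ`, with `O(log (1 / δ))` instances
        (∀ δ : ℝ, 0 < δ → δ < 1 → ∀ r : ℕ, a * Real.log (1 / δ) ≤ r →
          ENNReal.ofReal (1 - δ) ≤
            (run ⟨k, h, Δ, W, β, γ, c⟩ KM p r n).toOuterMeasure
              {l | (output KM l).Nonempty ∧
                (output KM l).card = min k ((Finset.range n).image p).card ∧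
                streamCost h p n (output KM l) ≤
                  K * medianOpt k Set.univ (streamCost h p n)}) ∧
        -- time and space of `r` instances, in every outcome
        (∀ r : ℕ, 1 ≤ r → ∀ l ∈ (run ⟨k, h, Δ, W, β, γ, c⟩ KM p r n).support,
          ∀ τ : ℝ, 0 ≤ τ →
          ((∀ S w, (KM.time S w : ℝ) ≤ τ * (k * S.card)) →
            (totalTime KM l : ℝ) ≤
              R * (1 + τ) * r * (n * k * Real.logb 2 (2 + h * Δ))) ∧
          ((∀ S w, (KM.space S w : ℝ) ≤ τ * S.card) →
            (totalSpace KM l : ℝ) ≤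
              R * (1 + τ) * r * (k * Real.logb 2 (2 + h * Δ) + h))) := by
  -- The factors depend only on `β`, `γ` and `c`; the entries 1 for the other parameters are
  -- placeholders, so `K` is chosen before `k`, `h`, `Δ` and `W`.
  have hmv : 0 ≤ (⟨1, 1, 1, 1, β, γ, c⟩ : Params).moveFactor := by
    unfold Params.moveFactor
    have : 0 < β - 1 := by linarith
    positivity
  refine ⟨(⟨1, 1, 1, 1, β, γ, c⟩ : Params).approxFactor, 1 / Real.log (4 / 3), ?_,
    one_div_pos.2 (Real.log_pos (by norm_num)), fun ω hω => ⟨resourceConst γ ω, ?_, ?_⟩⟩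
  · unfold Params.approxFactor Params.jumpFactor
    positivity
  · unfold resourceConst logRatio
    positivity
  · intro X _ _ k h Δ W KM p n hk hh hΔ hW hWω hn hasp
    have hA : (⟨k, h, Δ, W, β, γ, c⟩ : Params).Valid := ⟨hk, hh, hΔ, hW, hβ₁, hβ₂, hγ, hc⟩
    obtain ⟨D, hp⟩ := hasp.exists_boundedStream hn
    refine ⟨fun δ hδ hδ' r hr => output_prob_ge hA KM hn hasp hδ hδ' hr, fun r hr l hl τ hτ =>
      ⟨fun hKM => totalTime_le hA hω hWω hτ hKM hn hp hr hl,
        fun hKM => totalSpace_le hA hω hWω hτ hKM hp hr hl⟩⟩
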